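/- Let $1\le n\le 6$ be an integer, $c\in\mathbb R$, $\omega>0$, $\nu=\omega^{1/2}$, and consider in the channel $0\le y\le 1$ the flow $u_n(t,y)=\cos(\omega t)\,(c-|y-\tfrac12|^n)$. Let the vertical position $Y$ of a tracer be a reflected Brownian motion on $[0,1]$, $dY_t=dB_t+dL^0_t-dL^1_t$, where $B$ is a standard Brownian motion relative to some filtration, $Y$ is adapted with an arbitrary starting point in $[0,1]$, and $L^0,L^1$ are the adapted, continuous, nondecreasing local-time terms, started from $0$, which grow only when $Y=0$, respectively $Y=1$. Let $X_t=\int_0^t u_n(s,Y_s)\,ds$ be the horizontal displacement. Then $E[X_t^2]<\infty$ for all $t\ge 0$, and the Taylor dispersivity $\mathcal D=\lim_{t\to\infty}E[X_t^2]/t$ exists and equals $D_n(\nu)$ given below; in particular it does not depend on the constant $c$. Moreover, the problem $\tfrac12 f_{yy}+f_t=u_n(t,y)-\int_0^1u_n(t,\eta)\,d\eta$ on $\mathbb R\times[0,1]$, with $f_y(t,0)=f_y(t,1)=0$ and $f$ of period $2\pi/\omega$ in $t$, has a classical solution (with $f,f_t,f_y,f_{yy}$ continuous up to the walls), and every such solution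 satisfies $$\frac{\omega}{2\pi}\int_0^{2\pi/\omega}\!\!\int_0^1 f_y(t,y)^2\,dy\,dt=D_n(\nu).$$ Here $$D_1=\frac{\nu\cos\frac\nu2+\nu\cosh\frac\nu2-2\sin\frac\nu2-2\sinh\frac\nu2}{2\nu^5(\cos\frac\nu2+\cosh\frac\nu2)},\qquad D_2=\frac{\nu\cos\nu-\nu\cosh\nu-3\sin\nu+3\sinh\nu}{6\nu^5(\cos\nu-\cosh\nu)},$$ $$\begin{aligned}D_3=\frac{9}{160\nu^9(\cos\nu-\cosh\nu)}\Big(&\nu(-80+\nu^4)\cos\nu-\nu(-80+\nu^4)\cosh\nu+80(-4+\nu^2)\cosh\tfrac\nu2\sin\tfrac\nu2\\&-5(-32+8\nu^2+\nu^4)\sin\nu+80(4+\nu^2)\cos\tfrac\nu2\sinh\tfrac\nu2+5(-32-8\nu^2+\nu^4)\sinh\nu\Big),\end{aligned}$$ $$\begin{aligned}D_4=\frac{1}{56\nu^9(\cos\nu-\cosh\nu)}\Big(&\nu(-672+\nu^4)\cos\nu-\nu(-672+\nu^4)\cosh\nu\\&-7(-144+24\nu^2+\nu^4)\sin\nu+7(-144-24\nu^2+\nu^4)\sinh\nu\Big),\end{aligned}$$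 $$\begin{aligned}D_5=\frac{5}{4608\nu^{13}(\cos\nu-\cosh\nu)}\Big(&\nu(414720-13824\nu^4+5\nu^8)\cos\nu+\nu(-414720+13824\nu^4-5\nu^8)\cosh\nu\\&-17280(-96+24\nu^2+\nu^4)\cosh\tfrac\nu2\sin\tfrac\nu2-45(18432-4608\nu^2-768\nu^4+48\nu^6+\nu^8)\sin\nu\\&+17280(-96-24\nu^2+\nu^4)\cos\tfrac\nu2\sinh\tfrac\nu2+45(18432+4608\nu^2-768\nu^4-48\nu^6+\nu^8)\sinh\nu\Big),\end{aligned}$$ $$\begin{aligned}D_6=\frac{9}{39424\nu^{13}(\cos\nu-\cosh\nu)}\Big(&\nu(11827200-54560\nu^4+7\nu^8)\cos\nu+\nu(-11827200+54560\nu^4-7\nu^8)\cosh\nu\\&-77(230400-38400\nu^2-2560\nu^4+80\nu^6+\nu^8)\sin\nu\\&+77(230400+38400\nu^2-2560\nu^4-80\nu^6+\nu^8)\sinh\nu\Big).\end{aligned}$$ -/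

import Mathlib

open MeasureTheory ProbabilityTheory Filter Topology Set
open scoped NNReal

namespace TaylorDispersion

noncomputable section

/-- The velocity profile `u_n(t, y) = cos (ω t) (c - |y - 1/2| ^ n)`. -/
def powerLawFlow (n : ℕ) (c ω : ℝ) (t y : ℝ) : ℝ :=
  Real.cos (ω * t) * (c - |y - 1 / 2| ^ n)

/-- The flow with its cross-channel mean removed, `u'(t, y) = u(t, y) - ∫₀¹ u(t, η) dη`
(the stationary density of the vertical motion on `[0, 1]` is `1`). -/
def meanFree (u : ℝ → ℝ → ℝ) (t y : ℝ) : ℝ :=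
  u t y - ∫ η in (0 : ℝ)..1, u t η

/-- `∂f/∂y` on the channel `[0, 1]` (one-sided at the walls). -/
def dy (f : ℝ → ℝ → ℝ) (t y : ℝ) : ℝ := derivWithin (f t) (Icc 0 1) y

/-- `∂f/∂t`. -/
def dt (f : ℝ → ℝ → ℝ) (t y : ℝ) : ℝ := deriv (fun s => f s y) t

/-- `f` is a classical (once continuously differentiable in time, twice in space, up to the
walls) solution, `2π/ω`-periodic in time, of `(1/2) f_yy + f_t = u'` on `ℝ × [0, 1]` with
`f_y = 0` at `y = 0` and `y = 1`. -/
structure IsOscillatorySolution (ω : ℝ) (u f : ℝ → ℝ → ℝ) : Prop where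
  continuousOn : ContinuousOn (Function.uncurry f) (univ ×ˢ Icc 0 1)
  differentiableOn_y : ∀ t, DifferentiableOn ℝ (f t) (Icc 0 1)
  continuousOn_dy : ContinuousOn (Function.uncurry (dy f)) (univ ×ˢ Icc 0 1)
  differentiableOn_dy : ∀ t, DifferentiableOn ℝ (dy f t) (Icc 0 1)
  continuousOn_dyy : ContinuousOn (Function.uncurry (dy (dy f))) (univ ×ˢ Icc 0 1)
  differentiable_t : ∀ y ∈ Icc (0 : ℝ) 1, Differentiable ℝ (fun t => f t y)
  continuousOn_dt : ContinuousOn (Function.uncurry (dt f)) (univ ×ˢ Icc 0 1)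
  periodic : ∀ t, ∀ y ∈ Icc (0 : ℝ) 1, f (t + 2 * Real.pi / ω) y = f t y
  wall_zero : ∀ t, dy f t 0 = 0
  wall_one : ∀ t, dy f t 1 = 0
  equation : ∀ t, ∀ y ∈ Icc (0 : ℝ) 1,
    (1 / 2) * dy (dy f) t y + dt f t y = meanFree u t y

/-- `(ω/2π) ∫₀^{2π/ω} ∫₀¹ (∂f/∂y)² dy dt`. -/
def meanSquareGradient (ω : ℝ) (f : ℝ → ℝ → ℝ) : ℝ :=
  ω / (2 * Real.pi) *
    ∫ t in (0 : ℝ)..(2 * Real.pi / ω), ∫ y in (0 : ℝ)..1, dy f t y ^ 2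

/-- `B` is a standard Brownian motion relative to the filtration `𝓕`, and `Y` is the diffusion
confined to `[0, 1]` that it drives, `dY = dB + dL⁰ - dL¹`.  The initial position is an arbitrary
`𝓕 0`-measurable random point of `[0, 1]`; `L₀` and `L₁` are the local-time terms at `0` and `1`:
continuous nondecreasing processes started from `0` which are constant on every time interval
during which `Y` does not visit the point `0`, respectively the point `1`. -/
structure IsReflectedBrownianMotion {Ω : Type*} [mΩ : MeasurableSpace Ω]
    (P : Measure Ω) (𝓕 : Filtration ℝ≥0 mΩ) (B Y L₀ L₁ : ℝ≥0 → Ω → ℝ) : Prop where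
  brownian : IsBrownianReal B P
  adapted_B : Adapted 𝓕 B
  indep_increment : ∀ s t : ℝ≥0, s ≤ t →
    Indep (MeasurableSpace.comap (fun x => B t x - B s x) inferInstance) (𝓕 s) P
  adapted_Y : Adapted 𝓕 Y
  adapted_L₀ : Adapted 𝓕 L₀
  adapted_L₁ : Adapted 𝓕 L₁
  continuous_Y : ∀ᵐ x ∂P, Continuous fun t => Y t x
  continuous_L₀ : ∀ᵐ x ∂P, Continuous fun t => L₀ t x
  continuous_L₁ : ∀ᵐ x ∂P, Continuous fun t => L₁ t x
  confined : ∀ᵐ x ∂P, ∀ t, Y t x ∈ Icc (0 : ℝ) 1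
  L₀_start : ∀ᵐ x ∂P, L₀ 0 x = 0
  L₁_start : ∀ᵐ x ∂P, L₁ 0 x = 0
  L₀_mono : ∀ᵐ x ∂P, Monotone fun t => L₀ t x
  L₁_mono : ∀ᵐ x ∂P, Monotone fun t => L₁ t x
  L₀_grows : ∀ᵐ x ∂P, ∀ s t : ℝ≥0, s ≤ t → (∀ r ∈ Icc s t, Y r x ≠ 0) → L₀ t x = L₀ s x
  L₁_grows : ∀ᵐ x ∂P, ∀ s t : ℝ≥0, s ≤ t → (∀ r ∈ Icc s t, Y r x ≠ 1) → L₁ t x = L₁ s x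
  equation : ∀ᵐ x ∂P, ∀ t, Y t x = Y 0 x + B t x + L₀ t x - L₁ t x

/-- The horizontal displacement `X_t = ∫₀ᵗ u(s, Y_s) ds`. -/
def displacement {Ω : Type*} (u : ℝ → ℝ → ℝ) (Y : ℝ≥0 → Ω → ℝ) (t : ℝ≥0) (x : Ω) : ℝ :=
  ∫ s in (0 : ℝ)..t, u s (Y s.toNNReal x)

open Real in
/-- The closed forms, as functions of `ν = √ω`, for `n = 1, …, 6` (`0` is a dummy value for the
other `n`). -/
def closedForm : ℕ → ℝ → ℝ
  | 1, ν =>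
      (ν * cos (ν / 2) + ν * cosh (ν / 2) - 2 * sin (ν / 2) - 2 * sinh (ν / 2)) /
        (2 * ν ^ 5 * (cos (ν / 2) + cosh (ν / 2)))
  | 2, ν =>
      (ν * cos ν - ν * cosh ν - 3 * sin ν + 3 * sinh ν) / (6 * ν ^ 5 * (cos ν - cosh ν))
  | 3, ν =>
      (9 * (ν * (-80 + ν ^ 4) * cos ν - ν * (-80 + ν ^ 4) * cosh ν
        + 80 * (-4 + ν ^ 2) * cosh (ν / 2) * sin (ν / 2)
        - 5 * (-32 + 8 * ν ^ 2 + ν ^ 4) * sin ν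
        + 80 * (4 + ν ^ 2) * cos (ν / 2) * sinh (ν / 2)
        + 5 * (-32 - 8 * ν ^ 2 + ν ^ 4) * sinh ν)) /
        (160 * ν ^ 9 * (cos ν - cosh ν))
  | 4, ν =>
      (ν * (-672 + ν ^ 4) * cos ν - ν * (-672 + ν ^ 4) * cosh ν
        - 7 * (-144 + 24 * ν ^ 2 + ν ^ 4) * sin ν
        + 7 * (-144 - 24 * ν ^ 2 + ν ^ 4) * sinh ν) /
        (56 * ν ^ 9 * (cos ν - cosh ν))
  | 5, ν =>
      (5 * (ν * (414720 - 13824 * ν ^ 4 + 5 * ν ^ 8) * cos ν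
        + ν * (-414720 + 13824 * ν ^ 4 - 5 * ν ^ 8) * cosh ν
        - 17280 * (-96 + 24 * ν ^ 2 + ν ^ 4) * cosh (ν / 2) * sin (ν / 2)
        - 45 * (18432 - 4608 * ν ^ 2 - 768 * ν ^ 4 + 48 * ν ^ 6 + ν ^ 8) * sin ν
        + 17280 * (-96 - 24 * ν ^ 2 + ν ^ 4) * cos (ν / 2) * sinh (ν / 2)
        + 45 * (18432 + 4608 * ν ^ 2 - 768 * ν ^ 4 - 48 * ν ^ 6 + ν ^ 8) * sinh ν)) /
        (4608 * ν ^ 13 * (cos ν - cosh ν))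
  | 6, ν =>
      (9 * (ν * (11827200 - 54560 * ν ^ 4 + 7 * ν ^ 8) * cos ν
        + ν * (-11827200 + 54560 * ν ^ 4 - 7 * ν ^ 8) * cosh ν
        - 77 * (230400 - 38400 * ν ^ 2 - 2560 * ν ^ 4 + 80 * ν ^ 6 + ν ^ 8) * sin ν
        + 77 * (230400 + 38400 * ν ^ 2 - 2560 * ν ^ 4 - 80 * ν ^ 6 + ν ^ 8) * sinh ν)) /
        (39424 * ν ^ 13 * (cos ν - cosh ν))
  | _, _ => 0

end

end TaylorDispersion

/-! Write the mean-free flow as `cos (ω t) a(y)` with `a` continuous, and let `G = p + i q` solve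
`G'' / 2 + i ω G = a` with Neumann conditions. Then `f = Re (exp (i ω t) G) = cos (ω t) p - sin (ω
t) q` is the corrector: `f_yy / 2 + f_t` equals the mean-free flow. Everything is reduced to the
single number `-∫ a p`.

Probability. Let `k_s` be the mean-free velocity along the path and `X_t` its time integral.
Dynkin's formula (`dynkin`, `integral_cos_and_sin`) says that, given the past up to `s`, the
expected value of `∫_s^t k` is that of `f(t, Y_t) - f(s, Y_s)`. Inserting this in `E X_t² = 2 E
∫_0^t k_s (∫_s^t k_r dr) ds` gives `E X_t² = 2 E[X_t f(t, Y_t)] - 2 ∫_0^t E[k_s f(s, Y_s)] ds`. In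
the last integral `cos² = (1 + cos 2ω·) / 2` and `sin cos = (sin 2ω·) / 2`; Dynkin's formula for a
stationary corrector and for correctors of frequency `2 ω` shows that it is `t ∫ a p / 2 + O(1)`.
The first term is `O(E|X_t|)`, and Cauchy–Schwarz applied to the same identity gives `E|X_t| =
O(√t)`. Hence `E X_t² / t → -∫ a p`. The mean of the flow only adds a bounded oscillation, so `c`
drops out.

Dynkin's formula is proved by hand on partitions. An increment of `g(Y)` is a wall term, plus a
martingale difference, plus the Gaussian average of the increment of `g`. The wall term is
negligible because the local times grow only where `Y` is at a wall, and there `g' = 0`; the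
Gaussian averages are `g'' / 2` times the mesh up to `o(mesh)`.

Periodic problem. The corrector is a classical solution, and integrating by parts against `G` gives
mean square gradient `-∫ a p`. The energy identity for the homogeneous problem over one period shows
that two solutions have the same `y`-derivative (`dy_eq_zero`), so every solution has that value.

Closed forms. As a function of `z = |y - 1/2|` the forcing is a polynomial, so `P'' / 2 + i ω P = A`
has a polynomial solution on the half channel. Green's identity (`integral_eq_re`) expresses `∫ a p`
through the boundary values of `P` and of a homogeneous hyperbolic correction, and for each `n` what
is left is algebra. -/

namespace TaylorDispersion

set_option linter.unusedSectionVars false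

/-! ### Neumann test functions, Taylor estimates and Gaussian averages -/

section

/-- `g` is twice continuously differentiable on the line with derivatives `g₁`, `g₂`, and satisfies
the Neumann condition at `0` and `1`. -/
structure NeumannC2 (g g₁ g₂ : ℝ → ℝ) : Prop where
  deriv₁ : ∀ y, HasDerivAt g (g₁ y) y
  deriv₂ : ∀ y, HasDerivAt g₁ (g₂ y) y
  cont : Continuous g₂
  zero : g₁ 0 = 0
  one : g₁ 1 = 0

/-- A `NeumannC2` function which is bounded with its derivatives by `M`, and whose second
derivative is uniformly continuous. -/
structure BoundedNeumannC2 (g g₁ g₂ : ℝ → ℝ) (M : ℝ) : Prop extends NeumannC2 g g₁ g₂ where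
  bound : ∀ y, |g y| ≤ M
  bound₁ : ∀ y, |g₁ y| ≤ M
  bound₂ : ∀ y, |g₂ y| ≤ M
  unif : UniformContinuous g₂

variable {g g₁ g₂ : ℝ → ℝ} {M : ℝ}

namespace NeumannC2

lemma continuous (h : NeumannC2 g g₁ g₂) : Continuous g :=
  continuous_iff_continuousAt.2 fun y => (h.deriv₁ y).continuousAt

lemma continuous₁ (h : NeumannC2 g g₁ g₂) : Continuous g₁ :=
  continuous_iff_continuousAt.2 fun y => (h.deriv₂ y).continuousAt

/-- Every `NeumannC2` function agrees on `[0, 1]`, with its derivatives, with a bounded one. -/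
lemma exists_bounded (h : NeumannC2 g g₁ g₂) :
    ∃ (k k₁ k₂ : ℝ → ℝ) (M : ℝ), BoundedNeumannC2 k k₁ k₂ M ∧
      ∀ y ∈ Icc (0 : ℝ) 1, k y = g y ∧ k₂ y = g₂ y := by
  -- The cutoff is `1` on `[-1/2, 3/2]`, a neighbourhood of the channel, so multiplying by it
  -- changes neither the values nor the derivatives on `[0, 1]`; in particular the Neumann condition
  -- survives.
  let χ : ContDiffBump (1 / 2 : ℝ) := ⟨1, 2, one_pos, by norm_num⟩
  have hχ : ContDiff ℝ 2 (χ : ℝ → ℝ) := χ.contDiff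
  have hχ1 : ContDiff ℝ 1 (deriv (χ : ℝ → ℝ)) := by
    have := (contDiff_succ_iff_deriv (𝕜 := ℝ) (n := 1) (f := (χ : ℝ → ℝ))).1
      (by norm_num; exact hχ)
    exact this.2.2
  have hχ2 : Continuous (deriv (deriv (χ : ℝ → ℝ))) := hχ1.continuous_deriv le_rfl
  have d1 : ∀ y, HasDerivAt (χ : ℝ → ℝ) (deriv (χ : ℝ → ℝ) y) y := fun y =>
    (hχ.differentiable (by norm_num) y).hasDerivAt
  have d2 : ∀ y, HasDerivAt (deriv (χ : ℝ → ℝ)) (deriv (deriv (χ : ℝ → ℝ)) y) y := fun y =>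
    (hχ1.differentiable (by norm_num) y).hasDerivAt
  have hs : HasCompactSupport (χ : ℝ → ℝ) := χ.hasCompactSupport
  have hs1 : HasCompactSupport (deriv (χ : ℝ → ℝ)) := hs.deriv
  have hs2 : HasCompactSupport (deriv (deriv (χ : ℝ → ℝ))) := hs1.deriv
  have e0 : ∀ y ∈ Ioo (-1 / 2 : ℝ) (3 / 2), χ y = 1 := fun y hy => by
    apply χ.one_of_mem_closedBall
    rw [Metric.mem_closedBall, Real.dist_eq, abs_le]
    constructor <;> [linarith [hy.1]; linarith [hy.2]]
  have e1 : ∀ y ∈ Ioo (-1 / 2 : ℝ) (3 / 2), deriv (χ : ℝ → ℝ) y = 0 := fun y hy => by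
    have : (χ : ℝ → ℝ) =ᶠ[𝓝 y] fun _ => 1 := by
      filter_upwards [isOpen_Ioo.mem_nhds hy] with z hz using e0 z hz
    rw [this.deriv_eq]; simp
  have e2 : ∀ y ∈ Ioo (-1 / 2 : ℝ) (3 / 2), deriv (deriv (χ : ℝ → ℝ)) y = 0 := fun y hy => by
    have : deriv (χ : ℝ → ℝ) =ᶠ[𝓝 y] fun _ => 0 := by
      filter_upwards [isOpen_Ioo.mem_nhds hy] with z hz using e1 z hz
    rw [this.deriv_eq]; simp
  let k : ℝ → ℝ := fun y => χ y * g y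
  let k₁ : ℝ → ℝ := fun y => deriv (χ : ℝ → ℝ) y * g y + χ y * g₁ y
  let k₂ : ℝ → ℝ := fun y => deriv (deriv (χ : ℝ → ℝ)) y * g y + deriv (χ : ℝ → ℝ) y * g₁ y +
    (deriv (χ : ℝ → ℝ) y * g₁ y + χ y * g₂ y)
  have hg := h.continuous
  have hg1 := h.continuous₁
  have hg2 := h.cont
  have c0 : Continuous k := hχ.continuous.mul hg
  have c1 : Continuous k₁ := (hχ1.continuous.mul hg).add (hχ.continuous.mul hg1)
  have c2 : Continuous k₂ := ((hχ2.mul hg).add (hχ1.continuous.mul hg1)).add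
    ((hχ1.continuous.mul hg1).add (hχ.continuous.mul hg2))
  have s0 : HasCompactSupport k := hs.mul_right
  have s1 : HasCompactSupport k₁ := hs1.mul_right.add hs.mul_right
  have s2 : HasCompactSupport k₂ :=
    (hs2.mul_right.add hs1.mul_right).add (hs1.mul_right.add hs.mul_right)
  obtain ⟨M0, h0⟩ := c0.bounded_above_of_compact_support s0
  obtain ⟨M1, h1⟩ := c1.bounded_above_of_compact_support s1
  obtain ⟨M2, h2⟩ := c2.bounded_above_of_compact_support s2
  refine ⟨k, k₁, k₂, max M0 (max M1 M2), ⟨⟨fun y => (d1 y).mul (h.deriv₁ y),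
    fun y => ((d2 y).mul (h.deriv₁ y)).add ((d1 y).mul (h.deriv₂ y)), c2, ?_, ?_⟩,
    fun y => (h0 y).trans (le_max_left _ _),
    fun y => (h1 y).trans ((le_max_left _ _).trans (le_max_right _ _)),
    fun y => (h2 y).trans ((le_max_right _ _).trans (le_max_right _ _)),
    s2.uniformContinuous_of_continuous c2⟩, fun y hy => ?_⟩
  · simp [k₁, e1 0 (by norm_num), h.zero]
  · simp [k₁, e1 1 (by norm_num), h.one]
  · have hy' : y ∈ Ioo (-1 / 2 : ℝ) (3 / 2) :=
      ⟨by linarith [hy.1], by linarith [hy.2]⟩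
    simp [k, k₂, e0 y hy', e1 y hy', e2 y hy']

end NeumannC2

/-- Second order Taylor estimate with the oscillation of the second derivative. -/
lemma abs_taylor_le (h1 : ∀ y, HasDerivAt g (g₁ y) y) (h2 : ∀ y, HasDerivAt g₁ (g₂ y) y)
    {y b C : ℝ} (hC : ∀ z, |z| ≤ |b| → |g₂ (y + z) - g₂ y| ≤ C) :
    |g (y + b) - g y - g₁ y * b - g₂ y * (b ^ 2 / 2)| ≤ C * b ^ 2 := by
  have hC0 : 0 ≤ C := (abs_nonneg _).trans (hC 0 (by simp))
  have key1 : ∀ z, |z| ≤ |b| → |g₁ (y + z) - g₁ y - g₂ y * z| ≤ C * |z| := by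
    intro z hz
    have hd : ∀ x ∈ uIcc 0 z, HasDerivWithinAt (fun x => g₁ (y + x) - g₁ y - g₂ y * x)
        (g₂ (y + x) - g₂ y) (uIcc 0 z) x := by
      intro x _
      have := (((h2 (y + x)).comp_const_add y x).sub_const (g₁ y)).sub
        ((hasDerivAt_id x).const_mul (g₂ y))
      exact (this.congr_deriv (by simp)).hasDerivWithinAt
    have := (convex_uIcc 0 z).norm_image_sub_le_of_norm_hasDerivWithin_le (C := C) hd
      (fun x hx => hC x (le_trans (by simpa using abs_sub_left_of_mem_uIcc hx) hz))
      left_mem_uIcc right_mem_uIcc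
    simpa using this
  have hd : ∀ x ∈ uIcc 0 b, HasDerivWithinAt
      (fun x => g (y + x) - g y - g₁ y * x - g₂ y * (x ^ 2 / 2))
      (g₁ (y + x) - g₁ y - g₂ y * x) (uIcc 0 b) x := by
    intro x _
    have := ((((h1 (y + x)).comp_const_add y x).sub_const (g y)).sub
      ((hasDerivAt_id x).const_mul (g₁ y))).sub
      (((hasDerivAt_pow 2 x).div_const 2).const_mul (g₂ y))
    refine (this.congr_deriv ?_).hasDerivWithinAt
    simp
  have := (convex_uIcc 0 b).norm_image_sub_le_of_norm_hasDerivWithin_le (C := C * |b|) hd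
    (fun x hx => by
      have hx' : |x| ≤ |b| := by simpa using abs_sub_left_of_mem_uIcc hx
      exact (key1 x hx').trans (by gcongr)) left_mem_uIcc right_mem_uIcc
  simp only [Real.norm_eq_abs, sub_zero, add_zero, sub_self, mul_zero, ne_eq, OfNat.ofNat_ne_zero,
    not_false_eq_true, zero_pow, zero_div] at this
  calc _ ≤ C * |b| * |b| := this
    _ = C * b ^ 2 := by rw [mul_assoc, ← sq, sq_abs]

namespace BoundedNeumannC2

lemma nonneg (h : BoundedNeumannC2 g g₁ g₂ M) : 0 ≤ M := (abs_nonneg _).trans (h.bound 0)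

/-- For small `b` uniform continuity of `g₂` gives `ε b²`. For `|b| ≥ ρ` the crude bound `2 M b²` is
absorbed in `b⁴`, a power whose Gaussian moment is quadratic in the variance. -/
lemma taylor (h : BoundedNeumannC2 g g₁ g₂ M) {ε : ℝ} (hε : 0 < ε) :
    ∃ K : ℝ, 0 ≤ K ∧ ∀ y b,
      |g (y + b) - g y - g₁ y * b - g₂ y * (b ^ 2 / 2)| ≤ ε * b ^ 2 + K * b ^ 4 := by
  obtain ⟨ρ, hρ, hu⟩ := Metric.uniformContinuous_iff.1 h.unif ε hε
  have hM := h.nonneg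
  refine ⟨2 * M / ρ ^ 2, by positivity, fun y b => ?_⟩
  by_cases hb : |b| < ρ
  · refine (abs_taylor_le (C := ε) h.deriv₁ h.deriv₂ fun z hz => ?_).trans
      (le_add_of_nonneg_right (by positivity))
    have := @hu (y + z) y (by simpa [Real.dist_eq] using hz.trans_lt hb)
    exact (by simpa [Real.dist_eq] using this.le)
  · refine (abs_taylor_le (C := 2 * M) h.deriv₁ h.deriv₂ fun z hz => ?_).trans ?_
    · exact (abs_sub _ _).trans (by linarith [h.bound₂ (y + z), h.bound₂ y])
    · have hb' : ρ ^ 2 ≤ b ^ 2 := by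
        rw [← sq_abs b]; push Not at hb; gcongr
      have : 2 * M * b ^ 2 ≤ 2 * M / ρ ^ 2 * b ^ 4 := by
        rw [div_mul_eq_mul_div, le_div_iff₀ (by positivity)]
        nlinarith [mul_le_mul_of_nonneg_left hb' (by positivity : 0 ≤ 2 * M * b ^ 2)]
      nlinarith [mul_nonneg hε.le (sq_nonneg b)]

lemma lipschitz (h : BoundedNeumannC2 g g₁ g₂ M) (x y : ℝ) : |g x - g y| ≤ M * |x - y| := by
  simpa using Convex.norm_image_sub_le_of_norm_hasDerivWithin_le (s := univ) (C := M)
    (fun z _ => (h.deriv₁ z).hasDerivWithinAt) (fun z _ => h.bound₁ z) convex_univ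
    (mem_univ y) (mem_univ x)

lemma lipschitz₁ (h : BoundedNeumannC2 g g₁ g₂ M) (x y : ℝ) : |g₁ x - g₁ y| ≤ M * |x - y| := by
  simpa using Convex.norm_image_sub_le_of_norm_hasDerivWithin_le (s := univ) (C := M)
    (fun z _ => (h.deriv₂ z).hasDerivWithinAt) (fun z _ => h.bound₂ z) convex_univ
    (mem_univ y) (mem_univ x)

end BoundedNeumannC2

/-! ### The Gaussian semigroup -/

lemma integrable_pow_gaussianReal (v : ℝ≥0) (n : ℕ) :
    Integrable (fun b : ℝ => b ^ n) (gaussianReal 0 v) :=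
  (integrable_norm_iff (by fun_prop)).1 <| by
    simpa using (memLp_id_gaussianReal (μ := 0) (v := v) n).integrable_norm_pow'

lemma integral_sq_gaussianReal (v : ℝ≥0) : ∫ b, b ^ 2 ∂gaussianReal 0 v = v := by
  have := variance_fun_id_gaussianReal (μ := 0) (v := v)
  rw [variance_eq_integral (by fun_prop), integral_id_gaussianReal] at this
  simpa using this

/-- Scaling from unit variance. Only the factor `v²` matters, so the unit moment is left
unevaluated. -/
lemma integral_pow_four_gaussianReal (v : ℝ≥0) :
    ∫ b, b ^ 4 ∂gaussianReal 0 v = (v : ℝ) ^ 2 * ∫ b, b ^ 4 ∂gaussianReal 0 1 := by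
  have h := gaussianReal_map_const_mul (μ := 0) (v := 1) (√(v : ℝ))
  have hv : (⟨√(v : ℝ) ^ 2, sq_nonneg _⟩ : ℝ≥0) * 1 = v := by
    ext; simp
  simp only [mul_zero] at h
  rw [show gaussianReal 0 v = Measure.map (fun x => √(v : ℝ) * x) (gaussianReal 0 1) by
    rw [h]; congr 1; exact hv.symm, integral_map (by fun_prop) (by fun_prop), ← integral_const_mul]
  congr with b
  rw [mul_pow, show √(v : ℝ) ^ 4 = (√(v : ℝ) ^ 2) ^ 2 by ring, Real.sq_sqrt v.coe_nonneg]

/-- The expected increment of `g` under a centred Gaussian displacement of variance `v`. -/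
noncomputable def gaussianIncr (g : ℝ → ℝ) (v : ℝ≥0) (y : ℝ) : ℝ :=
  ∫ b, (g (y + b) - g y) ∂gaussianReal 0 v

namespace BoundedNeumannC2

lemma abs_incr_le (h : BoundedNeumannC2 g g₁ g₂ M) (y b : ℝ) : |g (y + b) - g y| ≤ 2 * M :=
  (abs_sub _ _).trans (by linarith [h.bound (y + b), h.bound y])

lemma integrable_incr (h : BoundedNeumannC2 g g₁ g₂ M) (v : ℝ≥0) (y : ℝ) :
    Integrable (fun b => g (y + b) - g y) (gaussianReal 0 v) := by
  have := h.continuous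
  exact Integrable.of_bound (C := 2 * M) (by fun_prop) (ae_of_all _ fun b => h.abs_incr_le y b)

lemma continuous_gaussianIncr (h : BoundedNeumannC2 g g₁ g₂ M) (v : ℝ≥0) :
    Continuous (gaussianIncr g v) := by
  have := h.continuous
  refine continuous_of_dominated (bound := fun _ => 2 * M) (fun y => by fun_prop)
    (fun y => ae_of_all _ fun b => h.abs_incr_le y b) (by fun_prop) (ae_of_all _ fun b => ?_)
  fun_prop

lemma gaussianIncr_sub (h : BoundedNeumannC2 g g₁ g₂ M) (v : ℝ≥0) (y : ℝ) :
    gaussianIncr g v y - v * (g₂ y / 2) =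
      ∫ b, (g (y + b) - g y - g₁ y * b - g₂ y * (b ^ 2 / 2)) ∂gaussianReal 0 v := by
  have i1 := integrable_pow_gaussianReal v 1
  have i2 := integrable_pow_gaussianReal v 2
  simp only [pow_one] at i1
  have i3 : Integrable (fun b => g (y + b) - g y - g₁ y * b) (gaussianReal 0 v) :=
    (h.integrable_incr v y).sub (i1.const_mul _)
  rw [integral_sub i3 ((i2.div_const 2).const_mul _),
    integral_sub (h.integrable_incr v y) (i1.const_mul _), integral_const_mul, integral_const_mul,
    integral_div, integral_sq_gaussianReal, integral_id_gaussianReal, gaussianIncr]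
  ring

/-- The generator of the Gaussian semigroup is half the second derivative, uniformly in `y`. Over
`N` steps of variance `T / N` the errors add up to `T (ε + K T / N)`. -/
lemma abs_gaussianIncr_sub_le (h : BoundedNeumannC2 g g₁ g₂ M) {ε : ℝ} (hε : 0 < ε) :
    ∃ K : ℝ, 0 ≤ K ∧ ∀ (v : ℝ≥0) y,
      |gaussianIncr g v y - v * (g₂ y / 2)| ≤ v * (ε + K * v) := by
  obtain ⟨K, hK, hT⟩ := h.taylor hε
  refine ⟨K * ∫ b, b ^ 4 ∂gaussianReal 0 1,
    mul_nonneg hK (integral_nonneg fun b => by positivity), fun v y => ?_⟩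
  rw [h.gaussianIncr_sub]
  have i2 := integrable_pow_gaussianReal v 2
  have i4 := integrable_pow_gaussianReal v 4
  rw [← Real.norm_eq_abs]
  refine (norm_integral_le_of_norm_le ((i2.const_mul ε).add (i4.const_mul K))
    (ae_of_all _ fun b => by exact hT y b)).trans_eq ?_
  simp only [Pi.add_apply]
  rw [integral_add (i2.const_mul ε) (i4.const_mul K), integral_const_mul, integral_const_mul,
    integral_sq_gaussianReal, integral_pow_four_gaussianReal]
  ring

/-- Linearity in `v` is the point: the sum of these terms over a partition of an interval of length
`T` is at most `3 M T`, whatever the mesh. -/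
lemma abs_gaussianIncr_le (h : BoundedNeumannC2 g g₁ g₂ M) (v : ℝ≥0) (y : ℝ) :
    |gaussianIncr g v y| ≤ 3 * M * v := by
  have hM := h.nonneg
  have i2 := integrable_pow_gaussianReal v 2
  have h1 : |gaussianIncr g v y - v * (g₂ y / 2)| ≤ 2 * M * v := by
    rw [h.gaussianIncr_sub, ← integral_sq_gaussianReal, ← Real.norm_eq_abs, ← integral_const_mul]
    refine norm_integral_le_of_norm_le (i2.const_mul (2 * M)) (ae_of_all _ fun b => ?_)
    exact abs_taylor_le h.deriv₁ h.deriv₂ fun z _ =>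
      (abs_sub _ _).trans (by linarith [h.bound₂ (y + z), h.bound₂ y])
  have h2 : |(v : ℝ) * (g₂ y / 2)| ≤ M * v := by
    rw [abs_mul, abs_of_nonneg v.coe_nonneg, mul_comm]
    gcongr
    rw [abs_div, abs_two]
    linarith [h.bound₂ y]
  calc _ = |(gaussianIncr g v y - v * (g₂ y / 2)) + v * (g₂ y / 2)| := by ring_nf
    _ ≤ _ := (abs_add_le _ _).trans (by linarith)

end BoundedNeumannC2

end

/-! ### Uniform partitions and the pathwise estimate at the walls -/

section

variable {g g₁ g₂ : ℝ → ℝ} {M : ℝ}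

/-- The `k`-th node of the uniform partition of `[s, s + T]` into `N` intervals. -/
noncomputable def node (s T : ℝ≥0) (N k : ℕ) : ℝ≥0 := s + k * (T / N)

lemma node_zero (s T : ℝ≥0) (N : ℕ) : node s T N 0 = s := by simp [node]

lemma node_self (s T : ℝ≥0) {N : ℕ} (hN : N ≠ 0) : node s T N N = s + T := by
  have : (N : ℝ≥0) ≠ 0 := by exact_mod_cast hN
  rw [node, mul_div_cancel₀ _ this]

lemma node_succ (s T : ℝ≥0) (N k : ℕ) : node s T N (k + 1) = node s T N k + T / N := by
  simp only [node]; push_cast; ring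

lemma node_mono (s T : ℝ≥0) (N : ℕ) : Monotone (node s T N) := fun i j hij => by
  simp only [node]; gcongr

lemma node_mem (s T : ℝ≥0) {N k : ℕ} (hk : k ≤ N) : node s T N k ∈ Icc s (s + T) := by
  rcases eq_or_ne N 0 with rfl | hN
  · simp [node]
  · exact ⟨(node_zero s T N).symm.trans_le (node_mono s T N (Nat.zero_le k)),
      (node_mono s T N hk).trans_eq (node_self s T hN)⟩

lemma tendsto_mesh (T : ℝ≥0) : Tendsto (fun N : ℕ => ((T / N : ℝ≥0) : ℝ)) atTop (𝓝 0) := by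
  simpa using tendsto_const_div_atTop_nhds_zero_nat (T : ℝ)

/-- Riemann sums over uniform partitions. -/
lemma tendsto_riemann_sum {φ : ℝ≥0 → ℝ} (hφ : Continuous φ) (s T : ℝ≥0) :
    Tendsto (fun N : ℕ => ∑ k ∈ Finset.range N, ((T / N : ℝ≥0) : ℝ) * φ (node s T N k)) atTop
      (𝓝 (∫ q in (s : ℝ)..(s + T : ℝ≥0), φ q.toNNReal)) := by
  have hφ' : Continuous fun q : ℝ => φ q.toNNReal := hφ.comp continuous_real_toNNReal
  rw [Metric.tendsto_atTop]
  intro ε hε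
  set η : ℝ := ε / (T + 1) with hη
  have hη0 : 0 < η := by positivity
  have hu := (isCompact_Icc (a := s) (b := s + T)).uniformContinuousOn_of_continuous hφ.continuousOn
  obtain ⟨ρ, hρ, hu⟩ := Metric.uniformContinuousOn_iff.1 hu η hη0
  obtain ⟨N₀, hN₀⟩ := Metric.tendsto_atTop.1 (tendsto_mesh T) ρ hρ
  -- `N = 0` is excluded because `T / 0 = 0` would leave the last node at `s` instead of `s + T`.
  refine ⟨max N₀ 1, fun N hN => ?_⟩
  have hN1 : N ≠ 0 := by have := le_of_max_le_right hN; omega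
  have hmesh : ((T / N : ℝ≥0) : ℝ) < ρ := by
    have := hN₀ N (le_of_max_le_left hN)
    rwa [Real.dist_eq, sub_zero, abs_of_nonneg (NNReal.coe_nonneg _)] at this
  have hsplit : ∫ q in (s : ℝ)..(s + T : ℝ≥0), φ q.toNNReal =
      ∑ k ∈ Finset.range N, ∫ q in (node s T N k : ℝ)..(node s T N (k + 1) : ℝ), φ q.toNNReal := by
    rw [intervalIntegral.sum_integral_adjacent_intervals (a := fun k => (node s T N k : ℝ))
      fun k _ => hφ'.intervalIntegrable _ _, node_zero, node_self s T hN1]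
  rw [hsplit, Real.dist_eq, ← Finset.sum_sub_distrib]
  refine (Finset.abs_sum_le_sum_abs _ _).trans_lt ?_
  have hterm : ∀ k ∈ Finset.range N, |((T / N : ℝ≥0) : ℝ) * φ (node s T N k) -
      ∫ q in (node s T N k : ℝ)..(node s T N (k + 1) : ℝ), φ q.toNNReal| ≤
      η * ((T / N : ℝ≥0) : ℝ) := by
    intro k hk
    have hk : k < N := Finset.mem_range.1 hk
    have hlen : (node s T N (k + 1) : ℝ) - node s T N k = ((T / N : ℝ≥0) : ℝ) := by
      rw [node_succ]; push_cast; ring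
    have hle : (node s T N k : ℝ) ≤ node s T N (k + 1) := node_mono s T N (Nat.le_succ k)
    have hconst : ((T / N : ℝ≥0) : ℝ) * φ (node s T N k) =
        ∫ _ in (node s T N k : ℝ)..(node s T N (k + 1) : ℝ), φ (node s T N k) := by
      rw [intervalIntegral.integral_const, hlen, smul_eq_mul]
    rw [hconst, ← intervalIntegral.integral_sub (by simp) (hφ'.intervalIntegrable _ _),
      ← Real.norm_eq_abs]
    refine (intervalIntegral.norm_integral_le_of_norm_le_const (C := η) fun q hq => ?_).trans_eq
      (by rw [hlen, abs_of_nonneg (NNReal.coe_nonneg _)])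
    rw [uIoc_of_le hle] at hq
    have hq0 : 0 ≤ q := (NNReal.coe_nonneg _).trans hq.1.le
    have h1 : node s T N k ≤ q.toNNReal := by
      rw [← NNReal.coe_le_coe, Real.coe_toNNReal q hq0]; exact hq.1.le
    have h2 : q.toNNReal ≤ node s T N (k + 1) := by
      rw [← NNReal.coe_le_coe, Real.coe_toNNReal q hq0]; exact hq.2
    refine (hu _ (node_mem s T hk.le) _ ⟨(node_mem s T hk.le).1.trans h1,
      h2.trans (node_mem s T hk).2⟩ ?_).le
    rw [NNReal.dist_eq, Real.coe_toNNReal q hq0, abs_sub_comm, abs_of_nonneg (by linarith [hq.1])]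
    linarith [hq.2]
  refine (Finset.sum_le_sum hterm).trans_lt ?_
  have hTN : (N : ℝ) * ((T / N : ℝ≥0) : ℝ) = T := by
    have : (N : ℝ) ≠ 0 := by exact_mod_cast hN1
    push_cast; field_simp
  rw [Finset.sum_const, Finset.card_range, nsmul_eq_mul, mul_left_comm, hTN, hη,
    div_mul_eq_mul_div, div_lt_iff₀ (by positivity)]
  nlinarith [T.coe_nonneg]

/-- One step of the pathwise estimate: the part of the increment of `g (y)` which is due to the
local times is of second order, since the local times grow only where `g₁` vanishes. -/
lemma BoundedNeumannC2.abs_step_le (h : BoundedNeumannC2 g g₁ g₂ M) {y b l₀ l₁ : ℝ≥0 → ℝ}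
    (m₀ : Monotone l₀) (m₁ : Monotone l₁)
    (grow₀ : ∀ s t : ℝ≥0, s ≤ t → (∀ r ∈ Icc s t, y r ≠ 0) → l₀ t = l₀ s)
    (grow₁ : ∀ s t : ℝ≥0, s ≤ t → (∀ r ∈ Icc s t, y r ≠ 1) → l₁ t = l₁ s)
    (eq : ∀ t, y t = y 0 + b t + l₀ t - l₁ t) {r r' : ℝ≥0} (hr : r ≤ r') {ε : ℝ}
    (hy : ∀ q ∈ Icc r r', |y r' - y q| ≤ ε) (h₀ : l₀ r' - l₀ r ≤ ε) (h₁ : l₁ r' - l₁ r ≤ ε) :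
    |g (y r') - g (y r + (b r' - b r))| ≤
      2 * M * ε * ((l₀ r' - l₀ r) + (l₁ r' - l₁ r)) := by
  have d₀ : 0 ≤ l₀ r' - l₀ r := sub_nonneg.2 (m₀ hr)
  have d₁ : 0 ≤ l₁ r' - l₁ r := sub_nonneg.2 (m₁ hr)
  have hM := h.nonneg
  have hz : y r + (b r' - b r) = y r' - ((l₀ r' - l₀ r) - (l₁ r' - l₁ r)) := by
    rw [eq r', eq r]; ring
  have habs : |(l₀ r' - l₀ r) - (l₁ r' - l₁ r)| ≤ ε := by
    rw [abs_le]; constructor <;> linarith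
  have habs' : |(l₀ r' - l₀ r) - (l₁ r' - l₁ r)| ≤ (l₀ r' - l₀ r) + (l₁ r' - l₁ r) := by
    rw [abs_le]; constructor <;> linarith
  have hε : 0 ≤ ε := d₀.trans h₀
  -- If the wall `w` is visited at time `q`, every point between the two arguments of `g` is within
  -- `2 ε` of `w`; since `g₁ w = 0`, the slope there is at most `2 M ε`.
  have main : ∀ w q, q ∈ Icc r r' → y q = w → g₁ w = 0 →
      |g (y r') - g (y r + (b r' - b r))| ≤
        2 * M * ε * ((l₀ r' - l₀ r) + (l₁ r' - l₁ r)) := by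
    intro w q hq hw hgw
    have hbd : ∀ ξ ∈ uIcc (y r + (b r' - b r)) (y r'), ‖g₁ ξ‖ ≤ 2 * M * ε := by
      intro ξ hξ
      have e1 : |y r' - ξ| ≤ ε := by
        refine (abs_sub_right_of_mem_uIcc hξ).trans ?_
        rwa [hz, sub_sub_cancel]
      have e2 := h.lipschitz₁ ξ w
      rw [hgw, sub_zero] at e2
      have e3 : |ξ - w| ≤ ε + ε := by
        calc |ξ - w| = |(y r' - y q) - (y r' - ξ)| := by rw [hw]; congr 1; ring
          _ ≤ _ := (abs_sub _ _).trans (add_le_add (hy q hq) e1)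
      rw [Real.norm_eq_abs]
      nlinarith
    have := (convex_uIcc (y r + (b r' - b r)) (y r')).norm_image_sub_le_of_norm_hasDerivWithin_le
      (fun z _ => (h.deriv₁ z).hasDerivWithinAt) hbd left_mem_uIcc right_mem_uIcc
    simp only [Real.norm_eq_abs] at this
    refine this.trans ?_
    rw [hz, sub_sub_cancel]
    gcongr
  -- If neither local time grows, the increment of `y` is exactly that of `b`. Otherwise the wall
  -- whose local time grows has been visited, and `main` applies.
  by_cases c₀ : l₀ r' = l₀ r
  · by_cases c₁ : l₁ r' = l₁ r
    · rw [hz]; simp [c₀, c₁]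
    · have : ∃ q ∈ Icc r r', y q = 1 := by
        by_contra! hcon
        exact c₁ (grow₁ r r' hr hcon)
      obtain ⟨q, hq, hq'⟩ := this
      exact main 1 q hq hq' h.one
  · have : ∃ q ∈ Icc r r', y q = 0 := by
      by_contra! hcon
      exact c₀ (grow₀ r r' hr hcon)
    obtain ⟨q, hq, hq'⟩ := this
    exact main 0 q hq hq' h.zero

/-- Each step costs a small factor times the growth of the local times on that step. The growths
telescope to the finite total on `[s, s + T]`, and the factor tends to `0` by uniform continuity of
the paths. -/
lemma BoundedNeumannC2.tendsto_sum_step (h : BoundedNeumannC2 g g₁ g₂ M) {y b l₀ l₁ : ℝ≥0 → ℝ}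
    (cy : Continuous y) (c₀ : Continuous l₀) (c₁ : Continuous l₁)
    (m₀ : Monotone l₀) (m₁ : Monotone l₁)
    (grow₀ : ∀ s t : ℝ≥0, s ≤ t → (∀ r ∈ Icc s t, y r ≠ 0) → l₀ t = l₀ s)
    (grow₁ : ∀ s t : ℝ≥0, s ≤ t → (∀ r ∈ Icc s t, y r ≠ 1) → l₁ t = l₁ s)
    (eq : ∀ t, y t = y 0 + b t + l₀ t - l₁ t) (s T : ℝ≥0) :
    Tendsto (fun N : ℕ => ∑ k ∈ Finset.range N, (g (y (node s T N (k + 1))) -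
      g (y (node s T N k) + (b (node s T N (k + 1)) - b (node s T N k))))) atTop (𝓝 0) := by
  have hM := h.nonneg
  rw [Metric.tendsto_atTop]
  intro ε hε
  set V : ℝ := (l₀ (s + T) - l₀ s) + (l₁ (s + T) - l₁ s) with hV
  have hV0 : 0 ≤ V := add_nonneg (sub_nonneg.2 (m₀ le_self_add)) (sub_nonneg.2 (m₁ le_self_add))
  set η : ℝ := ε / (2 * M * V + 1) with hη
  have hη0 : 0 < η := by positivity
  have unif : ∀ {f : ℝ≥0 → ℝ}, Continuous f → ∀ᶠ N : ℕ in atTop, ∀ q ∈ Icc s (s + T),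
      ∀ q' ∈ Icc s (s + T), dist q q' ≤ (T / N : ℝ≥0) → |f q - f q'| ≤ η := by
    intro f hf
    have hu := (isCompact_Icc (a := s) (b := s + T)).uniformContinuousOn_of_continuous
      hf.continuousOn
    obtain ⟨ρ, hρ, hu⟩ := Metric.uniformContinuousOn_iff.1 hu η hη0
    filter_upwards [(tendsto_mesh T).eventually_lt_const hρ] with N hN q hq q' hq' hd
    exact (hu q hq q' hq' (hd.trans_lt hN)).le
  obtain ⟨N₀, hN₀⟩ := eventually_atTop.1 ((unif cy).and ((unif c₀).and (unif c₁)))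
  refine ⟨max N₀ 1, fun N hN => ?_⟩
  have hN1 : N ≠ 0 := by have := le_of_max_le_right hN; omega
  obtain ⟨uy, u₀, u₁⟩ := hN₀ N (le_of_max_le_left hN)
  rw [Real.dist_eq, sub_zero]
  refine (Finset.abs_sum_le_sum_abs _ _).trans_lt ?_
  have hterm : ∀ k ∈ Finset.range N, |g (y (node s T N (k + 1))) -
      g (y (node s T N k) + (b (node s T N (k + 1)) - b (node s T N k)))| ≤
      2 * M * η * ((l₀ (node s T N (k + 1)) + l₁ (node s T N (k + 1))) -
        (l₀ (node s T N k) + l₁ (node s T N k))) := by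
    intro k hk
    have hk : k < N := Finset.mem_range.1 hk
    have n1 := node_mem s T hk.le
    have n2 := node_mem s T (Nat.succ_le_of_lt hk)
    have n3 : node s T N k ≤ node s T N (k + 1) := node_mono s T N (Nat.le_succ k)
    have hd : ∀ q ∈ Icc (node s T N k) (node s T N (k + 1)),
        dist (node s T N (k + 1)) q ≤ (T / N : ℝ≥0) := by
      intro q hq
      have q1 : (node s T N k : ℝ) ≤ q := hq.1
      have q2 : (q : ℝ) ≤ node s T N (k + 1) := hq.2
      rw [NNReal.dist_eq, abs_of_nonneg (by linarith)]
      have : (node s T N (k + 1) : ℝ) = node s T N k + (T / N : ℝ≥0) := by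
        rw [node_succ]; push_cast; rfl
      linarith
    have := h.abs_step_le m₀ m₁ grow₀ grow₁ eq n3 (ε := η)
      (fun q hq => uy _ n2 q ⟨n1.1.trans hq.1, hq.2.trans n2.2⟩ (hd q hq))
      ((le_abs_self _).trans (u₀ _ n2 _ n1 (hd _ (left_mem_Icc.2 n3))))
      ((le_abs_self _).trans (u₁ _ n2 _ n1 (hd _ (left_mem_Icc.2 n3))))
    refine this.trans_eq ?_
    ring
  refine (Finset.sum_le_sum hterm).trans_lt ?_
  rw [← Finset.mul_sum, Finset.sum_range_sub (fun k => l₀ (node s T N k) + l₁ (node s T N k)),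
    node_zero, node_self s T hN1]
  have : 2 * M * η * (l₀ (s + T) + l₁ (s + T) - (l₀ s + l₁ s)) =
      ε * (2 * M * V) / (2 * M * V + 1) := by
    rw [hη, hV]; ring
  rw [this, div_lt_iff₀ (by positivity)]
  nlinarith

/-- An almost surely vanishing sequence which is bounded in `L²` vanishes in `L¹`. -/
lemma tendsto_integral_abs_of_ae_of_sq_le {Ω : Type*} [MeasurableSpace Ω] {P : Measure Ω}
    [IsProbabilityMeasure P] {X : ℕ → Ω → ℝ} {C : ℝ} (hX : ∀ N, MemLp (X N) 2 P)
    (hC : ∀ N, ∫ x, X N x ^ 2 ∂P ≤ C) (h0 : ∀ᵐ x ∂P, Tendsto (fun N => X N x) atTop (𝓝 0)) :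
    Tendsto (fun N => ∫ x, |X N x| ∂P) atTop (𝓝 0) := by
  have hC0 : 0 ≤ C := (integral_nonneg fun x => sq_nonneg _).trans (hC 0)
  rw [Metric.tendsto_atTop]
  intro ε hε
  -- Truncation level in `|X| ≤ min |X| K + X² / K`: the last term has mean at most `C / K < ε / 2`,
  -- and the truncated part is handled by dominated convergence.
  set K : ℝ := 2 * (C + 1) / ε with hK
  have hK0 : 0 < K := by positivity
  have hmeas : ∀ N, AEStronglyMeasurable (fun x => min |X N x| K) P := fun N => by
    have := (hX N).aestronglyMeasurable.norm
    exact this.inf aestronglyMeasurable_const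
  have hbd : ∀ N, ∀ᵐ x ∂P, ‖min |X N x| K‖ ≤ K := fun N => ae_of_all _ fun x => by
    rw [Real.norm_eq_abs, abs_of_nonneg (by positivity)]; exact min_le_right _ _
  have hlim : Tendsto (fun N => ∫ x, min |X N x| K ∂P) atTop (𝓝 0) := by
    have := tendsto_integral_of_dominated_convergence (f := fun _ => (0 : ℝ)) (fun _ => K) hmeas
      (integrable_const K) hbd (by
        filter_upwards [h0] with x hx
        have := (hx.abs).min (tendsto_const_nhds (x := K))
        simpa [hK0.le] using this)
    simpa using this
  obtain ⟨N₀, hN₀⟩ := Metric.tendsto_atTop.1 hlim (ε / 2) (by positivity)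
  refine ⟨N₀, fun N hN => ?_⟩
  have h1 := hN₀ N hN
  rw [Real.dist_eq, sub_zero] at h1 ⊢
  have hsq := (hX N).integrable_sq
  have hmin : Integrable (fun x => min |X N x| K) P :=
    Integrable.of_bound (hmeas N) K (hbd N)
  have hle : ∫ x, |X N x| ∂P ≤ ∫ x, (min |X N x| K + X N x ^ 2 / K) ∂P := by
    refine integral_mono_of_nonneg (ae_of_all _ fun x => abs_nonneg _)
      (hmin.add (hsq.div_const K)) (ae_of_all _ fun x => ?_)
    show |X N x| ≤ min |X N x| K + X N x ^ 2 / K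
    rcases le_total |X N x| K with hx | hx
    · rw [min_eq_left hx]; have : 0 ≤ X N x ^ 2 / K := by positivity
      linarith
    · have : |X N x| ≤ X N x ^ 2 / K := by
        rw [le_div_iff₀ hK0, ← sq_abs]; nlinarith [abs_nonneg (X N x)]
      have : 0 ≤ min |X N x| K := by positivity
      linarith
  rw [integral_add hmin (hsq.div_const K), integral_div] at hle
  have h2 : (∫ x, X N x ^ 2 ∂P) / K < ε / 2 := by
    rw [div_lt_iff₀ hK0, hK]
    have : ε / 2 * (2 * (C + 1) / ε) = C + 1 := by field_simp
    rw [this]; linarith [hC N]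
  rw [abs_of_nonneg (integral_nonneg fun x => abs_nonneg _)]
  linarith [le_abs_self (∫ x, min |X N x| K ∂P)]

end

/-! ### Dynkin's formula for the reflected Brownian motion -/

section

variable {g g₁ g₂ : ℝ → ℝ} {M : ℝ}
variable {Ω : Type*} [mΩ : MeasurableSpace Ω] {P : Measure Ω} [IsProbabilityMeasure P]
  {𝓕 : Filtration ℝ≥0 mΩ} {B Y L₀ L₁ : ℝ≥0 → Ω → ℝ}

namespace IsReflectedBrownianMotion

lemma measurable_Y (h : IsReflectedBrownianMotion P 𝓕 B Y L₀ L₁) (t : ℝ≥0) : Measurable (Y t) :=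
  (h.adapted_Y t).mono (𝓕.le t) le_rfl

lemma measurable_B (h : IsReflectedBrownianMotion P 𝓕 B Y L₀ L₁) (t : ℝ≥0) : Measurable (B t) :=
  (h.adapted_B t).mono (𝓕.le t) le_rfl

lemma map_increment (h : IsReflectedBrownianMotion P 𝓕 B Y L₀ L₁) {r r' v : ℝ≥0}
    (hv : r' = r + v) : P.map (fun x => B r' x - B r x) = gaussianReal 0 v := by
  have := (h.brownian.hasLaw_sub r' r).map_eq
  have e : nndist r'.1 r.1 = v := by
    apply NNReal.coe_injective
    rw [coe_nndist, Real.dist_eq, hv]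
    simp
  rw [e] at this
  exact this

lemma integrable_increment_sq (h : IsReflectedBrownianMotion P 𝓕 B Y L₀ L₁) {r r' v : ℝ≥0}
    (hv : r' = r + v) : Integrable (fun x => (B r' x - B r x) ^ 2) P := by
  have hm : Measurable fun x => B r' x - B r x := (h.measurable_B r').sub (h.measurable_B r)
  have := integrable_pow_gaussianReal v 2
  rw [← h.map_increment hv, integrable_map_measure (by fun_prop) hm.aemeasurable] at this
  exact this

lemma integral_increment_sq (h : IsReflectedBrownianMotion P 𝓕 B Y L₀ L₁) {r r' v : ℝ≥0}
    (hv : r' = r + v) : ∫ x, (B r' x - B r x) ^ 2 ∂P = v := by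
  have hm : Measurable fun x => B r' x - B r x := (h.measurable_B r').sub (h.measurable_B r)
  rw [← integral_sq_gaussianReal, ← h.map_increment hv, integral_map hm.aemeasurable (by fun_prop)]

/-- The Markov property of the driving Brownian motion. -/
lemma integral_mul_incr (h : IsReflectedBrownianMotion P 𝓕 B Y L₀ L₁)
    (hg : BoundedNeumannC2 g g₁ g₂ M) {r r' v : ℝ≥0} (hv : r' = r + v) {Z : Ω → ℝ} {K : ℝ}
    (hZ : Measurable[𝓕 r] Z) (hK : ∀ x, |Z x| ≤ K) :
    ∫ x, Z x * (g (Y r x + (B r' x - B r x)) - g (Y r x)) ∂P =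
      ∫ x, Z x * gaussianIncr g v (Y r x) ∂P := by
  have hgc := hg.continuous
  have hm : Measurable fun x => B r' x - B r x := (h.measurable_B r').sub (h.measurable_B r)
  have hZY : Measurable[𝓕 r] fun x => (Z x, Y r x) := hZ.prodMk (h.adapted_Y r)
  have hZY' : Measurable fun x => (Z x, Y r x) := hZY.mono (𝓕.le r) le_rfl
  -- The pair is measurable with respect to `𝓕 r`, hence independent of the increment; the joint law
  -- is a product and Fubini integrates out the Gaussian variable first.
  have hind : IndepFun (fun x => (Z x, Y r x)) (fun x => B r' x - B r x) P := by
    rw [IndepFun_iff_Indep]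
    refine indep_of_indep_of_le_left
      (h.indep_increment r r' (by rw [hv]; exact le_self_add)).symm ?_
    exact hZY.comap_le
  have hprod := (indepFun_iff_map_prod_eq_prod_map_map hZY'.aemeasurable hm.aemeasurable).1 hind
  rw [h.map_increment hv] at hprod
  let F : (ℝ × ℝ) × ℝ → ℝ := fun p => p.1.1 * (g (p.1.2 + p.2) - g p.1.2)
  have hF : Continuous F := by fun_prop
  have hpm : Measurable fun x => ((Z x, Y r x), B r' x - B r x) := hZY'.prodMk hm
  have hint : Integrable F (P.map fun x => ((Z x, Y r x), B r' x - B r x)) := by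
    rw [integrable_map_measure hF.aestronglyMeasurable hpm.aemeasurable]
    refine Integrable.of_bound (C := K * (2 * M)) (hF.measurable.comp hpm).aestronglyMeasurable
      (ae_of_all _ fun x => ?_)
    rw [Function.comp_apply, Real.norm_eq_abs, abs_mul]
    exact mul_le_mul (hK x) (hg.abs_incr_le _ _) (abs_nonneg _) ((abs_nonneg _).trans (hK x))
  calc _ = ∫ p, F p ∂(P.map fun x => ((Z x, Y r x), B r' x - B r x)) := by
        rw [integral_map hpm.aemeasurable hF.aestronglyMeasurable]
    _ = ∫ u, ∫ b, F (u, b) ∂gaussianReal 0 v ∂(P.map fun x => (Z x, Y r x)) := by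
        rw [hprod] at hint ⊢
        rw [integral_prod F hint]
    _ = ∫ u : ℝ × ℝ, u.1 * gaussianIncr g v u.2 ∂(P.map fun x => (Z x, Y r x)) := by
        congr with u
        simp only [F, gaussianIncr, integral_const_mul]
    _ = _ := by
        have := hg.continuous_gaussianIncr v
        rw [integral_map hZY'.aemeasurable (by fun_prop)]

/-- The martingale part of the increment of `g` over one interval of the partition. -/
noncomputable def mgDiff (B Y : ℝ≥0 → Ω → ℝ) (g : ℝ → ℝ) (s T : ℝ≥0) (N k : ℕ) (x : Ω) : ℝ :=
  g (Y (node s T N k) x + (B (node s T N (k + 1)) x - B (node s T N k) x)) -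
    g (Y (node s T N k) x) - gaussianIncr g (T / N) (Y (node s T N k) x)

lemma measurable_mgDiff (h : IsReflectedBrownianMotion P 𝓕 B Y L₀ L₁)
    (hg : BoundedNeumannC2 g g₁ g₂ M) (s T : ℝ≥0) (N : ℕ) {k j : ℕ} (hkj : k + 1 ≤ j) :
    Measurable[𝓕 (node s T N j)] (mgDiff B Y g s T N k) := by
  have hgc := hg.continuous.measurable
  have hgi := (hg.continuous_gaussianIncr (T / N)).measurable
  have m1 : 𝓕 (node s T N k) ≤ 𝓕 (node s T N j) := 𝓕.mono (node_mono s T N (by omega))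
  have m2 : 𝓕 (node s T N (k + 1)) ≤ 𝓕 (node s T N j) := 𝓕.mono (node_mono s T N hkj)
  have hY := (h.adapted_Y (node s T N k)).mono m1 le_rfl
  have hB := (h.adapted_B (node s T N k)).mono m1 le_rfl
  have hB' := (h.adapted_B (node s T N (k + 1))).mono m2 le_rfl
  exact ((hgc.comp (hY.add (hB'.sub hB))).sub (hgc.comp hY)).sub (hgi.comp hY)

lemma abs_mgDiff_le (hg : BoundedNeumannC2 g g₁ g₂ M) (s T : ℝ≥0) (N k : ℕ) (x : Ω) :
    |mgDiff B Y g s T N k x| ≤ 2 * M + 3 * M * (T / N : ℝ≥0) :=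
  (abs_sub _ _).trans (add_le_add (hg.abs_incr_le _ _) (hg.abs_gaussianIncr_le _ _))

/-- The compensator is the conditional expectation of the Gaussian step. Taking for `Z` the earlier
partial sum gives orthogonality of the differences; taking a weight known at time `s` removes the
martingale part from Dynkin's formula. -/
lemma integral_mul_mgDiff (h : IsReflectedBrownianMotion P 𝓕 B Y L₀ L₁)
    (hg : BoundedNeumannC2 g g₁ g₂ M) (s T : ℝ≥0) (N k : ℕ) {Z : Ω → ℝ} {K : ℝ}
    (hZ : Measurable[𝓕 (node s T N k)] Z) (hK : ∀ x, |Z x| ≤ K) :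
    ∫ x, Z x * mgDiff B Y g s T N k x ∂P = 0 := by
  have hgc := hg.continuous.measurable
  have hgi := (hg.continuous_gaussianIncr (T / N)).measurable
  have hZ' : Measurable Z := hZ.mono (𝓕.le _) le_rfl
  have hY := h.measurable_Y (node s T N k)
  have hB := h.measurable_B (node s T N k)
  have hB' := h.measurable_B (node s T N (k + 1))
  have i1 : Integrable (fun x => Z x * (g (Y (node s T N k) x +
      (B (node s T N (k + 1)) x - B (node s T N k) x)) - g (Y (node s T N k) x))) P := by
    refine Integrable.of_bound (C := K * (2 * M)) (by fun_prop) (ae_of_all _ fun x => ?_)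
    rw [Real.norm_eq_abs, abs_mul]
    exact mul_le_mul (hK x) (hg.abs_incr_le _ _) (abs_nonneg _) ((abs_nonneg _).trans (hK x))
  have i2 : Integrable (fun x => Z x * gaussianIncr g (T / N) (Y (node s T N k) x)) P := by
    refine Integrable.of_bound (C := K * (3 * M * (T / N : ℝ≥0))) (by fun_prop)
      (ae_of_all _ fun x => ?_)
    rw [Real.norm_eq_abs, abs_mul]
    exact mul_le_mul (hK x) (hg.abs_gaussianIncr_le _ _) (abs_nonneg _)
      ((abs_nonneg _).trans (hK x))
  simp only [mgDiff, mul_sub _ (g _ - g _)]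
  rw [integral_sub i1 i2, h.integral_mul_incr hg (node_succ s T N k) hZ hK, sub_self]

/-- The Lipschitz bound makes the step at most `M |ΔB|` and the compensator is at most `3 M v` with
`v = T / N`; then `(x - y)² ≤ 2 x² + 2 y²`. -/
lemma integral_mgDiff_sq_le (h : IsReflectedBrownianMotion P 𝓕 B Y L₀ L₁)
    (hg : BoundedNeumannC2 g g₁ g₂ M) (s T : ℝ≥0) (N k : ℕ) :
    ∫ x, mgDiff B Y g s T N k x ^ 2 ∂P ≤
      2 * M ^ 2 * (1 + 9 * (T / N : ℝ≥0)) * (T / N : ℝ≥0) := by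
  set v : ℝ≥0 := T / N
  have hM := hg.nonneg
  have hi := h.integrable_increment_sq (node_succ s T N k)
  calc _ ≤ ∫ x, (2 * M ^ 2 * (B (node s T N (k + 1)) x - B (node s T N k) x) ^ 2 +
        2 * (3 * M * (v : ℝ)) ^ 2) ∂P := by
        refine integral_mono_of_nonneg (ae_of_all _ fun x => sq_nonneg _)
          ((hi.const_mul _).add (integrable_const _)) (ae_of_all _ fun x => ?_)
        set b := B (node s T N (k + 1)) x - B (node s T N k) x
        have e1 := hg.lipschitz (Y (node s T N k) x + b) (Y (node s T N k) x)
        rw [add_sub_cancel_left] at e1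
        have e2 := hg.abs_gaussianIncr_le v (Y (node s T N k) x)
        have s1 := sq_le_sq' (by linarith [neg_abs_le (g (Y (node s T N k) x + b) -
          g (Y (node s T N k) x))]) ((le_abs_self _).trans e1)
        have s2 := sq_le_sq' (by linarith [neg_abs_le (gaussianIncr g v (Y (node s T N k) x))])
          ((le_abs_self _).trans e2)
        rw [mul_pow M, sq_abs] at s1
        show mgDiff B Y g s T N k x ^ 2 ≤ 2 * M ^ 2 * b ^ 2 + 2 * (3 * M * (v : ℝ)) ^ 2
        simp only [mgDiff]
        nlinarith [sq_nonneg ((g (Y (node s T N k) x + b) - g (Y (node s T N k) x)) +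
          gaussianIncr g v (Y (node s T N k) x))]
    _ = _ := by
        rw [integral_add (hi.const_mul _) (integrable_const _), integral_const_mul,
          h.integral_increment_sq (node_succ s T N k)]
        simp only [integral_const, probReal_univ, smul_eq_mul, one_mul]
        ring

lemma measurable_sum_mgDiff (h : IsReflectedBrownianMotion P 𝓕 B Y L₀ L₁)
    (hg : BoundedNeumannC2 g g₁ g₂ M) (s T : ℝ≥0) (N n : ℕ) :
    Measurable[𝓕 (node s T N n)] fun x => ∑ k ∈ Finset.range n, mgDiff B Y g s T N k x :=
  Finset.measurable_fun_sum _ fun _ hk => h.measurable_mgDiff hg s T N (Finset.mem_range.1 hk)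

lemma abs_sum_mgDiff_le (hg : BoundedNeumannC2 g g₁ g₂ M) (s T : ℝ≥0) (N n : ℕ) (x : Ω) :
    |∑ k ∈ Finset.range n, mgDiff B Y g s T N k x| ≤ n * (2 * M + 3 * M * (T / N : ℝ≥0)) := by
  refine (Finset.abs_sum_le_sum_abs _ _).trans ?_
  refine (Finset.sum_le_sum fun k _ => abs_mgDiff_le hg s T N k x).trans_eq ?_
  rw [Finset.sum_const, Finset.card_range, nsmul_eq_mul]

/-- Martingale differences are orthogonal, so the second moments add. With `n = N` the bound stays
bounded as the mesh shrinks. -/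
lemma integral_sum_mgDiff_sq_le (h : IsReflectedBrownianMotion P 𝓕 B Y L₀ L₁)
    (hg : BoundedNeumannC2 g g₁ g₂ M) (s T : ℝ≥0) (N n : ℕ) :
    ∫ x, (∑ k ∈ Finset.range n, mgDiff B Y g s T N k x) ^ 2 ∂P ≤
      n * (2 * M ^ 2 * (1 + 9 * (T / N : ℝ≥0)) * (T / N : ℝ≥0)) := by
  induction n with
  | zero => simp
  | succ n ih =>
    have mS := (h.measurable_sum_mgDiff hg s T N n)
    have mS' := mS.mono (𝓕.le _) le_rfl
    have mD : Measurable (mgDiff B Y g s T N n) :=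
      (h.measurable_mgDiff hg s T N le_rfl).mono (𝓕.le _) le_rfl
    have bS := abs_sum_mgDiff_le (B := B) (Y := Y) hg s T N n
    have bD := abs_mgDiff_le (B := B) (Y := Y) hg s T N n
    have key : ∀ {f k : Ω → ℝ} {C D : ℝ}, Measurable f → Measurable k → (∀ x, |f x| ≤ C) →
        (∀ x, |k x| ≤ D) → Integrable (fun x => f x * k x) P := by
      intro f k C D hf hk hC hD
      refine Integrable.of_bound (C := C * D) (by fun_prop) (ae_of_all _ fun x => ?_)
      rw [Real.norm_eq_abs, abs_mul]
      exact mul_le_mul (hC x) (hD x) (abs_nonneg _) ((abs_nonneg _).trans (hC x))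
    have i1 := key mS' mS' bS bS
    have i2 := key mS' mD bS bD
    have i3 := key mD mD bD bD
    have hsq : ∀ x, (∑ k ∈ Finset.range (n + 1), mgDiff B Y g s T N k x) ^ 2 =
        (∑ k ∈ Finset.range n, mgDiff B Y g s T N k x) *
          (∑ k ∈ Finset.range n, mgDiff B Y g s T N k x) +
        2 * ((∑ k ∈ Finset.range n, mgDiff B Y g s T N k x) * mgDiff B Y g s T N n x) +
        mgDiff B Y g s T N n x * mgDiff B Y g s T N n x := fun x => by
      rw [Finset.sum_range_succ]; ring
    have i12 : Integrable (fun x => (∑ k ∈ Finset.range n, mgDiff B Y g s T N k x) *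
        (∑ k ∈ Finset.range n, mgDiff B Y g s T N k x) +
        2 * ((∑ k ∈ Finset.range n, mgDiff B Y g s T N k x) * mgDiff B Y g s T N n x)) P :=
      i1.add (i2.const_mul 2)
    simp only [hsq]
    rw [integral_add i12 i3, integral_add i1 (i2.const_mul 2), integral_const_mul,
      h.integral_mul_mgDiff hg s T N n mS bS]
    simp only [← sq]
    have := h.integral_mgDiff_sq_le hg s T N n
    rw [Nat.cast_succ, add_mul, one_mul, mul_zero, add_zero]
    exact add_le_add ih this

/-- The part of the increment of `g (Y)` due to the local times. -/
noncomputable def wallSum (B Y : ℝ≥0 → Ω → ℝ) (g : ℝ → ℝ) (s T : ℝ≥0) (N : ℕ) (x : Ω) : ℝ :=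
  ∑ k ∈ Finset.range N, (g (Y (node s T N (k + 1)) x) -
      g (Y (node s T N k) x + (B (node s T N (k + 1)) x - B (node s T N k) x)))

/-- A discrete Itô formula. The three sums are the wall term, the martingale and the compensator;
the last is close to a Riemann sum of `g₂ (Y) / 2`. -/
lemma increment_eq (B Y : ℝ≥0 → Ω → ℝ) (g : ℝ → ℝ) (s T : ℝ≥0) {N : ℕ} (hN : N ≠ 0) (x : Ω) :
    g (Y (s + T) x) - g (Y s x) = wallSum B Y g s T N x +
      ∑ k ∈ Finset.range N, mgDiff B Y g s T N k x +
      ∑ k ∈ Finset.range N, gaussianIncr g (T / N) (Y (node s T N k) x) := by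
  rw [wallSum, ← Finset.sum_add_distrib, ← Finset.sum_add_distrib, ← node_self s T hN]
  nth_rw 2 [← node_zero s T N]
  rw [← Finset.sum_range_sub (fun k => g (Y (node s T N k) x))]
  refine Finset.sum_congr rfl fun k _ => ?_
  simp only [mgDiff]
  ring

/-- Almost sure convergence is pathwise, but nothing is known about moments of the local times. The
`L²` bound needed for convergence in mean is read off `increment_eq` instead: the wall term is a
bounded increment, minus a bounded compensator, minus a martingale bounded in `L²`. -/
lemma tendsto_integral_abs_wallSum (h : IsReflectedBrownianMotion P 𝓕 B Y L₀ L₁)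
    (hg : BoundedNeumannC2 g g₁ g₂ M) (s T : ℝ≥0) :
    Tendsto (fun N => ∫ x, |wallSum B Y g s T N x| ∂P) atTop (𝓝 0) := by
  have hM := hg.nonneg
  have hgc := hg.continuous.measurable
  have hmeas : ∀ N, Measurable (wallSum B Y g s T N) := fun N => by
    refine Finset.measurable_fun_sum _ fun k _ => ?_
    have hY := h.measurable_Y (node s T N k)
    have hY' := h.measurable_Y (node s T N (k + 1))
    have hB := h.measurable_B (node s T N k)
    have hB' := h.measurable_B (node s T N (k + 1))
    fun_prop
  have hbd : ∀ N x, |wallSum B Y g s T N x| ≤ N * (2 * M) := fun N x => by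
    refine (Finset.abs_sum_le_sum_abs _ _).trans ?_
    refine (Finset.sum_le_sum fun k _ => (abs_sub _ _).trans
      (add_le_add (hg.bound _) (hg.bound _))).trans_eq ?_
    simp only [Finset.sum_const, Finset.card_range, nsmul_eq_mul]
    ring
  refine tendsto_integral_abs_of_ae_of_sq_le
    (C := 2 * (2 * M + 3 * M * T) ^ 2 + 2 * (2 * M ^ 2 * (1 + 9 * T) * T))
    (fun N => MemLp.of_bound (hmeas N).aestronglyMeasurable (N * (2 * M))
      (ae_of_all _ fun x => hbd N x)) (fun N => ?_) ?_
  · rcases eq_or_ne N 0 with rfl | hN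
    · simp only [wallSum, Finset.range_zero, Finset.sum_empty, ne_eq, OfNat.ofNat_ne_zero,
        not_false_eq_true, zero_pow, integral_zero]
      positivity
    have hN1 : (1 : ℝ) ≤ N := by exact_mod_cast Nat.one_le_iff_ne_zero.2 hN
    have hTN : (N : ℝ) * ((T / N : ℝ≥0) : ℝ) = T := by
      push_cast; field_simp
    have hTN' : ((T / N : ℝ≥0) : ℝ) ≤ T := by
      push_cast; exact div_le_self T.coe_nonneg hN1
    have mS := (h.measurable_sum_mgDiff hg s T N N).mono (𝓕.le _) le_rfl
    have iS : Integrable (fun x => (∑ k ∈ Finset.range N, mgDiff B Y g s T N k x) ^ 2) P :=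
      (MemLp.of_bound mS.aestronglyMeasurable _ (ae_of_all _ fun x =>
        abs_sum_mgDiff_le hg s T N N x) : MemLp _ 2 P).integrable_sq
    calc _ ≤ ∫ x, (2 * (2 * M + 3 * M * (T : ℝ)) ^ 2 +
          2 * (∑ k ∈ Finset.range N, mgDiff B Y g s T N k x) ^ 2) ∂P := by
          refine integral_mono_of_nonneg (ae_of_all _ fun x => sq_nonneg _)
            ((integrable_const _).add (iS.const_mul 2)) (ae_of_all _ fun x => ?_)
          show wallSum B Y g s T N x ^ 2 ≤ 2 * (2 * M + 3 * M * (T : ℝ)) ^ 2 +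
            2 * (∑ k ∈ Finset.range N, mgDiff B Y g s T N k x) ^ 2
          have heq := increment_eq B Y g s T hN x
          have e1 : |g (Y (s + T) x) - g (Y s x)| ≤ 2 * M :=
            (abs_sub _ _).trans (by linarith [hg.bound (Y (s + T) x), hg.bound (Y s x)])
          have e2 : |∑ k ∈ Finset.range N, gaussianIncr g (T / N) (Y (node s T N k) x)| ≤
              3 * M * T := by
            refine (Finset.abs_sum_le_sum_abs _ _).trans ?_
            refine (Finset.sum_le_sum fun k _ => hg.abs_gaussianIncr_le _ _).trans_eq ?_
            rw [Finset.sum_const, Finset.card_range, nsmul_eq_mul, mul_left_comm, hTN]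
          set S := ∑ k ∈ Finset.range N, mgDiff B Y g s T N k x
          set G := ∑ k ∈ Finset.range N, gaussianIncr g (T / N) (Y (node s T N k) x)
          have e3 : |g (Y (s + T) x) - g (Y s x) - G| ≤ 2 * M + 3 * M * T :=
            (abs_sub _ _).trans (add_le_add e1 e2)
          have e4 := sq_le_sq' (by linarith [neg_abs_le (g (Y (s + T) x) - g (Y s x) - G)])
            ((le_abs_self _).trans e3)
          have e5 : wallSum B Y g s T N x = (g (Y (s + T) x) - g (Y s x) - G) - S := by linarith
          rw [e5]
          nlinarith [sq_nonneg ((g (Y (s + T) x) - g (Y s x) - G) + S)]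
      _ = 2 * (2 * M + 3 * M * (T : ℝ)) ^ 2 +
          2 * ∫ x, (∑ k ∈ Finset.range N, mgDiff B Y g s T N k x) ^ 2 ∂P := by
          rw [integral_add (integrable_const _) (iS.const_mul 2), integral_const, probReal_univ,
            one_smul, integral_const_mul]
      _ ≤ _ := by
          have := h.integral_sum_mgDiff_sq_le hg s T N N
          rw [mul_left_comm, hTN] at this
          have : 2 * M ^ 2 * (1 + 9 * ((T / N : ℝ≥0) : ℝ)) * T ≤ 2 * M ^ 2 * (1 + 9 * T) * T := by
            gcongr
          linarith
  · filter_upwards [h.continuous_Y, h.continuous_L₀, h.continuous_L₁, h.L₀_mono, h.L₁_mono,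
      h.L₀_grows, h.L₁_grows, h.equation] with x a1 a2 a3 a4 a5 a6 a7 a8
    exact hg.tendsto_sum_step a1 a2 a3 a4 a5 a6 a7 a8 s T

lemma continuous_integral_mul (h : IsReflectedBrownianMotion P 𝓕 B Y L₀ L₁) {a : ℝ → ℝ}
    (ha : Continuous a) {Z : Ω → ℝ} {K : ℝ} (hZ : Measurable Z) (hK : ∀ x, |Z x| ≤ K) :
    Continuous fun t => ∫ x, Z x * a (Y t x) ∂P := by
  obtain ⟨C, hC⟩ := (isCompact_Icc (a := (0 : ℝ)) (b := 1)).exists_bound_of_continuousOn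
    ha.continuousOn
  refine continuous_of_dominated (bound := fun _ => K * C) (fun t => ?_) (fun t => ?_)
    (integrable_const _) ?_
  · have := h.measurable_Y t
    have := ha.measurable
    fun_prop
  · filter_upwards [h.confined] with x hx
    rw [norm_mul]
    exact mul_le_mul (hK x) (hC _ (hx t)) (norm_nonneg _) ((abs_nonneg _).trans (hK x))
  · filter_upwards [h.continuous_Y] with x hx
    fun_prop

/-- Multiply the discrete Itô formula by `Z` and average: the wall term tends to `0`, the martingale
part vanishes, and the compensators converge to the time integral. -/
lemma dynkin_of_bounded (h : IsReflectedBrownianMotion P 𝓕 B Y L₀ L₁)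
    (hg : BoundedNeumannC2 g g₁ g₂ M) (s T : ℝ≥0) {Z : Ω → ℝ} {K : ℝ}
    (hZ : Measurable[𝓕 s] Z) (hK : ∀ x, |Z x| ≤ K) :
    ∫ x, Z x * g (Y (s + T) x) ∂P - ∫ x, Z x * g (Y s x) ∂P =
      ∫ q in (s : ℝ)..(s + T : ℝ≥0), ∫ x, Z x * (g₂ (Y q.toNNReal x) / 2) ∂P := by
  have hM := hg.nonneg
  have hK0 : 0 ≤ K := by
    obtain ⟨x⟩ : Nonempty Ω := P.nonempty_of_neZero
    exact (abs_nonneg _).trans (hK x)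
  have hgc := hg.continuous.measurable
  have hg2c := hg.cont.measurable
  have hZ' : Measurable Z := hZ.mono (𝓕.le _) le_rfl
  have key : ∀ {k : Ω → ℝ} {D : ℝ}, Measurable k → (∀ x, |k x| ≤ D) →
      Integrable (fun x => Z x * k x) P := by
    intro k D hk hD
    refine Integrable.of_bound (C := K * D) (by fun_prop) (ae_of_all _ fun x => ?_)
    rw [Real.norm_eq_abs, abs_mul]
    exact mul_le_mul (hK x) (hD x) (abs_nonneg _) ((abs_nonneg _).trans (hK x))
  have hφ : Continuous fun t => ∫ x, Z x * (g₂ (Y t x) / 2) ∂P :=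
    h.continuous_integral_mul (hg.cont.div_const 2) hZ' hK
  have hR := tendsto_riemann_sum hφ s T
  refine tendsto_nhds_unique (f := fun _ : ℕ => ∫ x, Z x * g (Y (s + T) x) ∂P -
    ∫ x, Z x * g (Y s x) ∂P) (l := atTop) tendsto_const_nhds ?_
  have hW := (h.tendsto_integral_abs_wallSum hg s T).const_mul K
  rw [mul_zero] at hW
  have hdiff : Tendsto (fun N : ℕ => (∫ x, Z x * g (Y (s + T) x) ∂P - ∫ x, Z x * g (Y s x) ∂P) -
      ∑ k ∈ Finset.range N, ((T / N : ℝ≥0) : ℝ) *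
        ∫ x, Z x * (g₂ (Y (node s T N k) x) / 2) ∂P) atTop (𝓝 0) := by
    rw [Metric.tendsto_atTop]
    intro ε hε
    -- One third of `ε` each for the wall term, for the Taylor error `K T η`, and for the error
    -- proportional to the mesh.
    set η : ℝ := ε / (3 * (K * T + 1)) with hη
    have hη0 : 0 < η := by positivity
    obtain ⟨C, hC0, hC⟩ := hg.abs_gaussianIncr_sub_le hη0
    have hmesh : Tendsto (fun N : ℕ => K * T * (C * ((T / N : ℝ≥0) : ℝ))) atTop (𝓝 0) := by
      simpa using ((tendsto_mesh T).const_mul C).const_mul (K * T)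
    obtain ⟨N₀, hN₀⟩ := eventually_atTop.1
      ((hW.eventually_lt_const (show (0 : ℝ) < ε / 3 by positivity)).and
        (hmesh.eventually_lt_const (show (0 : ℝ) < ε / 3 by positivity)))
    refine ⟨max N₀ 1, fun N hN => ?_⟩
    have hN1 : N ≠ 0 := by have := le_of_max_le_right hN; omega
    obtain ⟨w1, w2⟩ := hN₀ N (le_of_max_le_left hN)
    have hTN : (N : ℝ) * ((T / N : ℝ≥0) : ℝ) = T := by
      have : (N : ℝ) ≠ 0 := by exact_mod_cast hN1
      push_cast; field_simp
    have mW : Measurable (wallSum B Y g s T N) := by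
      refine Finset.measurable_fun_sum _ fun k _ => ?_
      have hY := h.measurable_Y (node s T N k)
      have hY' := h.measurable_Y (node s T N (k + 1))
      have hB := h.measurable_B (node s T N k)
      have hB' := h.measurable_B (node s T N (k + 1))
      fun_prop
    have mS := h.measurable_sum_mgDiff hg s T N N
    have bW : ∀ x, |wallSum B Y g s T N x| ≤ N * (2 * M) := fun x => by
      refine (Finset.abs_sum_le_sum_abs _ _).trans ?_
      refine (Finset.sum_le_sum fun k _ => (abs_sub _ _).trans
        (add_le_add (hg.bound _) (hg.bound _))).trans_eq ?_
      simp only [Finset.sum_const, Finset.card_range, nsmul_eq_mul]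
      ring
    have mG : ∀ k, Measurable fun x => gaussianIncr g (T / N) (Y (node s T N k) x) := fun k =>
      (hg.continuous_gaussianIncr _).measurable.comp (h.measurable_Y _)
    have mG2 : ∀ k, Measurable fun x => g₂ (Y (node s T N k) x) / 2 := fun k =>
      (hg2c.comp (h.measurable_Y _)).div_const 2
    have iG : ∀ k, Integrable (fun x => Z x * gaussianIncr g (T / N) (Y (node s T N k) x)) P :=
      fun k => key (mG k) fun x => hg.abs_gaussianIncr_le _ _
    have iG2 : ∀ k, Integrable (fun x => Z x * (g₂ (Y (node s T N k) x) / 2)) P :=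
      fun k => key (D := M) (mG2 k) fun x => by
        rw [abs_div, abs_two]; linarith [hg.bound₂ (Y (node s T N k) x)]
    have iW : Integrable (fun x => Z x * wallSum B Y g s T N x) P := key mW bW
    have iS : ∀ k, Integrable (fun x => Z x * mgDiff B Y g s T N k x) P := fun k =>
      key ((h.measurable_mgDiff hg s T N le_rfl).mono (𝓕.le _) le_rfl)
        (abs_mgDiff_le (B := B) (Y := Y) hg s T N k)
    have hdec : ∫ x, Z x * g (Y (s + T) x) ∂P - ∫ x, Z x * g (Y s x) ∂P =
        ∫ x, Z x * wallSum B Y g s T N x ∂P +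
          ∑ k ∈ Finset.range N, ∫ x, Z x * gaussianIncr g (T / N) (Y (node s T N k) x) ∂P := by
      have e0 : ∑ k ∈ Finset.range N, ∫ x, Z x * mgDiff B Y g s T N k x ∂P = 0 :=
        Finset.sum_eq_zero fun k _ => h.integral_mul_mgDiff hg s T N k
          (hZ.mono (𝓕.mono (node_mem s T (k := 0) (Nat.zero_le N) |>.1.trans
            (node_mono s T N (Nat.zero_le k)))) le_rfl) hK
      have ig : ∀ t, Integrable (fun x => Z x * g (Y t x)) P := fun t =>
        key (hgc.comp (h.measurable_Y t)) fun x => hg.bound _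
      have iWS : Integrable (fun x => Z x * wallSum B Y g s T N x +
          ∑ k ∈ Finset.range N, Z x * mgDiff B Y g s T N k x) P :=
        iW.add (integrable_finsetSum _ fun k _ => iS k)
      rw [← integral_sub (ig _) (ig _), ← integral_finsetSum _
        fun k _ => iG k, ← add_zero (∫ x, Z x * wallSum B Y g s T N x ∂P), ← e0,
        ← integral_finsetSum _ fun k _ => iS k, ← integral_add iW
        (integrable_finsetSum _ fun k _ => iS k), ← integral_add
        iWS (integrable_finsetSum _ fun k _ => iG k)]
      refine integral_congr_ae (ae_of_all _ fun x => ?_)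
      simp only [← Finset.mul_sum]
      rw [← mul_sub, increment_eq B Y g s T hN1 x]
      ring
    have hwall : |∫ x, Z x * wallSum B Y g s T N x ∂P| ≤
        K * ∫ x, |wallSum B Y g s T N x| ∂P := by
      rw [← integral_const_mul, ← Real.norm_eq_abs]
      refine norm_integral_le_of_norm_le ((Integrable.of_bound mW.aestronglyMeasurable _
        (ae_of_all _ bW)).abs.const_mul K) (ae_of_all _ fun x => ?_)
      rw [Real.norm_eq_abs, abs_mul]
      exact mul_le_mul_of_nonneg_right (hK x) (abs_nonneg _)
    have hterm : ∀ k ∈ Finset.range N,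
        |∫ x, Z x * gaussianIncr g (T / N) (Y (node s T N k) x) ∂P -
          ((T / N : ℝ≥0) : ℝ) * ∫ x, Z x * (g₂ (Y (node s T N k) x) / 2) ∂P| ≤
        ((T / N : ℝ≥0) : ℝ) * (K * (η + C * ((T / N : ℝ≥0) : ℝ))) := by
      intro k _
      rw [← integral_const_mul, ← integral_sub (iG k) ((iG2 k).const_mul _), ← Real.norm_eq_abs]
      refine (norm_integral_le_of_norm_le_const (C := K * (((T / N : ℝ≥0) : ℝ) *
        (η + C * ((T / N : ℝ≥0) : ℝ)))) (ae_of_all _ fun x => ?_)).trans_eq ?_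
      · rw [show Z x * gaussianIncr g (T / N) (Y (node s T N k) x) -
          ((T / N : ℝ≥0) : ℝ) * (Z x * (g₂ (Y (node s T N k) x) / 2)) =
          Z x * (gaussianIncr g (T / N) (Y (node s T N k) x) -
            ((T / N : ℝ≥0) : ℝ) * (g₂ (Y (node s T N k) x) / 2)) by ring, Real.norm_eq_abs, abs_mul]
        exact mul_le_mul (hK x) (hC _ _) (abs_nonneg _) hK0
      · rw [probReal_univ]; ring
    have hsum := (Finset.abs_sum_le_sum_abs _ _).trans (Finset.sum_le_sum hterm)
    rw [Finset.sum_sub_distrib, Finset.sum_const, Finset.card_range, nsmul_eq_mul, ← mul_assoc,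
      hTN] at hsum
    rw [Real.dist_eq, sub_zero, hdec, add_sub_assoc]
    refine (abs_add_le _ _).trans_lt ?_
    have hηK : T * (K * η) ≤ ε / 3 := by
      rw [hη, ← mul_div_assoc, ← mul_div_assoc, div_le_div_iff₀ (by positivity) (by norm_num)]
      nlinarith
    nlinarith
  have := hdiff.add hR
  simpa using this

/-- **Dynkin's formula**, conditionally on the past. -/
theorem dynkin (h : IsReflectedBrownianMotion P 𝓕 B Y L₀ L₁)
    (hg : NeumannC2 g g₁ g₂) {s t : ℝ≥0} (hst : s ≤ t) {Z : Ω → ℝ} {K : ℝ}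
    (hZ : Measurable[𝓕 s] Z) (hK : ∀ x, |Z x| ≤ K) :
    ∫ x, Z x * g (Y t x) ∂P - ∫ x, Z x * g (Y s x) ∂P =
      ∫ q in (s : ℝ)..t, ∫ x, Z x * (g₂ (Y q.toNNReal x) / 2) ∂P := by
  obtain ⟨k, k₁, k₂, M, hk, hkg⟩ := hg.exists_bounded
  obtain ⟨T, rfl⟩ := exists_add_of_le hst
  have := h.dynkin_of_bounded hk s T hZ hK
  have e1 : ∀ t, ∫ x, Z x * k (Y t x) ∂P = ∫ x, Z x * g (Y t x) ∂P := fun t =>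
    integral_congr_ae (by filter_upwards [h.confined] with x hx; rw [(hkg _ (hx t)).1])
  have e2 : ∀ t, ∫ x, Z x * (k₂ (Y t x) / 2) ∂P = ∫ x, Z x * (g₂ (Y t x) / 2) ∂P := fun t =>
    integral_congr_ae (by filter_upwards [h.confined] with x hx; rw [(hkg _ (hx t)).2])
  simpa only [e1, e2] using this

end IsReflectedBrownianMotion

end

/-! ### Correctors, and time averages along the path -/

section

/-- `cos (α t) p (y) - sin (α t) q (y)` is a classical solution, for all `y`, of
`(1/2) f_yy + f_t = cos (α t) a (y)`, with the Neumann condition at `0` and `1`. -/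
structure IsCorrector (α : ℝ) (a p p₁ p₂ q q₁ q₂ : ℝ → ℝ) : Prop where
  neumann_p : NeumannC2 p p₁ p₂
  neumann_q : NeumannC2 q q₁ q₂
  eq_p : ∀ y, p₂ y / 2 = a y + α * q y
  eq_q : ∀ y, q₂ y / 2 = -(α * p y)

lemma hasDerivAt_integral_of_continuous {E : Type*} [NormedAddCommGroup E] [NormedSpace ℝ E]
    [CompleteSpace E] {f : ℝ → E} (hf : Continuous f) (a y : ℝ) :
    HasDerivAt (fun y => ∫ x in a..y, f x) (f y) y :=
  (hf.integral_hasStrictDerivAt a y).hasDerivAt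

lemma sinh_one_sub_I_mul (h : ℝ) : Complex.sinh ((1 - Complex.I) * h) =
    (Real.sinh h * Real.cos h : ℝ) - (Real.cosh h * Real.sin h : ℝ) * Complex.I := by
  rw [show (1 - Complex.I) * (h : ℂ) = h + -h * Complex.I by ring, Complex.sinh_add,
    Complex.sinh_mul_I, Complex.cosh_mul_I, Complex.cos_neg, Complex.sin_neg]
  push_cast
  ring

lemma cosh_one_sub_I_mul (h : ℝ) : Complex.cosh ((1 - Complex.I) * h) =
    (Real.cosh h * Real.cos h : ℝ) - (Real.sinh h * Real.sin h : ℝ) * Complex.I := by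
  rw [show (1 - Complex.I) * (h : ℂ) = h + -h * Complex.I by ring, Complex.cosh_add,
    Complex.sinh_mul_I, Complex.cosh_mul_I, Complex.cos_neg, Complex.sin_neg]
  push_cast
  ring

/-- Both parts of the number could vanish only if `cos h = sin h = 0`. This absence of resonance
makes the oscillatory Neumann problem solvable at every positive frequency, on the whole channel (`h
= ν`) and on the half channel (`h = ν / 2`). -/
lemma sinh_one_sub_I_mul_ne_zero {h : ℝ} (hh : 0 < h) :
    Complex.sinh ((1 - Complex.I) * h) ≠ 0 := by
  intro h0
  rw [sinh_one_sub_I_mul] at h0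
  have hre := congrArg Complex.re h0
  have him := congrArg Complex.im h0
  simp only [Complex.sub_re, Complex.ofReal_re, Complex.mul_re, Complex.I_re, mul_zero,
    Complex.ofReal_im, Complex.I_im, mul_one, sub_self, sub_zero, Complex.zero_re] at hre
  simp only [Complex.sub_im, Complex.ofReal_im, Complex.mul_im, Complex.ofReal_re, Complex.I_im,
    mul_one, Complex.I_re, mul_zero, add_zero, zero_sub, Complex.zero_im, neg_eq_zero] at him
  have h1 : Real.cos h = 0 := (mul_eq_zero.1 hre).resolve_left (Real.sinh_pos_iff.2 hh).ne'
  have h2 : Real.sin h = 0 := (mul_eq_zero.1 him).resolve_left (Real.cosh_pos h).ne'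
  have := Real.sin_sq_add_cos_sq h
  rw [h1, h2] at this
  norm_num at this

/-- Solution of the oscillatory two-point problem by variation of constants. -/
lemma exists_complex_corrector {α : ℝ} (hα : 0 < α) {a : ℝ → ℝ} (ha : Continuous a) :
    ∃ G G₁ G₂ : ℝ → ℂ, (∀ y, HasDerivAt G (G₁ y) y) ∧ (∀ y, HasDerivAt G₁ (G₂ y) y) ∧
      Continuous G₂ ∧ G₁ 0 = 0 ∧ G₁ 1 = 0 ∧
      ∀ y, G₂ y / 2 + Complex.I * α * G y = a y := by
  set ν : ℝ := √α
  have hν : 0 < ν := Real.sqrt_pos.2 hα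
  have hνα : (ν : ℂ) ^ 2 = α := by exact_mod_cast Real.sq_sqrt hα.le
  -- Since `κ² = -2 i α`, the equation reads `G'' = 2 a + κ² G`.
  set κ : ℂ := (1 - Complex.I) * ν with hκ
  have hκ2 : κ ^ 2 = -2 * Complex.I * α := by
    rw [hκ, mul_pow, hνα]
    linear_combination (α : ℂ) * Complex.I_sq
  have hκ0 : κ ≠ 0 := by
    intro h0
    rw [h0] at hκ2
    have : (α : ℂ) = 0 := by
      have h3 : (-2 * Complex.I) * (α : ℂ) = 0 := by rw [← hκ2]; simp
      exact (mul_eq_zero.1 h3).resolve_left (by simp)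
    exact hα.ne' (by exact_mod_cast this)
  have hsinh : Complex.sinh κ ≠ 0 := sinh_one_sub_I_mul_ne_zero hν
  have hch : Continuous fun y : ℝ => Complex.cosh (κ * y) * a y :=
    ((Complex.continuous_cosh.comp (continuous_const.mul Complex.continuous_ofReal))).mul
      (Complex.continuous_ofReal.comp ha)
  have hsh : Continuous fun y : ℝ => Complex.sinh (κ * y) * a y :=
    ((Complex.continuous_sinh.comp (continuous_const.mul Complex.continuous_ofReal))).mul
      (Complex.continuous_ofReal.comp ha)
  let C : ℝ → ℂ := fun y => ∫ x in (0 : ℝ)..y, Complex.cosh (κ * x) * a x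
  let S : ℝ → ℂ := fun y => ∫ x in (0 : ℝ)..y, Complex.sinh (κ * x) * a x
  have dC : ∀ y : ℝ, HasDerivAt C (Complex.cosh (κ * y) * a y) y :=
    hasDerivAt_integral_of_continuous hch 0
  have dS : ∀ y : ℝ, HasDerivAt S (Complex.sinh (κ * y) * a y) y :=
    hasDerivAt_integral_of_continuous hsh 0
  have dlin : ∀ y : ℝ, HasDerivAt (fun y : ℝ => κ * (y : ℂ)) κ y := fun y => by
    simpa using (Complex.ofRealCLM.hasDerivAt (x := y)).const_mul κ
  have dch : ∀ y : ℝ, HasDerivAt (fun y : ℝ => Complex.cosh (κ * y)) (Complex.sinh (κ * y) * κ) y :=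
    fun y => (Complex.hasDerivAt_cosh _).comp y (dlin y)
  have dsh : ∀ y : ℝ, HasDerivAt (fun y : ℝ => Complex.sinh (κ * y)) (Complex.cosh (κ * y) * κ) y :=
    fun y => (Complex.hasDerivAt_sinh _).comp y (dlin y)
  -- The variation-of-constants term already has zero slope at `0`; the multiple of `cosh (κ y)`
  -- keeps that and is fixed by requiring zero slope at `1`.
  let c : ℂ := -(2 * (Complex.cosh κ * C 1 - Complex.sinh κ * S 1)) / (κ * Complex.sinh κ)
  let G : ℝ → ℂ := fun y => 2 / κ * (Complex.sinh (κ * y) * C y - Complex.cosh (κ * y) * S y) +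
    c * Complex.cosh (κ * y)
  let G₁ : ℝ → ℂ := fun y => 2 * (Complex.cosh (κ * y) * C y - Complex.sinh (κ * y) * S y) +
    c * (Complex.sinh (κ * y) * κ)
  let G₂ : ℝ → ℂ := fun y => 2 * a y + κ ^ 2 * G y
  have d1 : ∀ y, HasDerivAt G (G₁ y) y := fun y => by
    have := ((((dsh y).mul (dC y)).sub ((dch y).mul (dS y))).const_mul (2 / κ)).add
      ((dch y).const_mul c)
    refine this.congr_deriv ?_
    simp only [G₁]
    field_simp
    ring
  have d2 : ∀ y, HasDerivAt G₁ (G₂ y) y := fun y => by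
    have := ((((dch y).mul (dC y)).sub ((dsh y).mul (dS y))).const_mul 2).add
      (((dsh y).mul_const κ).const_mul c)
    refine this.congr_deriv ?_
    simp only [G₂, G]
    field_simp
    linear_combination (2 * (a y : ℂ)) * Complex.cosh_sq_sub_sinh_sq (κ * y)
  refine ⟨G, G₁, G₂, d1, d2, ?_, ?_, ?_, fun y => ?_⟩
  · have : Continuous G := continuous_iff_continuousAt.2 fun y => (d1 y).continuousAt
    exact (continuous_const.mul (Complex.continuous_ofReal.comp ha)).add (continuous_const.mul this)
  · simp [G₁, C, S]
  · simp only [G₁, c, Complex.ofReal_one, mul_one]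
    field_simp
    ring
  · simp only [G₂, hκ2]
    ring

lemma exists_corrector {α : ℝ} (hα : 0 < α) {a : ℝ → ℝ} (ha : Continuous a) :
    ∃ p p₁ p₂ q q₁ q₂, IsCorrector α a p p₁ p₂ q q₁ q₂ := by
  obtain ⟨G, G₁, G₂, d1, d2, hc, h0, h1, he⟩ := exists_complex_corrector hα ha
  have re : ∀ {F F' : ℝ → ℂ}, (∀ y, HasDerivAt F (F' y) y) →
      ∀ y, HasDerivAt (fun y => (F y).re) (F' y).re y := fun h y =>
    Complex.reCLM.hasFDerivAt.comp_hasDerivAt y (h y)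
  have im : ∀ {F F' : ℝ → ℂ}, (∀ y, HasDerivAt F (F' y) y) →
      ∀ y, HasDerivAt (fun y => (F y).im) (F' y).im y := fun h y =>
    Complex.imCLM.hasFDerivAt.comp_hasDerivAt y (h y)
  refine ⟨fun y => (G y).re, fun y => (G₁ y).re, fun y => (G₂ y).re, fun y => (G y).im,
    fun y => (G₁ y).im, fun y => (G₂ y).im,
    ⟨re d1, re d2, Complex.continuous_re.comp hc, by simp [h0], by simp [h1]⟩,
    ⟨im d1, im d2, Complex.continuous_im.comp hc, by simp [h0], by simp [h1]⟩,
    fun y => ?_, fun y => ?_⟩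
  · have := congrArg Complex.re (he y)
    simp at this
    linarith
  · have := congrArg Complex.im (he y)
    simp at this
    linarith

/-- Solution of the stationary two-point problem. -/
lemma exists_stationary_corrector {a : ℝ → ℝ} (ha : Continuous a) :
    ∃ p p₁ p₂, NeumannC2 p p₁ p₂ ∧ ∀ y, p₂ y / 2 = a y - ∫ x in (0 : ℝ)..1, a x := by
  set m := ∫ x in (0 : ℝ)..1, a x with hm
  have hc : Continuous fun y => 2 * (a y - m) := by fun_prop
  have d1 := hasDerivAt_integral_of_continuous hc 0
  have hc1 : Continuous fun y => ∫ x in (0 : ℝ)..y, 2 * (a x - m) :=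
    continuous_iff_continuousAt.2 fun y => (d1 y).continuousAt
  refine ⟨_, _, _, ⟨hasDerivAt_integral_of_continuous hc1 0, d1, hc, by simp, ?_⟩, fun y => by ring⟩
  -- The Neumann condition at `1` is the solvability condition: the forcing has mean zero.
  rw [intervalIntegral.integral_const_mul, intervalIntegral.integral_sub
    (ha.intervalIntegrable _ _) (by simp), ← hm]
  simp

variable {Ω : Type*} [mΩ : MeasurableSpace Ω] {P : Measure Ω} [IsProbabilityMeasure P]
  {𝓕 : Filtration ℝ≥0 mΩ} {B Y L₀ L₁ : ℝ≥0 → Ω → ℝ}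
  {α : ℝ} {a p p₁ p₂ q q₁ q₂ : ℝ → ℝ}

namespace IsReflectedBrownianMotion

/-- Integrated Dynkin formula for an oscillating forcing. -/
lemma integral_cos_and_sin (h : IsReflectedBrownianMotion P 𝓕 B Y L₀ L₁)
    (ha : Continuous a) (hc : IsCorrector α a p p₁ p₂ q q₁ q₂) {s t : ℝ≥0} (hst : s ≤ t)
    {Z : Ω → ℝ} {K : ℝ} (hZ : Measurable[𝓕 s] Z) (hK : ∀ x, |Z x| ≤ K) :
    (∫ r in (s : ℝ)..t, Real.cos (α * r) * ∫ x, Z x * a (Y r.toNNReal x) ∂P =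
      (Real.cos (α * t) * ∫ x, Z x * p (Y t x) ∂P - Real.sin (α * t) * ∫ x, Z x * q (Y t x) ∂P) -
      (Real.cos (α * s) * ∫ x, Z x * p (Y s x) ∂P -
        Real.sin (α * s) * ∫ x, Z x * q (Y s x) ∂P)) ∧
    (∫ r in (s : ℝ)..t, Real.sin (α * r) * ∫ x, Z x * a (Y r.toNNReal x) ∂P =
      (Real.sin (α * t) * ∫ x, Z x * p (Y t x) ∂P + Real.cos (α * t) * ∫ x, Z x * q (Y t x) ∂P) -
      (Real.sin (α * s) * ∫ x, Z x * p (Y s x) ∂P +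
        Real.cos (α * s) * ∫ x, Z x * q (Y s x) ∂P)) := by
  have hZ' : Measurable Z := hZ.mono (𝓕.le _) le_rfl
  have cont : ∀ {k : ℝ → ℝ}, Continuous k →
      Continuous fun r : ℝ => ∫ x, Z x * k (Y r.toNNReal x) ∂P := fun hk =>
    (h.continuous_integral_mul hk hZ' hK).comp continuous_real_toNNReal
  have hpc := hc.neumann_p.continuous
  have hqc := hc.neumann_q.continuous
  have int : ∀ {k : ℝ → ℝ}, Continuous k → ∀ r : ℝ≥0, Integrable (fun x => Z x * k (Y r x)) P := by
    intro k hk r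
    obtain ⟨C, hC⟩ := (isCompact_Icc (a := (0 : ℝ)) (b := 1)).exists_bound_of_continuousOn
      hk.continuousOn
    have := h.measurable_Y r
    have := hk.measurable
    refine Integrable.of_bound (C := K * C) (by fun_prop) ?_
    filter_upwards [h.confined] with x hx
    rw [norm_mul]
    exact mul_le_mul (hK x) (hC _ (hx r)) (norm_nonneg _) ((abs_nonneg _).trans (hK x))
  let φ : ℝ → ℝ := fun r => ∫ x, Z x * (p₂ (Y r.toNNReal x) / 2) ∂P
  let ψ : ℝ → ℝ := fun r => ∫ x, Z x * (q₂ (Y r.toNNReal x) / 2) ∂P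
  have cφ : Continuous φ := cont (hc.neumann_p.cont.div_const 2)
  have cψ : Continuous ψ := cont (hc.neumann_q.cont.div_const 2)
  -- The right-hand side of Dynkin's formula serves as definition, so that differentiability in `r`
  -- holds on all of `ℝ`; it agrees with the moment of `p (Y)` only for `r ≥ s`. The two identities
  -- are then the real and imaginary parts of the derivative of `exp (i α r) (mp + i mq)`.
  let mp : ℝ → ℝ := fun r => (∫ x, Z x * p (Y s x) ∂P) + ∫ q in (s : ℝ)..r, φ q
  let mq : ℝ → ℝ := fun r => (∫ x, Z x * q (Y s x) ∂P) + ∫ q in (s : ℝ)..r, ψ q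
  have dp : ∀ r, HasDerivAt mp (φ r) r := fun r =>
    (hasDerivAt_integral_of_continuous cφ _ r).const_add _
  have dq : ∀ r, HasDerivAt mq (ψ r) r := fun r =>
    (hasDerivAt_integral_of_continuous cψ _ r).const_add _
  have emp : ∀ r : ℝ≥0, s ≤ r → mp r = ∫ x, Z x * p (Y r x) ∂P := fun r hr => by
    simp only [mp, φ]
    rw [← h.dynkin hc.neumann_p hr hZ hK]
    ring
  have emq : ∀ r : ℝ≥0, s ≤ r → mq r = ∫ x, Z x * q (Y r x) ∂P := fun r hr => by
    simp only [mq, ψ]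
    rw [← h.dynkin hc.neumann_q hr hZ hK]
    ring
  have hφ : ∀ r ∈ uIcc (s : ℝ) t, φ r = (∫ x, Z x * a (Y r.toNNReal x) ∂P) + α * mq r := by
    intro r hr
    rw [uIcc_of_le (by exact_mod_cast hst)] at hr
    have hr0 : 0 ≤ r := s.coe_nonneg.trans hr.1
    have hr' : ((r.toNNReal : ℝ≥0) : ℝ) = r := Real.coe_toNNReal r hr0
    rw [← hr', emq _ (by rw [← NNReal.coe_le_coe, hr']; exact hr.1), ← integral_const_mul, hr',
      ← integral_add (int ha _) ((int hqc _).const_mul α)]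
    refine integral_congr_ae (ae_of_all _ fun x => ?_)
    simp only [hc.eq_p]
    ring
  have hψ : ∀ r ∈ uIcc (s : ℝ) t, ψ r = -(α * mp r) := by
    intro r hr
    rw [uIcc_of_le (by exact_mod_cast hst)] at hr
    have hr0 : 0 ≤ r := s.coe_nonneg.trans hr.1
    have hr' : ((r.toNNReal : ℝ≥0) : ℝ) = r := Real.coe_toNNReal r hr0
    rw [← hr', emp _ (by rw [← NNReal.coe_le_coe, hr']; exact hr.1), ← integral_const_mul, hr',
      ← integral_neg]
    refine integral_congr_ae (ae_of_all _ fun x => ?_)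
    simp only [hc.eq_q]
    ring
  have dcos : ∀ r : ℝ, HasDerivAt (fun r => Real.cos (α * r)) (-Real.sin (α * r) * α) r := fun r =>
    by simpa using ((hasDerivAt_id r).const_mul α).cos
  have dsin : ∀ r : ℝ, HasDerivAt (fun r => Real.sin (α * r)) (Real.cos (α * r) * α) r := fun r =>
    by simpa using ((hasDerivAt_id r).const_mul α).sin
  have ccos : Continuous fun r : ℝ => Real.cos (α * r) := by fun_prop
  have csin : Continuous fun r : ℝ => Real.sin (α * r) := by fun_prop
  rw [← emp t hst, ← emq t hst, ← emp s le_rfl, ← emq s le_rfl]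
  constructor
  · refine intervalIntegral.integral_eq_sub_of_hasDerivAt
      (f := fun r => Real.cos (α * r) * mp r - Real.sin (α * r) * mq r) (fun r hr => ?_)
      ((ccos.mul (cont ha)).intervalIntegrable _ _)
    refine (((dcos r).mul (dp r)).sub ((dsin r).mul (dq r))).congr_deriv ?_
    rw [hφ r hr, hψ r hr]
    ring
  · refine intervalIntegral.integral_eq_sub_of_hasDerivAt
      (f := fun r => Real.sin (α * r) * mp r + Real.cos (α * r) * mq r) (fun r hr => ?_)
      ((csin.mul (cont ha)).intervalIntegrable _ _)
    refine (((dsin r).mul (dp r)).add ((dcos r).mul (dq r))).congr_deriv ?_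
    rw [hφ r hr, hψ r hr]
    ring

lemma exists_abs_integral_le (h : IsReflectedBrownianMotion P 𝓕 B Y L₀ L₁) (ha : Continuous a) :
    ∃ C, ∀ t : ℝ≥0, |∫ x, a (Y t x) ∂P| ≤ C := by
  obtain ⟨C, hC⟩ := (isCompact_Icc (a := (0 : ℝ)) (b := 1)).exists_bound_of_continuousOn
    ha.continuousOn
  refine ⟨C, fun t => ?_⟩
  rw [← Real.norm_eq_abs]
  refine (norm_integral_le_of_norm_le_const (C := C) ?_).trans_eq ?_
  · filter_upwards [h.confined] with x hx using hC _ (hx t)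
  · rw [probReal_univ, mul_one]

lemma continuous_integral (h : IsReflectedBrownianMotion P 𝓕 B Y L₀ L₁) (ha : Continuous a) :
    Continuous fun r : ℝ => ∫ x, a (Y r.toNNReal x) ∂P := by
  have := (h.continuous_integral_mul ha (Z := fun _ => 1) (K := 1) measurable_const
    (by simp)).comp continuous_real_toNNReal
  simpa [Function.comp_def] using this

/-- Oscillating time averages of `E a (Y)` vanish at rate `1/t`. -/
lemma exists_abs_integral_cos_sin_le (h : IsReflectedBrownianMotion P 𝓕 B Y L₀ L₁)
    (hα : 0 < α) (ha : Continuous a) : ∃ C, ∀ t : ℝ≥0,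
      |∫ r in (0 : ℝ)..t, Real.cos (α * r) * ∫ x, a (Y r.toNNReal x) ∂P| ≤ C ∧
      |∫ r in (0 : ℝ)..t, Real.sin (α * r) * ∫ x, a (Y r.toNNReal x) ∂P| ≤ C := by
  obtain ⟨p, p₁, p₂, q, q₁, q₂, hc⟩ := exists_corrector hα ha
  obtain ⟨C₁, h₁⟩ := h.exists_abs_integral_le hc.neumann_p.continuous
  obtain ⟨C₂, h₂⟩ := h.exists_abs_integral_le hc.neumann_q.continuous
  have bd : ∀ u v w z : ℝ, |u| ≤ 1 → |v| ≤ 1 → |w| ≤ C₁ → |z| ≤ C₂ →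
      |u * w| ≤ C₁ ∧ |v * z| ≤ C₂ := fun u v w z hu hv hw hz => by
    rw [abs_mul, abs_mul]
    constructor <;> nlinarith [abs_nonneg u, abs_nonneg v, abs_nonneg w, abs_nonneg z]
  refine ⟨2 * (C₁ + C₂), fun t => ?_⟩
  have key := h.integral_cos_and_sin ha hc (zero_le (a := t)) (Z := fun _ => 1) (K := 1)
    measurable_const (by simp)
  simp only [one_mul, NNReal.coe_zero] at key
  rw [key.1, key.2]
  have e1 := bd _ _ _ _ (Real.abs_cos_le_one (α * t)) (Real.abs_sin_le_one (α * t)) (h₁ t) (h₂ t)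
  have e2 := bd _ _ _ _ (Real.abs_cos_le_one (α * 0)) (Real.abs_sin_le_one (α * 0)) (h₁ 0) (h₂ 0)
  have e3 := bd _ _ _ _ (Real.abs_sin_le_one (α * t)) (Real.abs_cos_le_one (α * t)) (h₁ t) (h₂ t)
  have e4 := bd _ _ _ _ (Real.abs_sin_le_one (α * 0)) (Real.abs_cos_le_one (α * 0)) (h₁ 0) (h₂ 0)
  simp only [abs_le] at e1 e2 e3 e4 ⊢
  constructor <;> constructor <;> linarith

/-- Time averages of `E a (Y)` converge to the uniform mean at rate `1/t`. -/
lemma exists_abs_integral_sub_mean_le (h : IsReflectedBrownianMotion P 𝓕 B Y L₀ L₁)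
    (ha : Continuous a) : ∃ C, ∀ t : ℝ≥0,
      |(∫ r in (0 : ℝ)..t, ∫ x, a (Y r.toNNReal x) ∂P) - t * ∫ y in (0 : ℝ)..1, a y| ≤ C := by
  obtain ⟨p, p₁, p₂, hp, he⟩ := exists_stationary_corrector ha
  obtain ⟨C₁, h₁⟩ := h.exists_abs_integral_le hp.continuous
  refine ⟨2 * C₁, fun t => ?_⟩
  have key := h.dynkin hp (zero_le (a := t)) (Z := fun _ => 1) (K := 1) measurable_const (by simp)
  simp only [one_mul, NNReal.coe_zero] at key
  have e : (∫ r in (0 : ℝ)..t, ∫ x, a (Y r.toNNReal x) ∂P) - t * ∫ y in (0 : ℝ)..1, a y =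
      ∫ r in (0 : ℝ)..t, ∫ x, p₂ (Y r.toNNReal x) / 2 ∂P := by
    have e1 : ∀ r : ℝ, ∫ x, p₂ (Y r.toNNReal x) / 2 ∂P =
        (∫ x, a (Y r.toNNReal x) ∂P) - ∫ y in (0 : ℝ)..1, a y := fun r => by
      simp only [he]
      rw [integral_sub _ (integrable_const _)]
      · simp
      · obtain ⟨C, hC⟩ := (isCompact_Icc (a := (0 : ℝ)) (b := 1)).exists_bound_of_continuousOn
          ha.continuousOn
        have := h.measurable_Y r.toNNReal
        refine Integrable.of_bound (C := C) (by fun_prop) ?_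
        filter_upwards [h.confined] with x hx using hC _ (hx _)
    simp only [e1]
    rw [intervalIntegral.integral_sub ((h.continuous_integral ha).intervalIntegrable _ _) (by simp)]
    simp
  rw [e, ← key]
  exact (abs_sub _ _).trans (by linarith [h₁ t, h₁ 0])

end IsReflectedBrownianMotion

end

/-! ### The second moment of the mean-free displacement -/

section

variable {Ω : Type*} [mΩ : MeasurableSpace Ω] {P : Measure Ω} [IsProbabilityMeasure P]
  {𝓕 : Filtration ℝ≥0 mΩ} {B Y L₀ L₁ : ℝ≥0 → Ω → ℝ}
  {α : ℝ} {a p p₁ p₂ q q₁ q₂ : ℝ → ℝ}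

lemma integral_swap_of_bound {Φ : ℝ → Ω → ℝ} (hΦ : Measurable (Function.uncurry Φ)) {C : ℝ}
    (hC : ∀ s x, |Φ s x| ≤ C) (b c : ℝ) :
    ∫ s in b..c, ∫ x, Φ s x ∂P = ∫ x, (∫ s in b..c, Φ s x) ∂P := by
  refine intervalIntegral_integral_swap ?_
  have : IsFiniteMeasure ((volume.restrict (uIoc b c) : Measure ℝ)) :=
    ⟨by simp [uIoc]⟩
  exact Integrable.of_bound hΦ.aestronglyMeasurable C (ae_of_all _ fun z => hC z.1 z.2)

/-- The square is written so that each velocity `k s` multiplies only the later displacement, the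
form to which conditioning on the past up to `s` applies. The integrand is the derivative of
`-(∫_s^t k)²`. -/
lemma sq_integral_eq {k : ℝ → ℝ} (hk : Continuous k) (t : ℝ) :
    (∫ s in (0 : ℝ)..t, k s) ^ 2 = 2 * ∫ s in (0 : ℝ)..t, k s * ∫ r in s..t, k r := by
  have d : ∀ s, HasDerivAt (fun s => ∫ r in s..t, k r) (-k s) s := fun s =>
    intervalIntegral.integral_hasDerivAt_left (hk.intervalIntegrable _ _)
      hk.stronglyMeasurable.stronglyMeasurableAtFilter hk.continuousAt
  have c : Continuous fun s => ∫ r in s..t, k r :=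
    continuous_iff_continuousAt.2 fun s => (d s).continuousAt
  have d2 : ∀ s ∈ uIcc 0 t, HasDerivAt (fun s => -(∫ r in s..t, k r) ^ 2)
      (2 * (k s * ∫ r in s..t, k r)) s := fun s _ => by
    refine ((d s).fun_pow 2).neg.congr_deriv ?_
    ring
  have := intervalIntegral.integral_eq_sub_of_hasDerivAt d2
    ((continuous_const.mul (hk.mul c)).intervalIntegrable _ _)
  rw [intervalIntegral.integral_const_mul] at this
  rw [this]
  simp

/-- `y` is a version of `Y`, indexed by `ℝ`, all of whose paths are continuous and confined. -/
structure IsVersion (P : Measure Ω) (Y : ℝ≥0 → Ω → ℝ) (y : ℝ → Ω → ℝ) : Prop where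
  cont : ∀ x, Continuous fun t => y t x
  meas : ∀ t, Measurable (y t)
  mem : ∀ t x, y t x ∈ Icc (0 : ℝ) 1
  ae_eq : ∀ᵐ x ∂P, ∀ t : ℝ, Y t.toNNReal x = y t x

/-- The velocity `cos (α s) a (y)` along the path. -/
noncomputable def vel (α : ℝ) (a : ℝ → ℝ) (y : ℝ → Ω → ℝ) (s : ℝ) (x : Ω) : ℝ :=
  Real.cos (α * s) * a (y s x)

/-- The corrector `cos (α s) p (y) - sin (α s) q (y)` along the path. -/
noncomputable def corr (α : ℝ) (p q : ℝ → ℝ) (y : ℝ → Ω → ℝ) (s : ℝ) (x : Ω) : ℝ :=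
  Real.cos (α * s) * p (y s x) - Real.sin (α * s) * q (y s x)

lemma exists_abs_le_on_unit (ha : Continuous a) :
    ∃ A, 0 ≤ A ∧ ∀ z ∈ Icc (0 : ℝ) 1, |a z| ≤ A := by
  obtain ⟨A, hA⟩ := (isCompact_Icc (a := (0 : ℝ)) (b := 1)).exists_bound_of_continuousOn
    ha.continuousOn
  exact ⟨A, (norm_nonneg _).trans (hA 0 (by simp)), hA⟩

namespace IsVersion

variable {y : ℝ → Ω → ℝ}

lemma measurable_uncurry (hy : IsVersion P Y y) : Measurable (Function.uncurry y) :=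
  measurable_uncurry_of_continuous_of_measurable hy.cont hy.meas

lemma measurable_vel (hy : IsVersion P Y y) (ha : Continuous a) :
    Measurable (Function.uncurry (vel α a y)) :=
  (Real.continuous_cos.measurable.comp (measurable_fst.const_mul α)).mul
    (ha.measurable.comp hy.measurable_uncurry)

lemma measurable_vel_apply (hy : IsVersion P Y y) (ha : Continuous a) (s : ℝ) :
    Measurable (vel α a y s) :=
  (ha.measurable.comp (hy.meas s)).const_mul _

lemma continuous_vel (hy : IsVersion P Y y) (ha : Continuous a) (x : Ω) :
    Continuous fun s => vel α a y s x := by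
  have := hy.cont x
  unfold vel
  fun_prop

lemma abs_vel_le (hy : IsVersion P Y y) {A : ℝ} (hA : ∀ z ∈ Icc (0 : ℝ) 1, |a z| ≤ A)
    (s : ℝ) (x : Ω) : |vel α a y s x| ≤ A := by
  rw [vel, abs_mul]
  calc _ ≤ 1 * A :=
        mul_le_mul (Real.abs_cos_le_one _) (hA _ (hy.mem s x)) (abs_nonneg _) zero_le_one
    _ = A := one_mul _

lemma measurable_corr (hy : IsVersion P Y y) (hp : Continuous p) (hq : Continuous q) (s : ℝ) :
    Measurable (corr α p q y s) :=
  ((hp.measurable.comp (hy.meas s)).const_mul _).sub ((hq.measurable.comp (hy.meas s)).const_mul _)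

lemma continuous_corr (hy : IsVersion P Y y) (hp : Continuous p) (hq : Continuous q) (x : Ω) :
    Continuous fun s => corr α p q y s x := by
  have := hy.cont x
  unfold corr
  fun_prop

lemma abs_corr_le (hy : IsVersion P Y y) {A A' : ℝ} (hA : ∀ z ∈ Icc (0 : ℝ) 1, |p z| ≤ A)
    (hA' : ∀ z ∈ Icc (0 : ℝ) 1, |q z| ≤ A') (s : ℝ) (x : Ω) : |corr α p q y s x| ≤ A + A' := by
  refine (abs_sub _ _).trans (add_le_add ?_ ?_)
  · exact hy.abs_vel_le hA s x
  · rw [abs_mul]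
    calc _ ≤ 1 * A' :=
          mul_le_mul (Real.abs_sin_le_one _) (hA' _ (hy.mem s x)) (abs_nonneg _) zero_le_one
      _ = A' := one_mul _

lemma integrable (hy : IsVersion P Y y) {Z : Ω → ℝ} {K : ℝ} (hZ : Measurable Z)
    (hK : ∀ x, |Z x| ≤ K) (ha : Continuous a) (r : ℝ) :
    Integrable (fun x => Z x * a (y r x)) P := by
  obtain ⟨C, hC0, hC⟩ := exists_abs_le_on_unit ha
  have := hy.meas r
  have := ha.measurable
  refine Integrable.of_bound (C := K * C) (by fun_prop) (ae_of_all _ fun x => ?_)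
  rw [norm_mul]
  exact mul_le_mul (hK x) (hC _ (hy.mem r x)) (norm_nonneg _) ((abs_nonneg _).trans (hK x))

lemma measurable_tail (hy : IsVersion P Y y) (ha : Continuous a) (t : ℝ) :
    Measurable (Function.uncurry fun s x => ∫ r in s..t, vel α a y r x) := by
  have kc := hy.continuous_vel (α := α) ha
  refine measurable_uncurry_of_continuous_of_measurable (fun x => ?_) fun s => ?_
  · refine continuous_iff_continuousAt.2 fun s => ?_
    exact (intervalIntegral.integral_hasDerivAt_left ((kc x).intervalIntegrable _ _)
      (kc x).stronglyMeasurable.stronglyMeasurableAtFilter (kc x).continuousAt).continuousAt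
  · have : StronglyMeasurable (Function.uncurry fun x s => vel α a y s x) :=
      ((hy.measurable_vel ha).comp measurable_swap).stronglyMeasurable
    simp only [intervalIntegral]
    exact (this.integral_prod_right.sub this.integral_prod_right).measurable

lemma abs_tail_le (hy : IsVersion P Y y) {A : ℝ} (hA : ∀ z ∈ Icc (0 : ℝ) 1, |a z| ≤ A)
    (b c : ℝ) (x : Ω) : |∫ s in b..c, vel α a y s x| ≤ A * |c - b| := by
  rw [← Real.norm_eq_abs]
  exact intervalIntegral.norm_integral_le_of_norm_le_const fun s _ => hy.abs_vel_le hA s x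

/-- Correlation of the velocity with the later displacement. -/
lemma integral_vel_mul_tail (h : IsReflectedBrownianMotion P 𝓕 B Y L₀ L₁) (ha : Continuous a)
    (hc : IsCorrector α a p p₁ p₂ q q₁ q₂) (hy : IsVersion P Y y) {s t : ℝ≥0} (hst : s ≤ t) :
    ∫ x, vel α a y s x * (∫ r in (s : ℝ)..t, vel α a y r x) ∂P =
      ∫ x, vel α a y s x * corr α p q y t x ∂P - ∫ x, vel α a y s x * corr α p q y s x ∂P := by
  obtain ⟨A, hA0, hA⟩ := exists_abs_le_on_unit ha
  have hpc := hc.neumann_p.continuous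
  have hqc := hc.neumann_q.continuous
  have kb := hy.abs_vel_le (α := α) hA
  have km := hy.measurable_vel (α := α) ha
  have km' : Measurable (vel α a y s) := hy.measurable_vel_apply ha s
  -- The version `y` need not be adapted, and `Y` is confined only almost surely. Clamping `Y s` to
  -- `[0, 1]` yields a weight that is both `𝓕 s`-measurable and bounded everywhere, and equals the
  -- velocity almost surely.
  let Z : Ω → ℝ := fun x => Real.cos (α * s) * a (max 0 (min 1 (Y s x)))
  have hZ : Measurable[𝓕 s] Z := by
    have h1 : Continuous fun z : ℝ => Real.cos (α * s) * a (max 0 (min 1 z)) := by fun_prop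
    exact h1.measurable.comp (h.adapted_Y s)
  have hZK : ∀ x, |Z x| ≤ A := fun x => by
    rw [abs_mul]
    calc _ ≤ 1 * A := mul_le_mul (Real.abs_cos_le_one _)
          (hA _ ⟨le_max_left _ _, max_le zero_le_one (min_le_left _ _)⟩) (abs_nonneg _) zero_le_one
      _ = A := one_mul _
  have eZ : ∀ᵐ x ∂P, Z x = vel α a y s x := by
    filter_upwards [hy.ae_eq] with x hx
    have e := hx s
    rw [Real.toNNReal_coe] at e
    simp only [Z, vel, e]
    rw [min_eq_right (hy.mem s x).2, max_eq_right (hy.mem s x).1]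
  have tr : ∀ (b : ℝ → ℝ) (r : ℝ),
      ∫ x, Z x * b (Y r.toNNReal x) ∂P = ∫ x, vel α a y s x * b (y r x) ∂P :=
    fun b r => integral_congr_ae (by filter_upwards [hy.ae_eq, eZ] with x h1 h2; rw [h1, h2])
  have tr' : ∀ (b : ℝ → ℝ) (r : ℝ≥0),
      ∫ x, Z x * b (Y r x) ∂P = ∫ x, vel α a y s x * b (y r x) ∂P :=
    fun b r => by have := tr b r; rwa [Real.toNNReal_coe] at this
  have key := (h.integral_cos_and_sin ha hc hst hZ hZK).1
  simp only [tr, tr'] at key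
  have ef : ∀ r : ℝ, ∫ x, vel α a y s x * corr α p q y r x ∂P =
      Real.cos (α * r) * ∫ x, vel α a y s x * p (y r x) ∂P -
        Real.sin (α * r) * ∫ x, vel α a y s x * q (y r x) ∂P := fun r => by
    rw [← integral_const_mul, ← integral_const_mul, ← integral_sub
      ((hy.integrable km' (kb s) hpc r).const_mul _) ((hy.integrable km' (kb s) hqc r).const_mul _)]
    refine integral_congr_ae (ae_of_all _ fun x => ?_)
    simp only [corr]; ring
  rw [ef, ef, ← key]
  have hm2 : Measurable (Function.uncurry fun r x => vel α a y s x * vel α a y r x) :=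
    (km'.comp measurable_snd).mul km
  have := integral_swap_of_bound (P := P) hm2 (C := A * A) (fun r x => by
    rw [abs_mul]; exact mul_le_mul (kb s x) (kb r x) (abs_nonneg _) hA0) s t
  simp only [← intervalIntegral.integral_const_mul]
  rw [← this]
  refine intervalIntegral.integral_congr fun r _ => ?_
  rw [← integral_const_mul]
  refine integral_congr_ae (ae_of_all _ fun x => ?_)
  simp only [vel]; ring

/-- Time averages of velocity times corrector. -/
lemma exists_abs_integral_vel_mul_corr_le (h : IsReflectedBrownianMotion P 𝓕 B Y L₀ L₁)
    (hα : 0 < α) (ha : Continuous a) (hp : Continuous p) (hq : Continuous q)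
    (hy : IsVersion P Y y) : ∃ C, ∀ t : ℝ≥0,
      |2 * (∫ s in (0 : ℝ)..t, ∫ x, vel α a y s x * corr α p q y s x ∂P) -
        t * ∫ y in (0 : ℝ)..1, a y * p y| ≤ C := by
  have hap : Continuous fun z => a z * p z := ha.mul hp
  have haq : Continuous fun z => a z * q z := ha.mul hq
  obtain ⟨C₁, h₁⟩ := h.exists_abs_integral_sub_mean_le hap
  obtain ⟨C₂, h₂⟩ := h.exists_abs_integral_cos_sin_le (α := 2 * α) (by positivity) hap
  obtain ⟨C₃, h₃⟩ := h.exists_abs_integral_cos_sin_le (α := 2 * α) (by positivity) haq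
  have trY : ∀ (b : ℝ → ℝ) (r : ℝ), ∫ x, b (Y r.toNNReal x) ∂P = ∫ x, b (y r x) ∂P :=
    fun b r => integral_congr_ae (by filter_upwards [hy.ae_eq] with x h1; rw [h1])
  have ib : ∀ {b : ℝ → ℝ}, Continuous b → ∀ r : ℝ, Integrable (fun x => b (y r x)) P := by
    intro b hb r
    simpa using hy.integrable (Z := fun _ => 1) (K := 1) measurable_const (by simp) hb r
  -- Double-angle formulas: of the three resulting terms only `a p / 2` has a nonzero time average;
  -- the other two oscillate at frequency `2 α`.
  have kf : ∀ s : ℝ, ∫ x, vel α a y s x * corr α p q y s x ∂P =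
      1 / 2 * ((∫ x, a (Y s.toNNReal x) * p (Y s.toNNReal x) ∂P) +
        Real.cos (2 * α * s) * (∫ x, a (Y s.toNNReal x) * p (Y s.toNNReal x) ∂P) -
        Real.sin (2 * α * s) * ∫ x, a (Y s.toNNReal x) * q (Y s.toNNReal x) ∂P) := by
    intro s
    have i1 : Integrable (fun x => a (y s x) * p (y s x)) P := ib hap s
    have i2 : Integrable (fun x => a (y s x) * q (y s x)) P := ib haq s
    have i12 : Integrable (fun x => a (y s x) * p (y s x) +
      Real.cos (2 * α * s) * (a (y s x) * p (y s x))) P := i1.add (i1.const_mul _)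
    rw [trY (fun z => a z * p z), trY (fun z => a z * q z), ← integral_const_mul,
      ← integral_const_mul, ← integral_add i1 (i1.const_mul _),
      ← integral_sub i12 (i2.const_mul _), ← integral_const_mul]
    refine integral_congr_ae (ae_of_all _ fun x => ?_)
    simp only [vel, corr]
    rw [mul_assoc 2 α s, Real.cos_two_mul, Real.sin_two_mul]
    ring
  refine ⟨C₁ + C₂ + C₃, fun t => ?_⟩
  have c1 : Continuous fun r : ℝ => ∫ x, a (Y r.toNNReal x) * p (Y r.toNNReal x) ∂P :=
    h.continuous_integral hap
  have c2 : Continuous fun r : ℝ => ∫ x, a (Y r.toNNReal x) * q (Y r.toNNReal x) ∂P :=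
    h.continuous_integral haq
  have e : 2 * (∫ s in (0 : ℝ)..t, ∫ x, vel α a y s x * corr α p q y s x ∂P) =
      (∫ s in (0 : ℝ)..t, ∫ x, a (Y s.toNNReal x) * p (Y s.toNNReal x) ∂P) +
      (∫ s in (0 : ℝ)..t, Real.cos (2 * α * s) *
        ∫ x, a (Y s.toNNReal x) * p (Y s.toNNReal x) ∂P) -
      ∫ s in (0 : ℝ)..t, Real.sin (2 * α * s) *
        ∫ x, a (Y s.toNNReal x) * q (Y s.toNNReal x) ∂P := by
    have i1 := c1.intervalIntegrable (μ := volume) 0 t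
    have i2 : IntervalIntegrable (fun s => Real.cos (2 * α * s) *
        ∫ x, a (Y s.toNNReal x) * p (Y s.toNNReal x) ∂P) volume 0 t :=
      (Continuous.mul (by fun_prop) c1).intervalIntegrable _ _
    have i3 : IntervalIntegrable (fun s => Real.sin (2 * α * s) *
        ∫ x, a (Y s.toNNReal x) * q (Y s.toNNReal x) ∂P) volume 0 t :=
      (Continuous.mul (by fun_prop) c2).intervalIntegrable _ _
    rw [← intervalIntegral.integral_add i1 i2, ← intervalIntegral.integral_sub (i1.add i2) i3,
      ← intervalIntegral.integral_const_mul]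
    refine intervalIntegral.integral_congr fun s _ => ?_
    simp only [kf]
    ring
  rw [e]
  have e1 := h₁ t
  have e2 := (h₂ t).1
  have e3 := (h₃ t).2
  simp only [abs_le] at e1 e2 e3 ⊢
  constructor <;> linarith

/-- The second moment of the displacement. -/
lemma integral_displacement_sq (h : IsReflectedBrownianMotion P 𝓕 B Y L₀ L₁)
    (ha : Continuous a) (hc : IsCorrector α a p p₁ p₂ q q₁ q₂) (hy : IsVersion P Y y) (t : ℝ≥0) :
    ∫ x, (∫ s in (0 : ℝ)..t, vel α a y s x) ^ 2 ∂P =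
      2 * (∫ x, (∫ s in (0 : ℝ)..t, vel α a y s x) * corr α p q y t x ∂P) -
      2 * ∫ s in (0 : ℝ)..t, ∫ x, vel α a y s x * corr α p q y s x ∂P := by
  have hpc := hc.neumann_p.continuous
  have hqc := hc.neumann_q.continuous
  obtain ⟨A, hA0, hA⟩ := exists_abs_le_on_unit ha
  obtain ⟨Mp, hMp0, hMp⟩ := exists_abs_le_on_unit hpc
  obtain ⟨Mq, hMq0, hMq⟩ := exists_abs_le_on_unit hqc
  have kb := hy.abs_vel_le (α := α) hA
  have km := hy.measurable_vel (α := α) ha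
  have kc := hy.continuous_vel (α := α) ha
  have km' : ∀ s, Measurable (vel α a y s) := hy.measurable_vel_apply ha
  have fb := hy.abs_corr_le (α := α) hMp hMq
  have fm' : ∀ s, Measurable (corr α p q y s) :=
    hy.measurable_corr hpc hqc
  have fc := hy.continuous_corr (α := α) hpc hqc
  have e1 : ∀ x, (∫ s in (0 : ℝ)..t, vel α a y s x) ^ 2 =
      2 * ∫ s in (0 : ℝ)..t, vel α a y s x * ∫ r in s..t, vel α a y r x := fun x =>
    sq_integral_eq (kc x) t
  simp only [e1]
  rw [integral_const_mul, ← mul_sub]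
  congr 1
  -- Clamping the lower limit to `[0, t]` makes the integrand bounded for all real `s`, as the
  -- exchange of integrals requires, and changes nothing for `s` in `[0, t]`.
  let Φ : ℝ → Ω → ℝ := fun s x =>
    vel α a y s x * ∫ r in (max 0 (min (t : ℝ) s))..t, vel α a y r x
  have Φm : Measurable (Function.uncurry Φ) := by
    refine km.mul ((hy.measurable_tail ha t).comp
      (f := fun z : ℝ × Ω => (max 0 (min (t : ℝ) z.1), z.2)) ?_)
    fun_prop
  have eΦ : ∀ s ∈ uIcc (0 : ℝ) t, ∀ x, Φ s x = vel α a y s x * ∫ r in s..t, vel α a y r x := by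
    intro s hs x
    rw [uIcc_of_le t.coe_nonneg] at hs
    simp only [Φ]
    rw [min_eq_right hs.2, max_eq_right hs.1]
  have Φb : ∀ s x, |Φ s x| ≤ A * (A * t) := fun s x => by
    rw [abs_mul]
    refine mul_le_mul (kb s x) ((hy.abs_tail_le hA _ _ x).trans ?_) (abs_nonneg _) hA0
    refine mul_le_mul_of_nonneg_left ?_ hA0
    have : max 0 (min (t : ℝ) s) ≤ t := max_le t.coe_nonneg (min_le_left _ _)
    rw [abs_of_nonneg (by linarith)]
    linarith [le_max_left 0 (min (t : ℝ) s)]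
  have e2 : ∫ x, (∫ s in (0 : ℝ)..t, vel α a y s x * ∫ r in s..t, vel α a y r x) ∂P =
      ∫ s in (0 : ℝ)..t, ∫ x, Φ s x ∂P := by
    rw [integral_swap_of_bound Φm Φb]
    refine integral_congr_ae (ae_of_all _ fun x => ?_)
    exact intervalIntegral.integral_congr fun s hs => (eΦ s hs x).symm
  have e3 : ∫ x, (∫ s in (0 : ℝ)..t, vel α a y s x) * corr α p q y t x ∂P =
      ∫ s in (0 : ℝ)..t, ∫ x, vel α a y s x * corr α p q y t x ∂P := by
    have hm2 : Measurable (Function.uncurry fun s x => vel α a y s x * corr α p q y t x) :=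
      km.mul ((fm' t).comp measurable_snd)
    rw [integral_swap_of_bound hm2 (C := A * (Mp + Mq)) (fun r x => by
      rw [abs_mul]; exact mul_le_mul (kb r x) (fb t x) (abs_nonneg _) hA0)]
    simp only [intervalIntegral.integral_mul_const]
  have i1 : IntervalIntegrable (fun s => ∫ x, vel α a y s x * corr α p q y t x ∂P) volume 0 t := by
    refine (continuous_of_dominated (bound := fun _ => A * (Mp + Mq)) (fun s =>
      ((km' s).mul (fm' t)).aestronglyMeasurable) (fun s => ae_of_all _ fun x => ?_)
      (integrable_const _) (ae_of_all _ fun x => (kc x).mul continuous_const)).intervalIntegrable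
      _ _
    rw [Pi.mul_apply, norm_mul]
    exact mul_le_mul (kb s x) (fb t x) (abs_nonneg _) hA0
  have i2 : IntervalIntegrable (fun s => ∫ x, vel α a y s x * corr α p q y s x ∂P) volume 0 t := by
    refine (continuous_of_dominated (bound := fun _ => A * (Mp + Mq)) (fun s =>
      ((km' s).mul (fm' s)).aestronglyMeasurable) (fun s => ae_of_all _ fun x => ?_)
      (integrable_const _) (ae_of_all _ fun x => (kc x).mul (fc x))).intervalIntegrable _ _
    rw [Pi.mul_apply, norm_mul]
    exact mul_le_mul (kb s x) (fb s x) (abs_nonneg _) hA0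
  rw [e2, e3, ← intervalIntegral.integral_sub i1 i2]
  refine intervalIntegral.integral_congr fun s hs => ?_
  simp only [eΦ s hs]
  rw [uIcc_of_le t.coe_nonneg] at hs
  lift s to ℝ≥0 using hs.1
  exact hy.integral_vel_mul_tail h ha hc hs.2

end IsVersion

namespace IsReflectedBrownianMotion

/-- Bad paths lie in a measurable null set and are replaced by the constant `0`. Continuity of every
path then gives joint measurability in time and `x`, hence Fubini. -/
lemma exists_isVersion (h : IsReflectedBrownianMotion P 𝓕 B Y L₀ L₁) :
    ∃ y : ℝ → Ω → ℝ, IsVersion P Y y := by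
  have hgood := h.continuous_Y.and h.confined
  obtain ⟨S, hS, hSm, hS0⟩ := exists_measurable_superset_of_null (ae_iff.1 hgood)
  classical
  refine ⟨fun t => S.piecewise (fun _ => 0) (Y t.toNNReal), fun x => ?_, fun t => ?_,
    fun t x => ?_, ?_⟩
  · by_cases hx : x ∈ S
    · simp [hx, continuous_const]
    · have : (Continuous fun t => Y t x) ∧ ∀ t, Y t x ∈ Icc (0 : ℝ) 1 := by
        by_contra hcon; exact hx (hS hcon)
      simpa [hx, Function.comp_def] using this.1.comp continuous_real_toNNReal
  · exact Measurable.piecewise hSm measurable_const (h.measurable_Y _)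
  · by_cases hx : x ∈ S
    · simp [hx]
    · have : (Continuous fun t => Y t x) ∧ ∀ t, Y t x ∈ Icc (0 : ℝ) 1 := by
        by_contra hcon; exact hx (hS hcon)
      show S.piecewise (fun _ => 0) (Y t.toNNReal) x ∈ Icc (0 : ℝ) 1
      rw [piecewise_eq_of_notMem _ _ _ hx]
      exact this.2 _
  · have : ∀ᵐ x ∂P, x ∉ S := by simpa [ae_iff] using hS0
    filter_upwards [this] with x hx t
    simp [hx]

/-- The second moment of the displacement in the flow `cos (α t) a (y)`, up to a remainder of the
order of the mean absolute displacement. -/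
lemma exists_second_moment (h : IsReflectedBrownianMotion P 𝓕 B Y L₀ L₁) (hα : 0 < α)
    (ha : Continuous a) (hc : IsCorrector α a p p₁ p₂ q q₁ q₂) :
    ∃ (X : ℝ≥0 → Ω → ℝ) (A C : ℝ), (∀ t, Measurable (X t)) ∧
      (∀ᵐ x ∂P, ∀ t : ℝ≥0, X t x = ∫ s in (0 : ℝ)..t, Real.cos (α * s) * a (Y s.toNNReal x)) ∧
      (∀ t x, |X t x| ≤ A * t) ∧
      ∀ t : ℝ≥0, |∫ x, X t x ^ 2 ∂P - t * -∫ y in (0 : ℝ)..1, a y * p y| ≤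
        C * (1 + ∫ x, |X t x| ∂P) := by
  have hpc := hc.neumann_p.continuous
  have hqc := hc.neumann_q.continuous
  obtain ⟨y, hy⟩ := h.exists_isVersion
  obtain ⟨A, hA0, hA⟩ := exists_abs_le_on_unit ha
  obtain ⟨Mp, hMp0, hMp⟩ := exists_abs_le_on_unit hpc
  obtain ⟨Mq, hMq0, hMq⟩ := exists_abs_le_on_unit hqc
  obtain ⟨C₁, h₁⟩ := hy.exists_abs_integral_vel_mul_corr_le h hα ha hpc hqc
  have Xm : ∀ t : ℝ≥0, Measurable fun x => ∫ s in (0 : ℝ)..t, vel α a y s x := fun t =>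
    (hy.measurable_tail ha t).comp measurable_prodMk_left
  have Xb : ∀ (t : ℝ≥0) x, |∫ s in (0 : ℝ)..t, vel α a y s x| ≤ A * t := fun t x => by
    refine (hy.abs_tail_le hA 0 t x).trans_eq ?_
    rw [sub_zero, abs_of_nonneg t.coe_nonneg]
  refine ⟨fun t x => ∫ s in (0 : ℝ)..t, vel α a y s x, A, max C₁ (2 * (Mp + Mq)), Xm, ?_, Xb,
    fun t => ?_⟩
  · filter_upwards [hy.ae_eq] with x hx t
    refine intervalIntegral.integral_congr fun s _ => ?_
    simp only [vel, hx]
  have hXf : |∫ x, (∫ s in (0 : ℝ)..t, vel α a y s x) * corr α p q y t x ∂P| ≤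
      (Mp + Mq) * ∫ x, |∫ s in (0 : ℝ)..t, vel α a y s x| ∂P := by
    rw [← integral_const_mul, ← Real.norm_eq_abs]
    refine norm_integral_le_of_norm_le ((Integrable.of_bound (Xm t).aestronglyMeasurable _
      (ae_of_all _ (Xb t))).abs.const_mul _) (ae_of_all _ fun x => ?_)
    rw [norm_mul, mul_comm]
    exact mul_le_mul_of_nonneg_right (hy.abs_corr_le hMp hMq t x) (abs_nonneg _)
  have hX0 : 0 ≤ ∫ x, |∫ s in (0 : ℝ)..t, vel α a y s x| ∂P :=
    integral_nonneg fun x => abs_nonneg _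
  have hfin : |∫ x, (∫ s in (0 : ℝ)..t, vel α a y s x) ^ 2 ∂P -
      t * -∫ y in (0 : ℝ)..1, a y * p y| ≤
      C₁ + 2 * (Mp + Mq) * ∫ x, |∫ s in (0 : ℝ)..t, vel α a y s x| ∂P := by
    have := h₁ t
    rw [hy.integral_displacement_sq h ha hc t]
    simp only [abs_le] at this hXf ⊢
    constructor <;> linarith
  refine hfin.trans ?_
  show _ ≤ max C₁ (2 * (Mp + Mq)) * (1 + ∫ x, |∫ s in (0 : ℝ)..t, vel α a y s x| ∂P)
  rw [mul_add (max _ _), mul_one]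
  exact add_le_add (le_max_left _ _) (mul_le_mul_of_nonneg_right (le_max_right _ _) hX0)

end IsReflectedBrownianMotion

end

/-! ### The dispersivity limit -/

section

variable {Ω : Type*} [mΩ : MeasurableSpace Ω] {P : Measure Ω} [IsProbabilityMeasure P]
  {𝓕 : Filtration ℝ≥0 mΩ} {B Y L₀ L₁ : ℝ≥0 → Ω → ℝ}
  {ω : ℝ} {w p p₁ p₂ q q₁ q₂ : ℝ → ℝ}

namespace IsReflectedBrownianMotion

/-- The displacement is the mean-free displacement plus a bounded oscillation. -/
lemma displacement_ae_eq (h : IsReflectedBrownianMotion P 𝓕 B Y L₀ L₁) (hω : 0 < ω)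
    (hw : Continuous w) (m : ℝ) {u : ℝ → ℝ → ℝ} (hu : ∀ t y, u t y = Real.cos (ω * t) * w y) :
    ∀ᵐ x ∂P, ∀ t : ℝ≥0, displacement u Y t x =
      (∫ s in (0 : ℝ)..t, Real.cos (ω * s) * (w (Y s.toNNReal x) - m)) +
        m * (Real.sin (ω * t) / ω) := by
  filter_upwards [h.continuous_Y] with x hx t
  have hY : Continuous fun s : ℝ => Y s.toNNReal x := hx.comp continuous_real_toNNReal
  have d : ∀ s ∈ uIcc (0 : ℝ) t, HasDerivAt (fun s => m * (Real.sin (ω * s) / ω))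
      (m * Real.cos (ω * s)) s := fun s _ => by
    have : HasDerivAt (fun s => Real.sin (ω * s)) (Real.cos (ω * s) * ω) s := by
      simpa using ((hasDerivAt_id s).const_mul ω).sin
    refine ((this.div_const ω).const_mul m).congr_deriv ?_
    field_simp
  have key := intervalIntegral.integral_eq_sub_of_hasDerivAt d
    (Continuous.intervalIntegrable (by fun_prop) _ _)
  simp only [mul_zero, Real.sin_zero, zero_div, sub_zero] at key
  rw [← key, ← intervalIntegral.integral_add (Continuous.intervalIntegrable (by fun_prop) _ _)
    (Continuous.intervalIntegrable (by fun_prop) _ _), displacement]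
  refine intervalIntegral.integral_congr fun s _ => ?_
  simp only [hu]
  ring

/-- The Taylor dispersivity in terms of the corrector. -/
theorem tendsto_dispersivity (h : IsReflectedBrownianMotion P 𝓕 B Y L₀ L₁) (hω : 0 < ω)
    (hw : Continuous w) {m : ℝ} {u : ℝ → ℝ → ℝ} (hu : ∀ t y, u t y = Real.cos (ω * t) * w y)
    (hc : IsCorrector ω (fun y => w y - m) p p₁ p₂ q q₁ q₂) :
    (∀ t : ℝ≥0, MemLp (displacement u Y t) 2 P) ∧
    Tendsto (fun t : ℝ≥0 => (∫ x, displacement u Y t x ^ 2 ∂P) / (t : ℝ)) atTop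
      (𝓝 (-∫ y in (0 : ℝ)..1, (w y - m) * p y)) := by
  have ha : Continuous fun y => w y - m := hw.sub continuous_const
  obtain ⟨X, A, C, Xm, Xe, Xb, XV⟩ := h.exists_second_moment hω ha hc
  have hdisp : ∀ t : ℝ≥0, displacement u Y t =ᵐ[P] fun x => X t x + m * (Real.sin (ω * t) / ω) := by
    intro t
    filter_upwards [h.displacement_ae_eq hω hw m hu, Xe] with x h1 h2
    rw [h1 t, h2 t]
  have XL : ∀ t : ℝ≥0, MemLp (X t) 2 P := fun t =>
    MemLp.of_bound (Xm t).aestronglyMeasurable _ (ae_of_all _ (Xb t))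
  refine ⟨fun t => (memLp_congr_ae (hdisp t)).2 ((XL t).add (memLp_const _)), ?_⟩
  set D := -∫ y in (0 : ℝ)..1, (w y - m) * p y with hD
  set e : ℝ≥0 → ℝ := fun t => ∫ x, |X t x| ∂P with he
  have e0 : ∀ t, 0 ≤ e t := fun t => integral_nonneg fun x => abs_nonneg _
  have hC0 : 0 ≤ C := by
    have := (abs_nonneg _).trans (XV 0)
    exact nonneg_of_mul_nonneg_left this (by linarith [e0 0])
  have esq : ∀ t, e t ^ 2 ≤ ∫ x, X t x ^ 2 ∂P := fun t => by
    have := variance_nonneg |X t| P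
    rw [variance_eq_sub (XL t).abs] at this
    simpa [sq_abs] using this
  -- From `e² ≤ E X² ≤ t D + C (1 + e)`, absorbing `C e ≤ C² / 2 + e² / 2` on the left gives `e² ≤ K
  -- t` for `t ≥ 1`.
  set K : ℝ := 2 * |D| + 2 * C + C ^ 2 with hK
  have hK0 : 0 ≤ K := by positivity
  have ebd : ∀ t : ℝ≥0, 1 ≤ t → e t ≤ √K * √t := by
    intro t ht
    have ht' : (1 : ℝ) ≤ t := by exact_mod_cast ht
    rw [← Real.sqrt_mul hK0]
    refine Real.le_sqrt_of_sq_le ?_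
    have h1 := (abs_le.1 (XV t)).2
    have h2 : (t : ℝ) * D ≤ t * |D| := mul_le_mul_of_nonneg_left (le_abs_self D) t.coe_nonneg
    have h3 := esq t
    have h4 : C * e t ≤ C ^ 2 / 2 + e t ^ 2 / 2 := by nlinarith [sq_nonneg (C - e t)]
    have h5 : 2 * C + C ^ 2 ≤ (2 * C + C ^ 2) * t := le_mul_of_one_le_right (by positivity) ht'
    have h6 : K * t = 2 * (t * |D|) + (2 * C + C ^ 2) * t := by rw [hK]; ring
    rw [h6]
    linarith
  set b : ℝ := |m| / ω with hb
  have hb0 : 0 ≤ b := by positivity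
  have hκ : ∀ t : ℝ≥0, |m * (Real.sin (ω * t) / ω)| ≤ b := fun t => by
    rw [abs_mul, abs_div, abs_of_pos hω, hb, ← mul_div_assoc]
    gcongr
    exact mul_le_of_le_one_right (abs_nonneg _) (Real.abs_sin_le_one _)
  -- Adding the deterministic oscillation `κ`, with `|κ| ≤ b`, changes the second moment by at most
  -- `2 b e + b²`, which is of lower order than `t`.
  have hsec : ∀ t : ℝ≥0, |∫ x, displacement u Y t x ^ 2 ∂P - t * D| ≤
      (C + 2 * b + b ^ 2) * (1 + e t) := by
    intro t
    set κ := m * (Real.sin (ω * t) / ω) with hκd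
    have i1 : Integrable (X t) P := (XL t).integrable one_le_two
    have i2 : Integrable (fun x => X t x ^ 2) P := (XL t).integrable_sq
    have e1 : ∫ x, displacement u Y t x ^ 2 ∂P =
        ∫ x, X t x ^ 2 ∂P + (2 * κ * (∫ x, X t x ∂P) + κ ^ 2) := by
      have i3 : Integrable (fun x => 2 * κ * X t x + κ ^ 2) P :=
        (i1.const_mul _).add (integrable_const _)
      calc _ = ∫ x, (X t x ^ 2 + (2 * κ * X t x + κ ^ 2)) ∂P := by
            refine integral_congr_ae ?_
            filter_upwards [hdisp t] with x hx
            rw [hx]; ring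
        _ = _ := by
            rw [integral_add i2 i3, integral_add (i1.const_mul _) (integrable_const _),
              integral_const_mul]
            simp
    have h1 : |2 * κ * ∫ x, X t x ∂P| ≤ 2 * b * e t := by
      rw [abs_mul, abs_mul, abs_two]
      exact mul_le_mul (mul_le_mul_of_nonneg_left (hκ t) zero_le_two) abs_integral_le_integral_abs
        (abs_nonneg _) (by positivity)
    have h2 : κ ^ 2 ≤ b ^ 2 := sq_le_sq.2 ((hκ t).trans (le_abs_self _))
    have h3 := XV t
    have h4 := e0 t
    rw [e1]
    have h5 : 0 ≤ b ^ 2 * e t := by positivity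
    have h6 : 0 ≤ κ ^ 2 := sq_nonneg _
    change |_ - t * D| ≤ C * (1 + e t) at h3
    simp only [abs_le] at h1 h3 ⊢
    constructor <;> nlinarith
  rw [tendsto_iff_dist_tendsto_zero]
  have htt : Tendsto (fun t : ℝ≥0 => (t : ℝ)) atTop atTop := NNReal.tendsto_coe_atTop.2 tendsto_id
  have hlim : Tendsto (fun t : ℝ≥0 => (C + 2 * b + b ^ 2) * ((t : ℝ)⁻¹ + √K * (√(t : ℝ))⁻¹)) atTop
      (𝓝 0) := by
    have l1 := tendsto_inv_atTop_zero.comp htt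
    have l2 := tendsto_inv_atTop_zero.comp (Real.tendsto_sqrt_atTop.comp htt)
    simpa using (l1.add (l2.const_mul √K)).const_mul (C + 2 * b + b ^ 2)
  refine squeeze_zero' (Eventually.of_forall fun t => dist_nonneg) ?_ hlim
  filter_upwards [eventually_ge_atTop 1] with t ht
  have ht' : (0 : ℝ) < t := lt_of_lt_of_le one_pos (by exact_mod_cast ht)
  have hst : 0 < √(t : ℝ) := Real.sqrt_pos.2 ht'
  rw [Real.dist_eq, show (∫ x, displacement u Y t x ^ 2 ∂P) / (t : ℝ) - D =
    (∫ x, displacement u Y t x ^ 2 ∂P - t * D) / t by field_simp, abs_div, abs_of_pos ht',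
    div_le_iff₀ ht']
  refine (hsec t).trans ?_
  rw [mul_assoc]
  refine mul_le_mul_of_nonneg_left ?_ (by positivity)
  have : ((t : ℝ)⁻¹ + √K * (√(t : ℝ))⁻¹) * t = 1 + √K * √t := by
    have hss : (√(t : ℝ))⁻¹ * t = √t := by
      rw [inv_mul_eq_div, div_eq_iff hst.ne', Real.mul_self_sqrt ht'.le]
    rw [add_mul, inv_mul_cancel₀ ht'.ne', mul_assoc, hss]
  rw [this]
  linarith [ebd t ht]

end IsReflectedBrownianMotion

end

/-! ### The periodic problem: existence, energy identity, uniqueness of the gradient -/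

section

variable {ω : ℝ} {a p p₁ p₂ q q₁ q₂ : ℝ → ℝ} {u f k : ℝ → ℝ → ℝ}

lemma derivWithin_unit {g : ℝ → ℝ} {g' y : ℝ} (hg : HasDerivAt g g' y) (hy : y ∈ Icc (0 : ℝ) 1) :
    derivWithin g (Icc 0 1) y = g' :=
  hg.hasDerivWithinAt.derivWithin (uniqueDiffOn_Icc zero_lt_one y hy)

/-- The time-dependent corrector. -/
noncomputable def oscillation (ω : ℝ) (p q : ℝ → ℝ) (t y : ℝ) : ℝ :=
  Real.cos (ω * t) * p y - Real.sin (ω * t) * q y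

namespace IsCorrector

lemma dy_oscillation (hc : IsCorrector ω a p p₁ p₂ q q₁ q₂) (t : ℝ) {y : ℝ}
    (hy : y ∈ Icc (0 : ℝ) 1) : dy (oscillation ω p q) t y = oscillation ω p₁ q₁ t y :=
  derivWithin_unit (((hc.neumann_p.deriv₁ y).const_mul _).sub
    ((hc.neumann_q.deriv₁ y).const_mul _)) hy

lemma dy_dy_oscillation (hc : IsCorrector ω a p p₁ p₂ q q₁ q₂) (t : ℝ) {y : ℝ}
    (hy : y ∈ Icc (0 : ℝ) 1) : dy (dy (oscillation ω p q)) t y = oscillation ω p₂ q₂ t y := by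
  rw [dy, derivWithin_congr (fun z hz => hc.dy_oscillation t hz) (hc.dy_oscillation t hy)]
  exact derivWithin_unit (((hc.neumann_p.deriv₂ y).const_mul _).sub
    ((hc.neumann_q.deriv₂ y).const_mul _)) hy

lemma hasDerivAt_oscillation (ω : ℝ) (p q : ℝ → ℝ) (t y : ℝ) :
    HasDerivAt (fun t => oscillation ω p q t y)
      (-(ω * (Real.sin (ω * t) * p y + Real.cos (ω * t) * q y))) t := by
  have h1 : HasDerivAt (fun t => Real.cos (ω * t)) (-Real.sin (ω * t) * ω) t := by
    simpa using ((hasDerivAt_id t).const_mul ω).cos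
  have h2 : HasDerivAt (fun t => Real.sin (ω * t)) (Real.cos (ω * t) * ω) t := by
    simpa using ((hasDerivAt_id t).const_mul ω).sin
  refine ((h1.mul_const (p y)).sub (h2.mul_const (q y))).congr_deriv ?_
  ring

lemma continuous_oscillation (ω : ℝ) (hp : Continuous p) (hq : Continuous q) :
    Continuous (Function.uncurry (oscillation ω p q)) := by
  unfold oscillation Function.uncurry
  fun_prop

/-- A corrector gives a classical solution of the oscillatory problem. -/
theorem isOscillatorySolution (hω : 0 < ω) (hc : IsCorrector ω a p p₁ p₂ q q₁ q₂)
    (hu : ∀ t y, meanFree u t y = Real.cos (ω * t) * a y) :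
    IsOscillatorySolution ω u (oscillation ω p q) where
  continuousOn :=
    (continuous_oscillation ω hc.neumann_p.continuous hc.neumann_q.continuous).continuousOn
  differentiableOn_y t y _ := (((hc.neumann_p.deriv₁ y).const_mul _).sub
    ((hc.neumann_q.deriv₁ y).const_mul _)).differentiableAt.differentiableWithinAt
  continuousOn_dy :=
    (continuous_oscillation ω hc.neumann_p.continuous₁ hc.neumann_q.continuous₁).continuousOn.congr
      fun z hz => hc.dy_oscillation z.1 hz.2
  differentiableOn_dy t := by
    have : DifferentiableOn ℝ (oscillation ω p₁ q₁ t) (Icc 0 1) := fun y _ =>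
      (((hc.neumann_p.deriv₂ y).const_mul _).sub
        ((hc.neumann_q.deriv₂ y).const_mul _)).differentiableAt.differentiableWithinAt
    exact this.congr fun y hy => hc.dy_oscillation t hy
  continuousOn_dyy :=
    (continuous_oscillation ω hc.neumann_p.cont hc.neumann_q.cont).continuousOn.congr
      fun z hz => hc.dy_dy_oscillation z.1 hz.2
  differentiable_t y _ t := (hasDerivAt_oscillation ω p q t y).differentiableAt
  continuousOn_dt := by
    have h1 := hc.neumann_p.continuous
    have h2 := hc.neumann_q.continuous
    have : Function.uncurry (dt (oscillation ω p q)) = fun z : ℝ × ℝ =>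
        -(ω * (Real.sin (ω * z.1) * p z.2 + Real.cos (ω * z.1) * q z.2)) := by
      ext z
      exact (hasDerivAt_oscillation ω p q z.1 z.2).deriv
    rw [this]
    fun_prop
  periodic t y _ := by
    have : ω * (t + 2 * Real.pi / ω) = ω * t + 2 * Real.pi := by field_simp
    simp only [oscillation, this, Real.cos_add_two_pi, Real.sin_add_two_pi]
  wall_zero t := by
    rw [hc.dy_oscillation t (by simp)]
    simp [oscillation, hc.neumann_p.zero, hc.neumann_q.zero]
  wall_one t := by
    rw [hc.dy_oscillation t (by simp)]
    simp [oscillation, hc.neumann_p.one, hc.neumann_q.one]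
  equation t y hy := by
    rw [hc.dy_dy_oscillation t hy, dt, (hasDerivAt_oscillation ω p q t y).deriv, hu, oscillation]
    linear_combination Real.cos (ω * t) * hc.eq_p y - Real.sin (ω * t) * hc.eq_q y

/-- The energy identity for a corrector. -/
lemma integral_sq_add_sq (hc : IsCorrector ω a p p₁ p₂ q q₁ q₂) (ha : Continuous a) :
    ∫ y in (0 : ℝ)..1, (p₁ y ^ 2 + q₁ y ^ 2) = -2 * ∫ y in (0 : ℝ)..1, a y * p y := by
  have c1 := hc.neumann_p.continuous
  have c2 := hc.neumann_q.continuous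
  have c3 := hc.neumann_p.continuous₁
  have c4 := hc.neumann_q.continuous₁
  -- The coupling terms `2 ω q p` and `-2 ω p q` cancel in this combination, and its boundary values
  -- vanish by the Neumann condition.
  have d : ∀ y ∈ uIcc (0 : ℝ) 1, HasDerivAt (fun y => p₁ y * p y + q₁ y * q y)
      ((p₁ y ^ 2 + q₁ y ^ 2) + 2 * (a y * p y)) y := fun y _ => by
    refine (((hc.neumann_p.deriv₂ y).mul (hc.neumann_p.deriv₁ y)).add
      ((hc.neumann_q.deriv₂ y).mul (hc.neumann_q.deriv₁ y))).congr_deriv ?_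
    linear_combination 2 * p y * hc.eq_p y + 2 * q y * hc.eq_q y
  have i1 : IntervalIntegrable (fun y => p₁ y ^ 2 + q₁ y ^ 2) volume 0 1 :=
    Continuous.intervalIntegrable (by fun_prop) _ _
  have i2 : IntervalIntegrable (fun y => 2 * (a y * p y)) volume 0 1 :=
    Continuous.intervalIntegrable (by fun_prop) _ _
  have := intervalIntegral.integral_eq_sub_of_hasDerivAt d (i1.add i2)
  rw [intervalIntegral.integral_add i1 i2, intervalIntegral.integral_const_mul, hc.neumann_p.zero,
    hc.neumann_p.one, hc.neumann_q.zero, hc.neumann_q.one] at this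
  linarith

/-- Averaging over a period removes the harmonics of frequency `2 ω` and leaves half of `∫ (p₁² +
q₁²)`, which the energy identity evaluates. -/
lemma meanSquareGradient_oscillation (hω : 0 < ω) (hc : IsCorrector ω a p p₁ p₂ q q₁ q₂)
    (ha : Continuous a) :
    meanSquareGradient ω (oscillation ω p q) = -∫ y in (0 : ℝ)..1, a y * p y := by
  have c3 := hc.neumann_p.continuous₁
  have c4 := hc.neumann_q.continuous₁
  have inner : ∀ t, ∫ y in (0 : ℝ)..1, dy (oscillation ω p q) t y ^ 2 =
      1 / 2 * (∫ y in (0 : ℝ)..1, (p₁ y ^ 2 + q₁ y ^ 2)) +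
      (Real.cos (2 * ω * t) * (1 / 2 * ∫ y in (0 : ℝ)..1, (p₁ y ^ 2 - q₁ y ^ 2)) -
      Real.sin (2 * ω * t) * ∫ y in (0 : ℝ)..1, p₁ y * q₁ y) := fun t => by
    rw [← intervalIntegral.integral_const_mul, ← intervalIntegral.integral_const_mul (1 / 2),
      ← intervalIntegral.integral_const_mul, ← intervalIntegral.integral_const_mul,
      ← intervalIntegral.integral_sub (Continuous.intervalIntegrable (by fun_prop) _ _)
        (Continuous.intervalIntegrable (by fun_prop) _ _),
      ← intervalIntegral.integral_add (Continuous.intervalIntegrable (by fun_prop) _ _)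
        (Continuous.intervalIntegrable (by fun_prop) _ _)]
    refine intervalIntegral.integral_congr fun y hy => ?_
    rw [uIcc_of_le zero_le_one] at hy
    simp only [hc.dy_oscillation t hy, oscillation]
    rw [mul_assoc 2 ω t, Real.cos_two_mul, Real.sin_two_mul]
    linear_combination (q₁ y ^ 2) * (Real.sin_sq_add_cos_sq (ω * t))
  have hT : 2 * ω * (2 * Real.pi / ω) = 2 * Real.pi + 2 * Real.pi := by field_simp; ring
  have osc : ∀ b c : ℝ, ∫ t in (0 : ℝ)..(2 * Real.pi / ω),
      (Real.cos (2 * ω * t) * b - Real.sin (2 * ω * t) * c) = 0 := fun b c => by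
    have d : ∀ t ∈ uIcc (0 : ℝ) (2 * Real.pi / ω), HasDerivAt
        (fun t => (Real.sin (2 * ω * t) * b + Real.cos (2 * ω * t) * c) / (2 * ω))
        (Real.cos (2 * ω * t) * b - Real.sin (2 * ω * t) * c) t := fun t _ => by
      have h1 : HasDerivAt (fun t => Real.cos (2 * ω * t)) (-Real.sin (2 * ω * t) * (2 * ω)) t := by
        simpa using ((hasDerivAt_id t).const_mul (2 * ω)).cos
      have h2 : HasDerivAt (fun t => Real.sin (2 * ω * t)) (Real.cos (2 * ω * t) * (2 * ω)) t := by
        simpa using ((hasDerivAt_id t).const_mul (2 * ω)).sin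
      refine (((h2.mul_const b).add (h1.mul_const c)).div_const (2 * ω)).congr_deriv ?_
      field_simp
      ring
    rw [intervalIntegral.integral_eq_sub_of_hasDerivAt d
      (Continuous.intervalIntegrable (by fun_prop) _ _), hT]
    simp [Real.sin_add_two_pi, Real.cos_add_two_pi]
  rw [meanSquareGradient]
  simp only [inner]
  rw [intervalIntegral.integral_add (by simp) (Continuous.intervalIntegrable (by fun_prop) _ _),
    osc, hc.integral_sq_add_sq ha, intervalIntegral.integral_const]
  have := Real.pi_pos.ne'
  simp only [sub_zero, smul_eq_mul]
  field_simp
  ring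

end IsCorrector

/-! ### Uniqueness of the gradient -/

namespace IsOscillatorySolution

lemma dy_sub (hf : IsOscillatorySolution ω u f) (hk : IsOscillatorySolution ω u k) (t : ℝ) {y : ℝ}
    (hy : y ∈ Icc (0 : ℝ) 1) : dy (f - k) t y = dy f t y - dy k t y :=
  derivWithin_fun_sub (hf.differentiableOn_y t y hy) (hk.differentiableOn_y t y hy)

lemma dy_dy_sub (hf : IsOscillatorySolution ω u f) (hk : IsOscillatorySolution ω u k) (t : ℝ)
    {y : ℝ} (hy : y ∈ Icc (0 : ℝ) 1) :
    dy (dy (f - k)) t y = dy (dy f) t y - dy (dy k) t y := by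
  rw [dy, derivWithin_congr (fun z hz => hf.dy_sub hk t hz) (hf.dy_sub hk t hy)]
  exact derivWithin_fun_sub (hf.differentiableOn_dy t y hy) (hk.differentiableOn_dy t y hy)

lemma dt_sub (hf : IsOscillatorySolution ω u f) (hk : IsOscillatorySolution ω u k) (t : ℝ) {y : ℝ}
    (hy : y ∈ Icc (0 : ℝ) 1) : dt (f - k) t y = dt f t y - dt k t y :=
  deriv_fun_sub (hf.differentiable_t y hy t) (hk.differentiable_t y hy t)

lemma sub (hf : IsOscillatorySolution ω u f) (hk : IsOscillatorySolution ω u k) :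
    IsOscillatorySolution ω 0 (f - k) where
  continuousOn := hf.continuousOn.sub hk.continuousOn
  differentiableOn_y t := (hf.differentiableOn_y t).sub (hk.differentiableOn_y t)
  continuousOn_dy := (hf.continuousOn_dy.sub hk.continuousOn_dy).congr
    fun z hz => hf.dy_sub hk z.1 hz.2
  differentiableOn_dy t := ((hf.differentiableOn_dy t).sub (hk.differentiableOn_dy t)).congr
    fun y hy => hf.dy_sub hk t hy
  continuousOn_dyy := (hf.continuousOn_dyy.sub hk.continuousOn_dyy).congr
    fun z hz => hf.dy_dy_sub hk z.1 hz.2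
  differentiable_t y hy := (hf.differentiable_t y hy).sub (hk.differentiable_t y hy)
  continuousOn_dt := (hf.continuousOn_dt.sub hk.continuousOn_dt).congr
    fun z hz => hf.dt_sub hk z.1 hz.2
  periodic t y hy := by simp [hf.periodic t y hy, hk.periodic t y hy]
  wall_zero t := by rw [hf.dy_sub hk t (by simp), hf.wall_zero, hk.wall_zero, sub_zero]
  wall_one t := by rw [hf.dy_sub hk t (by simp), hf.wall_one, hk.wall_one, sub_zero]
  equation t y hy := by
    rw [hf.dy_dy_sub hk t hy, hf.dt_sub hk t hy]
    have h1 := hf.equation t y hy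
    have h2 := hk.equation t y hy
    simp only [meanFree, Pi.zero_apply, intervalIntegral.integral_zero, sub_zero]
    linarith

lemma continuousOn_section {F : ℝ → ℝ → ℝ}
    (hF : ContinuousOn (Function.uncurry F) (univ ×ˢ Icc 0 1)) (t : ℝ) :
    ContinuousOn (F t) (Icc 0 1) :=
  hF.comp (f := fun y => (t, y)) (by fun_prop) fun _ hy => ⟨mem_univ _, hy⟩

lemma intervalIntegrable_section {F : ℝ → ℝ → ℝ}
    (hF : ContinuousOn (Function.uncurry F) (univ ×ˢ Icc 0 1)) (t : ℝ) :
    IntervalIntegrable (F t) volume 0 1 :=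
  ContinuousOn.intervalIntegrable (by
    rw [uIcc_of_le zero_le_one]; exact continuousOn_section hF t)

/-- Integration by parts in `y`. -/
lemma integral_mul_dy_dy (hf : IsOscillatorySolution ω u f) (t : ℝ) :
    ∫ y in (0 : ℝ)..1, f t y * dy (dy f) t y = -∫ y in (0 : ℝ)..1, dy f t y ^ 2 := by
  have h1 := intervalIntegral.integral_mul_deriv_eq_deriv_mul_of_hasDeriv_right
    (a := 0) (b := 1) (u := f t) (v := dy f t) (u' := dy f t) (v' := dy (dy f) t)
    (by rw [uIcc_of_le zero_le_one]; exact continuousOn_section hf.continuousOn t)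
    (by rw [uIcc_of_le zero_le_one]; exact continuousOn_section hf.continuousOn_dy t)
    (fun y hy => by
      rw [min_eq_left zero_le_one, max_eq_right zero_le_one] at hy
      have := (hf.differentiableOn_y t y (Ioo_subset_Icc_self hy)).hasDerivWithinAt
      exact (this.hasDerivAt (Icc_mem_nhds hy.1 hy.2)).hasDerivWithinAt)
    (fun y hy => by
      rw [min_eq_left zero_le_one, max_eq_right zero_le_one] at hy
      have := (hf.differentiableOn_dy t y (Ioo_subset_Icc_self hy)).hasDerivWithinAt
      exact (this.hasDerivAt (Icc_mem_nhds hy.1 hy.2)).hasDerivWithinAt)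
    (intervalIntegrable_section hf.continuousOn_dy t)
    (intervalIntegrable_section hf.continuousOn_dyy t)
  rw [h1, hf.wall_zero, hf.wall_one]
  simp [sq]

lemma integral_mul_dt (hf : IsOscillatorySolution ω u f) {y : ℝ}
    (hy : y ∈ Icc (0 : ℝ) 1) : ∫ t in (0 : ℝ)..(2 * Real.pi / ω), f t y * dt f t y = 0 := by
  have d : ∀ t ∈ uIcc (0 : ℝ) (2 * Real.pi / ω), HasDerivAt (fun t => f t y ^ 2 / 2)
      (f t y * dt f t y) t := fun t _ => by
    refine (((hf.differentiable_t y hy t).hasDerivAt.fun_pow 2).div_const 2).congr_deriv ?_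
    rw [dt]; push_cast; ring
  have hper := hf.periodic 0 y hy
  rw [zero_add] at hper
  have c1 : Continuous fun t => f t y :=
    (hf.differentiable_t y hy).continuous
  have c2 : Continuous fun t => dt f t y :=
    hf.continuousOn_dt.comp_continuous (f := fun t : ℝ => (t, y)) (by fun_prop)
      fun t => ⟨mem_univ _, hy⟩
  rw [intervalIntegral.integral_eq_sub_of_hasDerivAt d ((c1.mul c2).intervalIntegrable _ _), hper,
    sub_self]

/-- A solution of the homogeneous problem has no gradient. -/
lemma dy_eq_zero (hω : 0 < ω) (hf : IsOscillatorySolution ω 0 f) :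
    ∀ t ∈ Icc (0 : ℝ) (2 * Real.pi / ω), ∀ y ∈ Icc (0 : ℝ) 1, dy f t y = 0 := by
  have hT : 0 < 2 * Real.pi / ω := by positivity
  set T := 2 * Real.pi / ω
  have heq : ∀ t, ∀ y ∈ Icc (0 : ℝ) 1, dt f t y = -(1 / 2) * dy (dy f) t y := fun t y hy => by
    have := hf.equation t y hy
    simp only [meanFree, Pi.zero_apply, intervalIntegral.integral_zero, sub_zero] at this
    linarith
  -- Multiply the equation by `f` and integrate over the channel. The left side is half the time
  -- derivative of the energy, so it integrates to zero over a period, while the right side is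
  -- nonnegative.
  have hin : ∀ t, ∫ y in (0 : ℝ)..1, f t y * dt f t y =
      1 / 2 * ∫ y in (0 : ℝ)..1, dy f t y ^ 2 := fun t => by
    have : ∫ y in (0 : ℝ)..1, f t y * dt f t y =
        -(1 / 2) * ∫ y in (0 : ℝ)..1, f t y * dy (dy f) t y := by
      rw [← intervalIntegral.integral_const_mul]
      refine intervalIntegral.integral_congr fun y hy => ?_
      rw [uIcc_of_le zero_le_one] at hy
      simp only [heq t y hy]
      ring
    rw [this, hf.integral_mul_dy_dy]
    ring
  have hzero : ∫ t in (0 : ℝ)..T, ∫ y in (0 : ℝ)..1, f t y * dt f t y = 0 := by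
    rw [intervalIntegral_intervalIntegral_swap]
    · rw [intervalIntegral.integral_congr (g := fun _ => 0) fun y hy => ?_]
      · simp
      · rw [uIcc_of_le zero_le_one] at hy
        exact hf.integral_mul_dt hy
    · have : ContinuousOn (Function.uncurry fun t y => f t y * dt f t y) (Icc 0 T ×ˢ Icc 0 1) :=
        (hf.continuousOn.mul hf.continuousOn_dt).mono (prod_mono (subset_univ _) le_rfl)
      refine (this.integrableOn_compact (isCompact_Icc.prod isCompact_Icc)).mono_set ?_
      rw [uIoc_of_le hT.le, uIoc_of_le zero_le_one]
      exact prod_mono Ioc_subset_Icc_self Ioc_subset_Icc_self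
  simp only [hin] at hzero
  rw [intervalIntegral.integral_const_mul] at hzero
  have hzero' : ∫ t in (0 : ℝ)..T, ∫ y in (0 : ℝ)..1, dy f t y ^ 2 = 0 := by linarith
  have cin : Continuous fun t => ∫ y in (0 : ℝ)..1, dy f t y ^ 2 := by
    -- Clamping `y` extends the integrand continuously to the whole plane without changing the
    -- integral over `[0, 1]`.
    have hc : Continuous (Function.uncurry fun t y : ℝ => dy f t (max 0 (min 1 y)) ^ 2) := by
      refine (hf.continuousOn_dy.comp_continuous
        (f := fun z : ℝ × ℝ => (z.1, max 0 (min 1 z.2))) (by fun_prop) fun z =>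
        ⟨mem_univ _, le_max_left _ _, max_le zero_le_one (min_le_left _ _)⟩).pow 2
    have := intervalIntegral.continuous_parametric_intervalIntegral_of_continuous'
      (μ := volume) hc 0 1
    refine this.congr fun t => intervalIntegral.integral_congr fun y hy => ?_
    rw [uIcc_of_le zero_le_one] at hy
    rw [min_eq_right hy.2, max_eq_right hy.1]
  intro t ht y hy
  by_contra hne
  have hpos : 0 < ∫ y in (0 : ℝ)..1, dy f t y ^ 2 :=
    intervalIntegral.integral_pos zero_lt_one ((continuousOn_section hf.continuousOn_dy t).pow 2)
      (fun z _ => sq_nonneg _) ⟨y, hy, by positivity⟩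
  have := intervalIntegral.integral_pos hT cin.continuousOn
    (fun s _ => intervalIntegral.integral_nonneg zero_le_one fun z _ => sq_nonneg _) ⟨t, ht, hpos⟩
  exact this.ne' hzero'

/-- A solution is not unique, since constants may be added, but the difference of two solves the
homogeneous problem and has no gradient. -/
theorem meanSquareGradient_eq (hω : 0 < ω) (hf : IsOscillatorySolution ω u f)
    (hk : IsOscillatorySolution ω u k) : meanSquareGradient ω f = meanSquareGradient ω k := by
  have hT : 0 ≤ 2 * Real.pi / ω := by positivity
  rw [meanSquareGradient, meanSquareGradient]
  congr 1
  refine intervalIntegral.integral_congr fun t ht => intervalIntegral.integral_congr fun y hy => ?_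
  rw [uIcc_of_le hT] at ht
  rw [uIcc_of_le zero_le_one] at hy
  have := (hf.sub hk).dy_eq_zero hω t ht y hy
  rw [hf.dy_sub hk t hy] at this
  simp only [sub_eq_zero.1 this]

end IsOscillatorySolution

end

/-! ### Reduction of `∫ a p` to boundary values on the half channel -/

section

variable {ω ν : ℝ} {A p p₁ p₂ q q₁ q₂ R R₁ J J₁ Q : ℝ → ℝ}

/-- `R + i J` solves `(1/2) P'' + i ω P = A`, and `Q` is a primitive of `A R`. -/
structure IsParticular (ω : ℝ) (A R R₁ J J₁ Q : ℝ → ℝ) : Prop where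
  deriv_R : ∀ z, HasDerivAt R (R₁ z) z
  deriv_R₁ : ∀ z, HasDerivAt R₁ (2 * (A z + ω * J z)) z
  deriv_J : ∀ z, HasDerivAt J (J₁ z) z
  deriv_J₁ : ∀ z, HasDerivAt J₁ (-2 * ω * R z) z
  deriv_Q : ∀ z, HasDerivAt Q (A z * R z) z

lemma integral_unit_eq_half {f : ℝ → ℝ} (hf : Continuous f) :
    ∫ y in (0 : ℝ)..1, f y = ∫ z in (0 : ℝ)..(1 / 2), (f (1 / 2 + z) + f (1 / 2 - z)) := by
  rw [intervalIntegral.integral_add (Continuous.intervalIntegrable (by fun_prop) _ _)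
    (Continuous.intervalIntegrable (by fun_prop) _ _),
    intervalIntegral.integral_comp_add_left (fun z => f z),
    intervalIntegral.integral_comp_sub_left (fun z => f z), add_comm]
  norm_num
  rw [intervalIntegral.integral_add_adjacent_intervals (hf.intervalIntegrable _ _)
    (hf.intervalIntegrable _ _)]

lemma HasDerivAt.ofReal_add_mul_I {f g : ℝ → ℝ} {f' g' z : ℝ} (hf : HasDerivAt f f' z)
    (hg : HasDerivAt g g' z) :
    HasDerivAt (fun z => (f z : ℂ) + g z * Complex.I) ((f' : ℂ) + g' * Complex.I) z :=
  hf.ofReal_comp.add (hg.ofReal_comp.mul_const _)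

/-- Evaluation of the dispersivity functional from a particular solution on the half channel:
the Neumann condition is restored by adding `W = C cosh (κ z) + E sinh (κ z)`. -/
lemma integral_eq_re (hc : IsCorrector ω (fun y => A |y - 1 / 2|) p p₁ p₂ q q₁ q₂)
    (hA : Continuous A) (hP : IsParticular ω A R R₁ J J₁ Q) {κ σ γ P0 P1 P0' P1' : ℂ}
    (hκ : κ ^ 2 = -2 * Complex.I * ω) (hκ0 : κ ≠ 0) (hσ : σ = Complex.sinh (κ * (1 / 2 : ℝ)))
    (hγ : γ = Complex.cosh (κ * (1 / 2 : ℝ))) (hσ0 : σ ≠ 0)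
    (h0 : P0 = R 0 + J 0 * Complex.I) (h1 : P1 = R (1 / 2) + J (1 / 2) * Complex.I)
    (h0' : P0' = R₁ 0 + J₁ 0 * Complex.I) (h1' : P1' = R₁ (1 / 2) + J₁ (1 / 2) * Complex.I) :
    ∫ y in (0 : ℝ)..1, A |y - 1 / 2| * p y = 2 * (Q (1 / 2) - Q 0) +
      (P1' * P1 - P0' * P0 +
        (-(P1' ^ 2 + P0' ^ 2) * γ + 2 * (P1' * P0')) * (1 / (κ * σ))).re := by
  have hp := hc.neumann_p
  have hq := hc.neumann_q
  have hpc := hp.continuous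
  -- `E` and `C` make the slope of `P + W` vanish at `z = 0` and at `z = 1/2` respectively.
  let E : ℂ := -P0' / κ
  let C : ℂ := (-P1' + P0' * γ) / (κ * σ)
  let P : ℝ → ℂ := fun z => R z + J z * Complex.I
  let P' : ℝ → ℂ := fun z => R₁ z + J₁ z * Complex.I
  let W : ℝ → ℂ := fun z => C * Complex.cosh (κ * z) + E * Complex.sinh (κ * z)
  let W' : ℝ → ℂ := fun z => C * (Complex.sinh (κ * z) * κ) + E * (Complex.cosh (κ * z) * κ)
  -- The corrector symmetrised about the centre line: its slope vanishes at `z = 0` by symmetry and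
  -- at `z = 1/2` by the Neumann condition, and it solves the equation with forcing `2 A`.
  let K : ℝ → ℂ := fun z => ((p (1 / 2 + z) + p (1 / 2 - z) : ℝ) : ℂ) +
    ((q (1 / 2 + z) + q (1 / 2 - z) : ℝ) : ℂ) * Complex.I
  let K' : ℝ → ℂ := fun z => ((p₁ (1 / 2 + z) - p₁ (1 / 2 - z) : ℝ) : ℂ) +
    ((q₁ (1 / 2 + z) - q₁ (1 / 2 - z) : ℝ) : ℂ) * Complex.I
  have dP : ∀ z, HasDerivAt P (P' z) z := fun z =>
    HasDerivAt.ofReal_add_mul_I (hP.deriv_R z) (hP.deriv_J z)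
  have dP' : ∀ z, HasDerivAt P' (2 * (A z - Complex.I * ω * P z)) z := fun z => by
    refine (HasDerivAt.ofReal_add_mul_I (hP.deriv_R₁ z) (hP.deriv_J₁ z)).congr_deriv ?_
    simp only [P]
    push_cast
    linear_combination (2 * ω * J z : ℂ) * Complex.I_sq
  have dlin : ∀ y : ℝ, HasDerivAt (fun y : ℝ => κ * (y : ℂ)) κ y := fun y => by
    simpa using (Complex.ofRealCLM.hasDerivAt (x := y)).const_mul κ
  have dch : ∀ y : ℝ, HasDerivAt (fun y : ℝ => Complex.cosh (κ * y)) (Complex.sinh (κ * y) * κ) y :=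
    fun y => (Complex.hasDerivAt_cosh _).comp y (dlin y)
  have dsh : ∀ y : ℝ, HasDerivAt (fun y : ℝ => Complex.sinh (κ * y)) (Complex.cosh (κ * y) * κ) y :=
    fun y => (Complex.hasDerivAt_sinh _).comp y (dlin y)
  have dW : ∀ z, HasDerivAt W (W' z) z := fun z => ((dch z).const_mul C).add ((dsh z).const_mul E)
  have dW' : ∀ z, HasDerivAt W' (-2 * Complex.I * ω * W z) z := fun z => by
    refine ((((dsh z).mul_const κ).const_mul C).add
      (((dch z).mul_const κ).const_mul E)).congr_deriv ?_
    rw [← hκ]; simp only [W]; ring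
  have shift : ∀ {f f' : ℝ → ℝ}, (∀ y, HasDerivAt f (f' y) y) → ∀ z,
      HasDerivAt (fun z => f (1 / 2 + z)) (f' (1 / 2 + z)) z ∧
      HasDerivAt (fun z => f (1 / 2 - z)) (-f' (1 / 2 - z)) z := fun h z =>
    ⟨(h (1 / 2 + z)).comp_const_add _ _, (h (1 / 2 - z)).comp_const_sub _ _⟩
  have dK : ∀ z, HasDerivAt K (K' z) z := fun z => by
    refine (HasDerivAt.ofReal_add_mul_I ((shift hp.deriv₁ z).1.add (shift hp.deriv₁ z).2)
      ((shift hq.deriv₁ z).1.add (shift hq.deriv₁ z).2)).congr_deriv ?_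
    simp only [K', ← sub_eq_add_neg]
  have dK' : ∀ z ∈ uIcc (0 : ℝ) (1 / 2),
      HasDerivAt K' (4 * A z - 2 * Complex.I * ω * K z) z := fun z hz => by
    rw [uIcc_of_le (by norm_num)] at hz
    refine (HasDerivAt.ofReal_add_mul_I ((shift hp.deriv₂ z).1.sub (shift hp.deriv₂ z).2)
      ((shift hq.deriv₂ z).1.sub (shift hq.deriv₂ z).2)).congr_deriv ?_
    have e1 := hc.eq_p (1 / 2 + z)
    have e2 := hc.eq_p (1 / 2 - z)
    have e3 := hc.eq_q (1 / 2 + z)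
    have e4 := hc.eq_q (1 / 2 - z)
    simp only [add_sub_cancel_left, sub_sub_cancel_left, abs_neg, abs_of_nonneg hz.1] at e1 e2
    have f1 : p₂ (1 / 2 + z) - -p₂ (1 / 2 - z) =
        4 * A z + 2 * ω * (q (1 / 2 + z) + q (1 / 2 - z)) := by linarith
    have f2 : q₂ (1 / 2 + z) - -q₂ (1 / 2 - z) =
        -(2 * ω * (p (1 / 2 + z) + p (1 / 2 - z))) := by linarith
    rw [f1, f2]
    simp only [K]
    push_cast
    linear_combination (2 * ω * (q (1 / 2 + z) + q (1 / 2 - z)) : ℂ) * Complex.I_sq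
  -- Green's identity. The first Wronskian has derivative `A K - 2 A (P + W)` and vanishes at both
  -- ends, where all slopes in it are zero; the second has derivative `2 A W`. Their sum is a
  -- primitive of `A K - 2 A P`, and `2 Q` restores the real part of `2 A P`. No identification of
  -- `K` with `2 (P + W)` is needed.
  let Θ : ℝ → ℂ := fun z => 1 / 2 * ((P' z + W' z) * K z - (P z + W z) * K' z) +
    (P' z * W z - P z * W' z)
  have dΘ : ∀ z ∈ uIcc (0 : ℝ) (1 / 2), HasDerivAt Θ (A z * K z - 2 * A z * P z) z :=
    fun z hz => by
    refine ((((((dP' z).add (dW' z)).mul (dK z)).sub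
      (((dP z).add (dW z)).mul (dK' z hz))).const_mul (1 / 2)).add
      (((dP' z).mul (dW z)).sub ((dP z).mul (dW' z)))).congr_deriv ?_
    simp only [Pi.add_apply]
    ring
  have dtot : ∀ z ∈ uIcc (0 : ℝ) (1 / 2), HasDerivAt (fun z => (Θ z).re + 2 * Q z)
      (A |1 / 2 + z - 1 / 2| * p (1 / 2 + z) + A |1 / 2 - z - 1 / 2| * p (1 / 2 - z)) z :=
    fun z hz => by
    refine ((Complex.reCLM.hasFDerivAt.comp_hasDerivAt z (dΘ z hz)).add
      ((hP.deriv_Q z).const_mul 2)).congr_deriv ?_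
    rw [uIcc_of_le (by norm_num)] at hz
    simp only [add_sub_cancel_left, sub_sub_cancel_left, abs_neg, abs_of_nonneg hz.1]
    simp [K, P]
    ring
  have hcont : Continuous fun y => A |y - 1 / 2| * p y := by fun_prop
  rw [integral_unit_eq_half hcont, intervalIntegral.integral_eq_sub_of_hasDerivAt dtot
    (Continuous.intervalIntegrable (by fun_prop) _ _)]
  have hK0 : K' 0 = 0 := by simp [K']
  have hK1 : K' (1 / 2) = 0 := by
    simp only [K']
    norm_num [hp.zero, hp.one, hq.zero, hq.one]
  have hP0 : P 0 = P0 := h0.symm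
  have hP1 : P (1 / 2) = P1 := h1.symm
  have hP0' : P' 0 = P0' := h0'.symm
  have hP1' : P' (1 / 2) = P1' := h1'.symm
  have hW0' : W' 0 = -P0' := by
    simp only [W', Complex.ofReal_zero, mul_zero, Complex.sinh_zero, Complex.cosh_zero, zero_mul, E]
    field_simp
    ring
  have hγσ : γ ^ 2 - σ ^ 2 = 1 := by rw [hγ, hσ]; exact Complex.cosh_sq_sub_sinh_sq _
  have hW1' : W' (1 / 2) = -P1' := by
    simp only [W', ← hσ, ← hγ, C, E]
    field_simp
    ring
  have hW0 : W 0 = (-P1' + P0' * γ) / (κ * σ) := by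
    simp [W, C]
  have hW1 : W (1 / 2) = (-P1' * γ + P0') / (κ * σ) := by
    simp only [W, ← hσ, ← hγ, C, E]
    field_simp
    linear_combination P0' * hγσ
  have hfin : Θ (1 / 2) - Θ 0 = P1' * P1 - P0' * P0 +
        (-(P1' ^ 2 + P0' ^ 2) * γ + 2 * (P1' * P0')) * (1 / (κ * σ)) := by
    simp only [Θ]
    rw [hK0, hK1, hP0, hP1, hP0', hP1', hW0', hW1', hW0, hW1]
    field_simp
    ring
  rw [← hfin, Complex.sub_re]
  ring

/-- Real form of `integral_eq_re`. -/
lemma integral_eq (hν : 0 < ν) (hω : ω = ν ^ 2)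
    (hc : IsCorrector ω (fun y => A |y - 1 / 2|) p p₁ p₂ q q₁ q₂) (hA : Continuous A)
    (hP : IsParticular ω A R R₁ J J₁ Q) :
    ∫ y in (0 : ℝ)..1, A |y - 1 / 2| * p y = 2 * (Q (1 / 2) - Q 0) +
      (R₁ (1 / 2) * R (1 / 2) - J₁ (1 / 2) * J (1 / 2) - (R₁ 0 * R 0 - J₁ 0 * J 0)) +
      (-(R₁ (1 / 2) ^ 2 - J₁ (1 / 2) ^ 2 + R₁ 0 ^ 2 - J₁ 0 ^ 2) * (Real.sinh ν - Real.sin ν) / 2 +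
        (R₁ (1 / 2) * J₁ (1 / 2) + R₁ 0 * J₁ 0) * (Real.sinh ν + Real.sin ν) +
        2 * (R₁ (1 / 2) * R₁ 0 - J₁ (1 / 2) * J₁ 0) *
          (Real.sinh (ν / 2) * Real.cos (ν / 2) - Real.cosh (ν / 2) * Real.sin (ν / 2)) -
        2 * (R₁ (1 / 2) * J₁ 0 + J₁ (1 / 2) * R₁ 0) *
          (Real.sinh (ν / 2) * Real.cos (ν / 2) + Real.cosh (ν / 2) * Real.sin (ν / 2))) /
        (ν * (Real.cosh ν - Real.cos ν)) := by
  set κ : ℂ := (1 - Complex.I) * ν with hκd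
  have hκ : κ ^ 2 = -2 * Complex.I * ω := by
    rw [hκd, hω]; push_cast
    linear_combination (ν ^ 2 : ℂ) * Complex.I_sq
  have hν' : (ν : ℂ) ≠ 0 := by exact_mod_cast hν.ne'
  have hκ0 : κ ≠ 0 := by
    refine mul_ne_zero (fun h => ?_) hν'
    simpa using congrArg Complex.re h
  have hhalf : κ * (1 / 2 : ℝ) = (1 - Complex.I) * (ν / 2 : ℝ) := by
    rw [hκd]; push_cast; ring
  have hσ0 : Complex.sinh (κ * (1 / 2 : ℝ)) ≠ 0 := by
    rw [hhalf]; exact sinh_one_sub_I_mul_ne_zero (by positivity)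
  rw [integral_eq_re hc hA hP hκ hκ0 rfl rfl hσ0 rfl rfl rfl rfl, add_assoc]
  congr 1
  rw [hhalf, sinh_one_sub_I_mul] at hσ0
  rw [hhalf, sinh_one_sub_I_mul, cosh_one_sub_I_mul]
  set S := Real.sinh (ν / 2)
  set C := Real.cosh (ν / 2)
  set s := Real.sin (ν / 2)
  set c := Real.cos (ν / 2)
  have hsc : s ^ 2 + c ^ 2 = 1 := Real.sin_sq_add_cos_sq _
  have hSC : C ^ 2 - S ^ 2 = 1 := Real.cosh_sq_sub_sinh_sq _
  have d1 : Real.sinh ν = 2 * (S * C) := by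
    rw [show ν = 2 * (ν / 2) by ring, Real.sinh_two_mul]; ring
  have d2 : Real.sin ν = 2 * (s * c) := by
    rw [show ν = 2 * (ν / 2) by ring, Real.sin_two_mul]; ring
  have d3 : Real.cosh ν - Real.cos ν = 2 * (S ^ 2 + s ^ 2) := by
    rw [show ν = 2 * (ν / 2) by ring, Real.cosh_two_mul, Real.cos_two_mul]
    linear_combination hSC - 2 * hsc
  have hS : 0 < S := Real.sinh_pos_iff.2 (by positivity)
  have hN : 0 < S ^ 2 + s ^ 2 := by positivity
  have hN' : ((S ^ 2 + s ^ 2 : ℝ) : ℂ) ≠ 0 := by exact_mod_cast hN.ne'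
  have hsc' : (s : ℂ) ^ 2 + (c : ℂ) ^ 2 = 1 := by exact_mod_cast hsc
  have hSC' : (C : ℂ) ^ 2 - (S : ℂ) ^ 2 = 1 := by exact_mod_cast hSC
  -- Multiplication by the conjugate; `(S c)² + (C s)² = S² + s²`, which is half of `cosh ν - cos
  -- ν`.
  have hinv : 1 / (κ * (((S * c : ℝ) : ℂ) - ((C * s : ℝ) : ℂ) * Complex.I)) =
      ((1 / (2 * ν * (S ^ 2 + s ^ 2)) : ℝ) : ℂ) *
        (((S * c - C * s : ℝ) : ℂ) + ((S * c + C * s : ℝ) : ℂ) * Complex.I) := by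
    rw [div_eq_iff (mul_ne_zero hκ0 hσ0), hκd]
    have hN2 : (S : ℂ) ^ 2 + (s : ℂ) ^ 2 ≠ 0 := by exact_mod_cast hN'
    push_cast
    field_simp
    have e : ((S : ℂ) * c - C * s + (S * c + C * s) * Complex.I) * (1 - Complex.I) *
        (S * c - C * s * Complex.I) = 2 * (S ^ 2 + s ^ 2) := by
      linear_combination 2 * (S : ℂ) ^ 2 * hsc' + 2 * (s : ℂ) ^ 2 * hSC' +
        (-2 * (C * s : ℂ) ^ 2 - (S * c + C * s) * (S * c - C * s * Complex.I)) * Complex.I_sq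
    linear_combination -e
  rw [hinv, d1, d2, d3]
  simp only [Complex.add_re, Complex.sub_re, Complex.mul_re, Complex.mul_im, Complex.add_im,
    Complex.sub_im, Complex.neg_re, Complex.neg_im, Complex.ofReal_re, Complex.ofReal_im,
    Complex.I_re, Complex.I_im, pow_two, Complex.re_ofNat, Complex.im_ofNat]
  field_simp
  linear_combination (2 * (R₁ (1 / 2) * J₁ (1 / 2) + R₁ 0 * J₁ 0) -
    (R₁ (1 / 2) ^ 2 - J₁ (1 / 2) ^ 2 + R₁ 0 ^ 2 - J₁ 0 ^ 2)) * S * C * hsc +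
    (2 * (R₁ (1 / 2) * J₁ (1 / 2) + R₁ 0 * J₁ 0) +
    (R₁ (1 / 2) ^ 2 - J₁ (1 / 2) ^ 2 + R₁ 0 ^ 2 - J₁ 0 ^ 2)) * s * c * hSC

end

/-! ### Polynomial particular solutions and the closed forms -/

section

variable {ω ν : ℝ} {p p₁ p₂ q q₁ q₂ : ℝ → ℝ}

lemma cosh_sub_cos_pos (hν : 0 < ν) : 0 < Real.cosh ν - Real.cos ν :=
  sub_pos.2 ((Real.cos_le_one ν).trans_lt (Real.one_lt_cosh.2 hν.ne'))

/-- Here and for the higher powers, `R + i J` is the Neumann series `∑ (-1)^k (2 i ω)^(-k) A^(2k) /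
(i ω)` in the derivatives `A^(2k)` of order `2 k`, finite because `A` is a polynomial. Even `k`
contribute to `J`, odd `k` to `R`. -/
lemma isParticular_one (hω : 0 < ω) :
    IsParticular ω (fun z => (1 / 2) ^ 1 / (1 + 1) - z ^ 1)
      (fun _ => 0) (fun _ => 0) (fun z => (z - 1 / 4) / ω)
      (fun _ => 1 / ω) (fun _ => 0) := by
  constructor <;> intro z
  all_goals
    refine HasDerivAt.congr_deriv (DifferentiableAt.hasDerivAt (by fun_prop)) ?_
    simp (disch := fun_prop) [deriv_fun_sub]
    try field_simp
    try ring

lemma integral_mul_corrector_one (hν : 0 < ν)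
    (hc : IsCorrector (ν ^ 2) (fun y => (1 / 2) ^ 1 / (1 + 1) - |y - 1 / 2| ^ 1)
      p p₁ p₂ q q₁ q₂) :
    ∫ y in (0 : ℝ)..1, ((1 / 2) ^ 1 / (1 + 1) - |y - 1 / 2| ^ 1) * p y =
      -closedForm 1 ν := by
  have hd := (cosh_sub_cos_pos (half_pos hν)).ne'
  have hs : Real.cosh (ν / 2) + Real.cos (ν / 2) ≠ 0 := by
    refine ne_of_gt ?_
    have h₁ := Real.one_lt_cosh.2 (half_pos hν).ne'
    have h₂ := Real.neg_one_le_cos (ν / 2)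
    linarith
  have d1 : Real.sinh ν = 2 * Real.sinh (ν / 2) * Real.cosh (ν / 2) := by
    rw [← Real.sinh_two_mul, mul_div_cancel₀ ν two_ne_zero]
  have d2 : Real.sin ν = 2 * Real.sin (ν / 2) * Real.cos (ν / 2) := by
    rw [← Real.sin_two_mul, mul_div_cancel₀ ν two_ne_zero]
  -- The closed form for `n = 1` is in half angles: the first factor cancels and only `cosh (ν / 2)
  -- + cos (ν / 2)` remains in the denominator.
  have d3 : Real.cosh ν - Real.cos ν = 2 * ((Real.cosh (ν / 2) - Real.cos (ν / 2)) *
      (Real.cosh (ν / 2) + Real.cos (ν / 2))) := by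
    have h₁ := Real.cosh_two_mul (ν / 2)
    have h₂ := Real.cos_two_mul (ν / 2)
    rw [mul_div_cancel₀ ν two_ne_zero] at h₁ h₂
    linear_combination h₁ - h₂ - Real.cosh_sq_sub_sinh_sq (ν / 2)
  rw [integral_eq hν rfl hc (by fun_prop) (isParticular_one (by positivity)), closedForm,
    d1, d2, d3, add_comm (Real.cos (ν / 2))]
  field_simp
  ring

lemma isParticular_two (hω : 0 < ω) :
    IsParticular ω (fun z => (1 / 2) ^ 2 / (2 + 1) - z ^ 2)
      (fun _ => -1 / ω ^ 2) (fun _ => 0) (fun z => (z ^ 2 - 1 / 12) / ω)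
      (fun z => 2 * z / ω) (fun z => (z ^ 3 / 3 - z / 12) / ω ^ 2) := by
  constructor <;> intro z
  all_goals
    refine HasDerivAt.congr_deriv (DifferentiableAt.hasDerivAt (by fun_prop)) ?_
    simp (disch := fun_prop) [deriv_fun_sub]
    try field_simp
    try ring

lemma integral_mul_corrector_two (hν : 0 < ν)
    (hc : IsCorrector (ν ^ 2) (fun y => (1 / 2) ^ 2 / (2 + 1) - |y - 1 / 2| ^ 2)
      p p₁ p₂ q q₁ q₂) :
    ∫ y in (0 : ℝ)..1, ((1 / 2) ^ 2 / (2 + 1) - |y - 1 / 2| ^ 2) * p y =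
      -closedForm 2 ν := by
  have hd := (cosh_sub_cos_pos hν).ne'
  have hd' : Real.cos ν - Real.cosh ν ≠ 0 := fun h => hd (by linarith)
  rw [integral_eq hν rfl hc (by fun_prop) (isParticular_two (by positivity)), closedForm]
  rw [← neg_sub (Real.cosh ν)]
  field_simp
  ring

lemma isParticular_three (hω : 0 < ω) :
    IsParticular ω (fun z => (1 / 2) ^ 3 / (3 + 1) - z ^ 3)
      (fun z => -3 * z / ω ^ 2) (fun _ => -3 / ω ^ 2) (fun z => (z ^ 3 - 1 / 32) / ω)
      (fun z => 3 * z ^ 2 / ω) (fun z => (3 * z ^ 5 / 5 - 3 * z ^ 2 / 64) / ω ^ 2) := by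
  constructor <;> intro z
  all_goals
    refine HasDerivAt.congr_deriv (DifferentiableAt.hasDerivAt (by fun_prop)) ?_
    simp (disch := fun_prop) [deriv_fun_sub]
    try field_simp
    try ring

lemma integral_mul_corrector_three (hν : 0 < ν)
    (hc : IsCorrector (ν ^ 2) (fun y => (1 / 2) ^ 3 / (3 + 1) - |y - 1 / 2| ^ 3)
      p p₁ p₂ q q₁ q₂) :
    ∫ y in (0 : ℝ)..1, ((1 / 2) ^ 3 / (3 + 1) - |y - 1 / 2| ^ 3) * p y =
      -closedForm 3 ν := by
  have hd := (cosh_sub_cos_pos hν).ne'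
  have hd' : Real.cos ν - Real.cosh ν ≠ 0 := fun h => hd (by linarith)
  rw [integral_eq hν rfl hc (by fun_prop) (isParticular_three (by positivity)), closedForm]
  rw [← neg_sub (Real.cosh ν)]
  field_simp
  ring

lemma isParticular_four (hω : 0 < ω) :
    IsParticular ω (fun z => (1 / 2) ^ 4 / (4 + 1) - z ^ 4)
      (fun z => -6 * z ^ 2 / ω ^ 2)
      (fun z => -12 * z / ω ^ 2)
      (fun z => (z ^ 4 - 1 / 80) / ω - 6 / ω ^ 3)
      (fun z => 4 * z ^ 3 / ω) (fun z => (6 * z ^ 7 / 7 - z ^ 3 / 40) / ω ^ 2) := by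
  constructor <;> intro z
  all_goals
    refine HasDerivAt.congr_deriv (DifferentiableAt.hasDerivAt (by fun_prop)) ?_
    simp (disch := fun_prop) [deriv_fun_sub]
    try field_simp
    try ring

lemma integral_mul_corrector_four (hν : 0 < ν)
    (hc : IsCorrector (ν ^ 2) (fun y => (1 / 2) ^ 4 / (4 + 1) - |y - 1 / 2| ^ 4)
      p p₁ p₂ q q₁ q₂) :
    ∫ y in (0 : ℝ)..1, ((1 / 2) ^ 4 / (4 + 1) - |y - 1 / 2| ^ 4) * p y =
      -closedForm 4 ν := by
  have hd := (cosh_sub_cos_pos hν).ne'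
  have hd' : Real.cos ν - Real.cosh ν ≠ 0 := fun h => hd (by linarith)
  rw [integral_eq hν rfl hc (by fun_prop) (isParticular_four (by positivity)), closedForm]
  rw [← neg_sub (Real.cosh ν)]
  field_simp
  ring

lemma isParticular_five (hω : 0 < ω) :
    IsParticular ω (fun z => (1 / 2) ^ 5 / (5 + 1) - z ^ 5)
      (fun z => -10 * z ^ 3 / ω ^ 2)
      (fun z => -30 * z ^ 2 / ω ^ 2)
      (fun z => (z ^ 5 - 1 / 192) / ω - 30 * z / ω ^ 3)
      (fun z => 5 * z ^ 4 / ω - 30 / ω ^ 3)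
      (fun z => (10 * z ^ 9 / 9 - 5 * z ^ 4 / 384) / ω ^ 2) := by
  constructor <;> intro z
  all_goals
    refine HasDerivAt.congr_deriv (DifferentiableAt.hasDerivAt (by fun_prop)) ?_
    simp (disch := fun_prop) [deriv_fun_sub]
    try field_simp
    try ring

lemma integral_mul_corrector_five (hν : 0 < ν)
    (hc : IsCorrector (ν ^ 2) (fun y => (1 / 2) ^ 5 / (5 + 1) - |y - 1 / 2| ^ 5)
      p p₁ p₂ q q₁ q₂) :
    ∫ y in (0 : ℝ)..1, ((1 / 2) ^ 5 / (5 + 1) - |y - 1 / 2| ^ 5) * p y =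
      -closedForm 5 ν := by
  have hd := (cosh_sub_cos_pos hν).ne'
  have hd' : Real.cos ν - Real.cosh ν ≠ 0 := fun h => hd (by linarith)
  rw [integral_eq hν rfl hc (by fun_prop) (isParticular_five (by positivity)), closedForm]
  rw [← neg_sub (Real.cosh ν)]
  field_simp
  ring

lemma isParticular_six (hω : 0 < ω) :
    IsParticular ω (fun z => (1 / 2) ^ 6 / (6 + 1) - z ^ 6)
      (fun z => -15 * z ^ 4 / ω ^ 2 + 90 / ω ^ 4)
      (fun z => -60 * z ^ 3 / ω ^ 2)
      (fun z => (z ^ 6 - 1 / 448) / ω - 90 * z ^ 2 / ω ^ 3)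
      (fun z => 6 * z ^ 5 / ω - 180 * z / ω ^ 3)
      (fun z => (15 * z ^ 11 / 11 - 3 * z ^ 5 / 448) / ω ^ 2 +
        (90 / 448 * z - 90 / 7 * z ^ 7) / ω ^ 4) := by
  constructor <;> intro z
  all_goals
    refine HasDerivAt.congr_deriv (DifferentiableAt.hasDerivAt (by fun_prop)) ?_
    simp (disch := fun_prop) [deriv_fun_add, deriv_fun_sub]
    try field_simp
    try ring

lemma integral_mul_corrector_six (hν : 0 < ν)
    (hc : IsCorrector (ν ^ 2) (fun y => (1 / 2) ^ 6 / (6 + 1) - |y - 1 / 2| ^ 6)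
      p p₁ p₂ q q₁ q₂) :
    ∫ y in (0 : ℝ)..1, ((1 / 2) ^ 6 / (6 + 1) - |y - 1 / 2| ^ 6) * p y =
      -closedForm 6 ν := by
  have hd := (cosh_sub_cos_pos hν).ne'
  have hd' : Real.cos ν - Real.cosh ν ≠ 0 := fun h => hd (by linarith)
  rw [integral_eq hν rfl hc (by fun_prop) (isParticular_six (by positivity)), closedForm]
  rw [← neg_sub (Real.cosh ν)]
  field_simp
  ring

lemma integral_mul_corrector {n : ℕ} (hn₁ : 1 ≤ n) (hn₆ : n ≤ 6) (hν : 0 < ν)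
    (hc : IsCorrector (ν ^ 2) (fun y => (1 / 2) ^ n / ((n : ℝ) + 1) - |y - 1 / 2| ^ n)
      p p₁ p₂ q q₁ q₂) :
    ∫ y in (0 : ℝ)..1, ((1 / 2) ^ n / ((n : ℝ) + 1) - |y - 1 / 2| ^ n) * p y =
      -closedForm n ν := by
  interval_cases n <;> simp only [Nat.cast_ofNat, Nat.cast_one] at hc ⊢
  exacts [integral_mul_corrector_one hν hc, integral_mul_corrector_two hν hc,
    integral_mul_corrector_three hν hc, integral_mul_corrector_four hν hc,
    integral_mul_corrector_five hν hc, integral_mul_corrector_six hν hc]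

lemma integral_abs_sub_half_pow (n : ℕ) :
    ∫ y in (0 : ℝ)..1, |y - 1 / 2| ^ n = (1 / 2) ^ n / ((n : ℝ) + 1) := by
  rw [integral_unit_eq_half (by fun_prop)]
  calc ∫ z in (0 : ℝ)..(1 / 2), (|1 / 2 + z - 1 / 2| ^ n + |1 / 2 - z - 1 / 2| ^ n)
      = ∫ z in (0 : ℝ)..(1 / 2), 2 * z ^ n := by
        refine intervalIntegral.integral_congr fun z hz => ?_
        rw [uIcc_of_le (by norm_num)] at hz
        simp only [add_sub_cancel_left, sub_sub_cancel_left, abs_neg, abs_of_nonneg hz.1, two_mul]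
    _ = (1 / 2) ^ n / ((n : ℝ) + 1) := by
        rw [intervalIntegral.integral_const_mul, integral_pow, zero_pow n.succ_ne_zero, pow_succ]
        ring

lemma meanFree_powerLawFlow (n : ℕ) (c ω t y : ℝ) :
    meanFree (powerLawFlow n c ω) t y =
      Real.cos (ω * t) * ((1 / 2) ^ n / ((n : ℝ) + 1) - |y - 1 / 2| ^ n) := by
  simp only [meanFree, powerLawFlow]
  rw [intervalIntegral.integral_const_mul, intervalIntegral.integral_sub
    (by simp) (Continuous.intervalIntegrable (by fun_prop) _ _), integral_abs_sub_half_pow]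
  simp
  ring

end

end TaylorDispersion

/-! ### Assembly of the theorem -/

theorem mainTheorem6 (n : ℕ) (hn₁ : 1 ≤ n) (hn₆ : n ≤ 6) (c ω : ℝ) (hω : 0 < ω) :
    (∀ (Ω : Type*) [mΩ : MeasurableSpace Ω] (P : Measure Ω) [IsProbabilityMeasure P]
      (𝓕 : Filtration ℝ≥0 mΩ) (B Y L₀ L₁ : ℝ≥0 → Ω → ℝ),
      TaylorDispersion.IsReflectedBrownianMotion P 𝓕 B Y L₀ L₁ →
      (∀ t : ℝ≥0, MemLp
        (TaylorDispersion.displacement (TaylorDispersion.powerLawFlow n c ω) Y t) 2 P) ∧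
      Tendsto
        (fun t : ℝ≥0 =>
          (∫ x, TaylorDispersion.displacement (TaylorDispersion.powerLawFlow n c ω) Y t x ^ 2 ∂P)
            / (t : ℝ))
        atTop (𝓝 (TaylorDispersion.closedForm n (Real.sqrt ω)))) ∧
    (∃ f : ℝ → ℝ → ℝ,
      TaylorDispersion.IsOscillatorySolution ω (TaylorDispersion.powerLawFlow n c ω) f) ∧
    (∀ f : ℝ → ℝ → ℝ,
      TaylorDispersion.IsOscillatorySolution ω (TaylorDispersion.powerLawFlow n c ω) f →
      TaylorDispersion.meanSquareGradient ω f =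
        TaylorDispersion.closedForm n (Real.sqrt ω)) := by
  have ha : Continuous fun y : ℝ => (1 / 2) ^ n / ((n : ℝ) + 1) - |y - 1 / 2| ^ n := by fun_prop
  obtain ⟨p, p₁, p₂, q, q₁, q₂, hc⟩ := TaylorDispersion.exists_corrector hω ha
  have hD := TaylorDispersion.integral_mul_corrector hn₁ hn₆ (Real.sqrt_pos.2 hω)
    (by rwa [Real.sq_sqrt hω.le])
  have hsol : TaylorDispersion.IsOscillatorySolution ω (TaylorDispersion.powerLawFlow n c ω)
      (TaylorDispersion.oscillation ω p q) :=
    hc.isOscillatorySolution hω (TaylorDispersion.meanFree_powerLawFlow n c ω)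
  refine ⟨fun Ω _ P _ 𝓕 B Y L₀ L₁ h => ?_, ⟨_, hsol⟩, fun f hf => ?_⟩
  -- The constant `m` of `tendsto_dispersivity` is the channel mean of the profile; subtracting it
  -- removes `c`, so a single corrector serves for all `c`.
  · have hw : (fun y : ℝ => (1 / 2) ^ n / ((n : ℝ) + 1) - |y - 1 / 2| ^ n) =
        fun y => (c - |y - 1 / 2| ^ n) - (c - (1 / 2) ^ n / ((n : ℝ) + 1)) := by
      ext y; ring
    have key := h.tendsto_dispersivity (u := TaylorDispersion.powerLawFlow n c ω) hω
      (w := fun y => c - |y - 1 / 2| ^ n) (by fun_prop) (fun _ _ => rfl) (hw ▸ hc)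
    have hint : -∫ y in (0 : ℝ)..1,
        ((c - |y - 1 / 2| ^ n) - (c - (1 / 2) ^ n / ((n : ℝ) + 1))) * p y =
        TaylorDispersion.closedForm n (Real.sqrt ω) := by
      rw [← neg_eq_iff_eq_neg.2 hD]
      congr 2 with y
      ring
    rwa [hint] at key
  · rw [hf.meanSquareGradient_eq hω hsol, hc.meanSquareGradient_oscillation hω ha, hD, neg_neg]
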